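/- Let $\mathbb D^2\subset\mathbb R^2=\mathbb C$ be the closed unit disk, $\mathbb S^1=\partial\mathbb D^2$, and let $G$ be a subgroup of the group of linear isometries of $\mathbb R^2$ with no common fixed point on $\mathbb S^1$, i.e. for every $x\in\mathbb S^1$ there is $g\in G$ with $g(x)\ne x$. Let $K:\mathbb D^2\to\mathbb R$ and $h:\mathbb S^1\to\mathbb R$ be continuous and $G$-symmetric ($K\circ g=K$, $h\circ g=h$ for all $g\in G$). Put $$\mathbb X_G=\Big\{u\in H^1(\mathbb D^2):\ \int_{\mathbb D^2}Ke^u>0,\ \int_{\mathbb S^1}he^{u/2}>0,\ u\circ g=u\ \ \forall g\in G\Big\},$$ where on $\mathbb S^1$ the function $u$ is understood in the sense of traces, and for $\rho\in[0,2\pi]$ and $u\in\mathbb X_G$ let $$I_\rho(u)=\tfrac12\int_{\mathbb D^2}|\nabla u|^2-2\rho\log\int_{\mathbb D^2}Ke^u+2\int_{\mathbb S^1}u-4(2\pi-\rho)\log\int_{\mathbb S^1}he^{u/2}+4(2\pi-\rho)\log(2\pi-\rho)+2\rho+2\rho\log\rho,$$ with the convention $0\log 0=0$. Let $\|u\|_{H^1}^2=\int_{\mathbb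 D^2}u^2+\int_{\mathbb D^2}|\nabla u|^2$ and $\bar u=\frac1\pi\int_{\mathbb D^2}u$. Then: 1. For all $\rho\in[0,2\pi]$, $u\in\mathbb X_G$ and $c\in\mathbb R$ one has $u+c\in\mathbb X_G$ and $I_\rho(u+c)=I_\rho(u)$. 2. For every $\rho\in[0,2\pi]$, $I_\rho$ is coercive on $\mathbb X_G$ modulo constants: $I_\rho(u)\to+\infty$ as $\|u-\bar u\|_{H^1}\to+\infty$, $u\in\mathbb X_G$. (In particular $I_\rho(u)\to+\infty$ as $\|u\|_{H^1}\to+\infty$, $u\in\mathbb X_G$, $\int_{\mathbb D^2}u=0$.) 3. There are constants $C_1,C_2>0$ and $C\in\mathbb R$, independent of $\rho$ and $u$, such that for all $\rho\in[0,2\pi]$ and all $u\in\mathbb X_G$ with $\int_{\mathbb D^2}u=0$, $$I_\rho(u)\ \ge\ C_1\|u\|_{H^1}^2-C_2\|u\|_{H^1}+C.$$ -/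

import Mathlib

open scoped ContDiff

noncomputable section

namespace DiskCurvature

open MeasureTheory Filter Topology Set

/-- The open unit disk of the plane `ℝ² = ℂ`. -/
def disk : Set ℂ := Metric.ball 0 1

/-- Lebesgue (area) measure on the unit disk. -/
def area : Measure ℂ := volume.restrict disk

/-- Arc length on the unit circle: the image of Lebesgue measure on `(0, 2π]` under
`θ ↦ exp (i θ)`. -/
def arcLength : Measure ℂ :=
  (volume.restrict (Ioc (0 : ℝ) (2 * Real.pi))).map (circleMap 0 1)

/-- `g ∈ L²` is a weak gradient of `u` on the disk: `∫ u ∇φ = - ∫ φ g` for every test function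
`φ ∈ C_c^∞` of the open disk. The plane is identified with `ℂ`, so that gradients are
`ℂ`-valued and `‖g x‖` is their Euclidean length. -/
def IsWeakGradient (u : ℂ → ℝ) (g : ℂ → ℂ) : Prop :=
  MemLp g 2 area ∧
    ∀ φ : ℂ → ℝ, ContDiff ℝ ∞ φ → HasCompactSupport φ → tsupport φ ⊆ disk →
      ∫ x, u x • gradient φ x ∂area = - ∫ x, φ x • g x ∂area

/-- The Sobolev space `H¹` of the disk (as a set of functions; only the values almost everywhere
on the disk matter). -/
def MemH1 (u : ℂ → ℝ) : Prop :=
  MemLp u 2 area ∧ ∃ g : ℂ → ℂ, IsWeakGradient u g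

/-- The weak gradient of an `H¹` function (unique almost everywhere on the disk). -/
def weakGradient (u : ℂ → ℝ) : ℂ → ℂ :=
  Classical.epsilon (IsWeakGradient u)

/-- `t ∈ L²(𝕊¹)` is the boundary trace of `u`: there are smooth functions that converge to `u` in
`H¹` of the disk and whose restrictions to the circle converge to `t` in `L²` of the circle. -/
def IsTrace (u t : ℂ → ℝ) : Prop :=
  MemLp t 2 arcLength ∧
    ∃ φ : ℕ → ℂ → ℝ,
      (∀ n, ContDiff ℝ ∞ (φ n)) ∧
      Tendsto (fun n => eLpNorm (fun x => φ n x - u x) 2 area) atTop (𝓝 0) ∧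
      Tendsto (fun n => eLpNorm (fun x => gradient (φ n) x - weakGradient u x) 2 area)
        atTop (𝓝 0) ∧
      Tendsto (fun n => eLpNorm (fun x => φ n x - t x) 2 arcLength) atTop (𝓝 0)

/-- The boundary trace of an `H¹` function (unique almost everywhere on the circle). -/
def boundaryTrace (u : ℂ → ℝ) : ℂ → ℝ :=
  Classical.epsilon (IsTrace u)

/-- The norm of `H¹`: `‖u‖² = ∫ u² + ∫ |∇u|²`. -/
def h1Norm (u : ℂ → ℝ) : ℝ :=
  Real.sqrt ((∫ x, u x ^ 2 ∂area) + ∫ x, ‖weakGradient u x‖ ^ 2 ∂area)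

/-- `∫_{𝔻²} K e^u`. -/
def bulkMass (K u : ℂ → ℝ) : ℝ :=
  ∫ x, K x * Real.exp (u x) ∂area

/-- `∫_{𝕊¹} h e^{u/2}`. -/
def boundaryMass (h u : ℂ → ℝ) : ℝ :=
  ∫ x, h x * Real.exp (boundaryTrace u x / 2) ∂arcLength

/-- The space `𝕏 = {u ∈ H¹ : ∫_{𝔻²} K e^u > 0, ∫_{𝕊¹} h e^{u/2} > 0}`. -/
def X (K h : ℂ → ℝ) : Set (ℂ → ℝ) :=
  {u | MemH1 u ∧ 0 < bulkMass K u ∧ 0 < boundaryMass h u}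

/-- The space `𝕏_G = {u ∈ 𝕏 : u ∘ g = u for all g ∈ G}`, equality being that of `H¹`. -/
def XG (G : Subgroup (ℂ ≃ₗᵢ[ℝ] ℂ)) (K h : ℂ → ℝ) : Set (ℂ → ℝ) :=
  {u | u ∈ X K h ∧ ∀ g ∈ G, (fun x => u (g x)) =ᵐ[area] u}

/-- The functional `I_ρ`, for `ρ ∈ [0, 2π]`. As `0 * log 0 = 0`, the formula contains the
continuous extension of the last terms to `ρ = 0` and `ρ = 2π`. -/
def I (K h : ℂ → ℝ) (ρ : ℝ) (u : ℂ → ℝ) : ℝ :=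
  1 / 2 * (∫ x, ‖weakGradient u x‖ ^ 2 ∂area)
    - 2 * ρ * Real.log (bulkMass K u)
    + 2 * (∫ x, boundaryTrace u x ∂arcLength)
    - 4 * (2 * Real.pi - ρ) * Real.log (boundaryMass h u)
    + 4 * (2 * Real.pi - ρ) * Real.log (2 * Real.pi - ρ)
    + 2 * ρ + 2 * ρ * Real.log ρ

end DiskCurvature

end

open scoped ENNReal NNReal

namespace DiskCurvature

open MeasureTheory Filter Topology Set

noncomputable section

/-! Without symmetry the problem is borderline. For functions of mean zero the Moser–Trudinger
inequality on the disk and the Lebedev–Milin inequality on the circle bound `log ∫ e^u` by `‖∇u‖² /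
(8π)` and `log ∫ e^(u/2)` by `‖∇u‖² / (16π)` up to constants, and `2ρ / (8π) + 4(2π - ρ) / (16π) =
1/2`, so the Dirichlet term is exactly consumed for every `ρ`. Any improvement of both constants by
one common factor therefore gives coercivity, uniformly in `ρ`.

The improvement comes from a rotation. Two distinct reflections compose to a nontrivial rotation,
and a single reflection has a fixed point on the circle, so `G` contains multiplication by some `ζ ≠
1` (`exists_mul_mem`). A symmetric `u` cannot concentrate at one boundary point `x` without
concentrating at `ζ x` as well.

The inequalities are proved by entropy duality (`lintegral_exp_le_of_le_potential`): if `v` is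
dominated by the potential of an `L²` density, then `∫ e^v` is controlled as soon as the exponential
of the interaction energy of two kernels is integrable. A function on the disk is reflected in the
unit circle, which doubles its energy, and is represented by the kernel `1 / (2π|z - x|)`. The
interaction energy is logarithmic, so its exponential is a power of the distance. Averaging the
kernels at `x` and `ζ x` halves the coefficient of the singularity, and thus doubles the admissible
exponent. Near the origin, where `x` and `ζ x` are close, reflection is unnecessary and the energy
is not doubled. The constants obtained are `1 / (12π)` and `1 / (24π)`; together they use up `1/3`
of `‖∇u‖²`, and `1/6` is left (`exists_le_I`).

This is carried out for smooth functions and transferred to `H¹` and to traces by density, a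
multiplicative trace inequality and Fatou's lemma. The Poincaré inequality turns the remaining
Dirichlet energy into the full norm, and coercivity modulo constants follows from invariance under
constants. -/

/-! ### Entropy duality for exponential integrals -/

theorem mul_le_mul_log_sub_add_exp {a : ℝ} (ha : 0 < a) (b : ℝ) :
    a * b ≤ a * Real.log a - a + Real.exp b := by
  have h := Real.add_one_le_exp (b - Real.log a)
  rw [Real.exp_sub, Real.exp_log ha, le_div_iff₀ ha] at h
  nlinarith

/-- Gibbs' variational formula: for `ρ = e^v / T` with `T = ∫ e^v`, `log T = ∫ ρ v - ∫ ρ log ρ`. If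
`V` is the potential of `ρ`, then `∫ ρ v ≤ B + ‖w‖₂ ‖V‖₂`, and `‖V‖₂²` is the double integral of
`ρ(x) ρ(y) N(x, y)`, where `N = ∫ k k` is the interaction energy. Young's inequality `a b ≤ a log a
- a + e^b` with `b = c N` bounds it by the entropy plus constants, and the entropy cancels. The
bound `M` only makes the entropy finite; it does not enter the estimate. -/
theorem lintegral_exp_le_of_le_potential {X Z : Type*} [MeasurableSpace X] [MeasurableSpace Z]
    (m : Measure X) [IsFiniteMeasure m] (ν : Measure Z) [SFinite ν]
    {k : X → Z → ℝ≥0∞} (hk : Measurable (Function.uncurry k))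
    {w : Z → ℝ≥0∞} (hw : Measurable w) {v : X → ℝ} (hv : Measurable v)
    {M : ℝ} (hM : ∀ᵐ x ∂m, |v x| ≤ M) {c W B C₀ : ℝ} (hc : 0 < c) (hW₀ : 0 ≤ W) (hB : 0 ≤ B)
    (hC₀ : 0 ≤ C₀)
    (hle : ∀ᵐ x ∂m, ENNReal.ofReal (v x) ≤ ENNReal.ofReal B + ∫⁻ z, k x z * w z ∂ν)
    (hW : ∫⁻ z, w z ^ 2 ∂ν ≤ ENNReal.ofReal W)
    (hN : ∀ᵐ x ∂m, (∀ᵐ y ∂m, ∫⁻ z, k x z * k y z ∂ν ≠ ⊤) ∧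
      ∫⁻ y, ENNReal.ofReal (Real.exp (c * (∫⁻ z, k x z * k y z ∂ν).toReal)) ∂m
        ≤ ENNReal.ofReal C₀) :
    ∫⁻ x, ENNReal.ofReal (Real.exp (v x)) ∂m
      ≤ ENNReal.ofReal (Real.exp (B + W / (4 * c) + (m.real univ + C₀))) := by
  rcases eq_or_ne m 0 with rfl | hm
  · simp
  have : NeZero m := ⟨hm⟩
  have hint : Integrable (fun x => Real.exp (v x)) m := by
    refine Integrable.of_bound hv.exp.aestronglyMeasurable (Real.exp M) ?_
    filter_upwards [hM] with x hx
    rw [Real.norm_eq_abs, Real.abs_exp]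
    exact Real.exp_le_exp.2 (le_of_abs_le hx)
  rw [← ofReal_integral_eq_lintegral_ofReal hint (ae_of_all _ fun x => (Real.exp_pos _).le)]
  apply ENNReal.ofReal_le_ofReal
  set T := ∫ x, Real.exp (v x) ∂m with hT
  have hTpos : 0 < T := integral_exp_pos hint
  rw [← Real.log_le_iff_le_exp hTpos]
  set ρ : X → ℝ := fun x => Real.exp (v x) / T with hρ
  have hρpos : ∀ x, 0 < ρ x := fun x => div_pos (Real.exp_pos _) hTpos
  have hρm : Measurable ρ := hv.exp.div_const _
  have hρi : Integrable ρ m := hint.div_const _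
  have hρ1 : ∫ x, ρ x ∂m = 1 := by
    simp only [hρ, integral_div]
    exact div_self hTpos.ne'
  have hlogρ : ∀ x, Real.log (ρ x) = v x - Real.log T := fun x => by
    simp only [hρ, Real.log_div (Real.exp_pos _).ne' hTpos.ne', Real.log_exp]
  have hρvi : Integrable (fun x => ρ x * v x) m := by
    refine Integrable.bdd_mul (c := M) ?_ ?_ ?_ |>.congr (ae_of_all _ fun x => mul_comm (v x) (ρ x))
    · exact hρi
    · exact hv.aestronglyMeasurable
    · simpa using hM
  set S := ∫ x, ρ x * Real.log (ρ x) ∂m with hS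
  have hSi : Integrable (fun x => ρ x * Real.log (ρ x)) m := by
    simp_rw [hlogρ, mul_sub]
    exact hρvi.sub (hρi.mul_const _)
  have hSe : S = ∫ x, ρ x * v x ∂m - Real.log T := by
    rw [hS]
    simp_rw [hlogρ, mul_sub]
    rw [integral_sub hρvi (hρi.mul_const _), integral_mul_const, hρ1, one_mul]
  set R : X → ℝ≥0∞ := fun x => ENNReal.ofReal (ρ x) with hR
  have hRm : Measurable R := hρm.ennreal_ofReal
  have hR1 : ∫⁻ x, R x ∂m = 1 := by
    rw [← ofReal_integral_eq_lintegral_ofReal hρi (ae_of_all _ fun x => (hρpos x).le), hρ1,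
      ENNReal.ofReal_one]
  -- The summand `1` makes the integrand nonnegative, so its lower integral equals the Bochner
  -- integral.
  have hpos : ∀ x, 0 ≤ ρ x * Real.log (ρ x) - ρ x + 1 := fun x => by
    have := mul_le_mul_log_sub_add_exp (hρpos x) 0
    simpa using this
  have hSm : 0 ≤ S - 1 + m.real univ ∧
      ∫⁻ x, ENNReal.ofReal (ρ x * Real.log (ρ x) - ρ x + 1) ∂m
        = ENNReal.ofReal (S - 1 + m.real univ) := by
    have hi2 : Integrable (fun x => ρ x * Real.log (ρ x) - ρ x) m := hSi.sub hρi
    have hi3 : Integrable (fun x => ρ x * Real.log (ρ x) - ρ x + 1) m :=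
      hi2.add (integrable_const 1)
    have e : ∫ x, (ρ x * Real.log (ρ x) - ρ x + 1) ∂m = S - 1 + m.real univ := by
      rw [integral_add hi2 (integrable_const _), integral_sub hSi hρi, hρ1]
      simp [hS]
    constructor
    · rw [← e]; exact integral_nonneg hpos
    · rw [← e, ofReal_integral_eq_lintegral_ofReal hi3 (ae_of_all _ hpos)]
  set Q := (S + m.real univ + C₀) / c with hQ
  have hQ0 : 0 ≤ Q := div_nonneg (by linarith [hSm.1]) hc.le
  set V : Z → ℝ≥0∞ := fun z => ∫⁻ x, R x * k x z ∂m with hV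
  have hkx : ∀ x, Measurable (k x) := fun x => hk.comp measurable_prodMk_left
  have hkz : ∀ z, Measurable (fun x => k x z) := fun z => hk.comp measurable_prodMk_right
  have hRkz : ∀ z, Measurable (fun x => R x * k x z) := fun z => hRm.mul (hkz z)
  have hkk : ∀ x y, Measurable (fun z => k x z * k y z) := fun x y => (hkx x).mul (hkx y)
  have hkw : ∀ x, Measurable (fun z => k x z * w z) := fun x => (hkx x).mul hw
  have hRk : Measurable (fun p : Z × X => R p.2 * k p.2 p.1) :=
    (hRm.comp measurable_snd).mul (hk.comp measurable_swap)
  have hVm : Measurable V := hRk.lintegral_prod_right'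
  have hV2 : ∫⁻ z, V z ^ 2 ∂ν ≤ ENNReal.ofReal Q := by
    have e1 : ∀ z, V z ^ 2 = ∫⁻ x, R x * (∫⁻ y, R y * (k x z * k y z) ∂m) ∂m := fun z => by
      rw [pow_two]
      conv_lhs => rw [hV]; dsimp only
      rw [← lintegral_mul_const _ (hRkz z)]
      refine lintegral_congr fun x => ?_
      rw [mul_assoc, ← lintegral_const_mul _ (hRkz z)]
      congr 1
      refine lintegral_congr fun y => ?_
      ring
    have e2 : ∫⁻ z, V z ^ 2 ∂ν
        = ∫⁻ x, R x * (∫⁻ y, R y * (∫⁻ z, k x z * k y z ∂ν) ∂m) ∂m := by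
      simp_rw [e1]
      rw [lintegral_lintegral_swap]
      · refine lintegral_congr fun x => ?_
        rw [lintegral_const_mul]
        · rw [lintegral_lintegral_swap]
          · congr 1
            refine lintegral_congr fun y => ?_
            rw [lintegral_const_mul _ (hkk x y)]
          · apply Measurable.aemeasurable
            exact (hRm.comp measurable_snd).mul (((hkx x).comp measurable_fst).mul
              (hk.comp measurable_swap))
        · refine Measurable.lintegral_prod_right' (f := fun q : Z × X => R q.2 * (k x q.1 * k q.2 q.1)) ?_
          exact (hRm.comp measurable_snd).mul (((hkx x).comp measurable_fst).mul
              (hk.comp measurable_swap))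
      · apply Measurable.aemeasurable
        refine (hRm.comp measurable_snd).mul ?_
        refine Measurable.lintegral_prod_right'
          (f := fun q : (Z × X) × X => R q.2 * (k q.1.2 q.1.1 * k q.2 q.1.1)) ?_
        exact (hRm.comp measurable_snd).mul
          ((hk.comp ((measurable_snd.comp measurable_fst).prodMk
            (measurable_fst.comp measurable_fst))).mul
          (hk.comp (measurable_snd.prodMk (measurable_fst.comp measurable_fst))))
    rw [e2]
    calc _ ≤ ∫⁻ x, R x * ENNReal.ofReal Q ∂m := by
          apply lintegral_mono_ae
          filter_upwards [hN] with x hx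
          gcongr
          have hp : ∀ᵐ y ∂m, R y * (∫⁻ z, k x z * k y z ∂ν) ≤ ENNReal.ofReal c⁻¹ *
              (ENNReal.ofReal (ρ y * Real.log (ρ y) - ρ y + 1) +
              ENNReal.ofReal (Real.exp (c * (∫⁻ z, k x z * k y z ∂ν).toReal))) := by
            filter_upwards [hx.1] with y hy
            rw [← ENNReal.ofReal_add (hpos y) (Real.exp_pos _).le,
              ← ENNReal.ofReal_mul (inv_pos.2 hc).le]
            conv_lhs => rw [← ENNReal.ofReal_toReal hy]
            rw [hR, ← ENNReal.ofReal_mul (hρpos y).le]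
            apply ENNReal.ofReal_le_ofReal
            rw [inv_mul_eq_div, le_div_iff₀ hc]
            have := mul_le_mul_log_sub_add_exp (hρpos y) (c * (∫⁻ z, k x z * k y z ∂ν).toReal)
            nlinarith
          calc _ ≤ _ := lintegral_mono_ae hp
            _ = ENNReal.ofReal c⁻¹ * (ENNReal.ofReal (S - 1 + m.real univ) +
              ∫⁻ y, ENNReal.ofReal (Real.exp (c * (∫⁻ z, k x z * k y z ∂ν).toReal)) ∂m) := by
              rw [lintegral_const_mul', lintegral_add_left, hSm.2]
              · exact (((hρm.mul hρm.log).sub hρm).add_const 1).ennreal_ofReal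
              · exact ENNReal.ofReal_ne_top
            _ ≤ ENNReal.ofReal c⁻¹ * (ENNReal.ofReal (S - 1 + m.real univ) +
                ENNReal.ofReal C₀) := by gcongr; exact hx.2
            _ ≤ ENNReal.ofReal Q := by
              rw [← ENNReal.ofReal_add hSm.1 hC₀, ← ENNReal.ofReal_mul (inv_pos.2 hc).le]
              apply ENNReal.ofReal_le_ofReal
              rw [hQ, inv_mul_eq_div]
              gcongr
              linarith
      _ = ENNReal.ofReal Q := by rw [lintegral_mul_const _ hRm, hR1, one_mul]
  have hJ : ∫⁻ x, R x * (∫⁻ z, k x z * w z ∂ν) ∂m ≤ ENNReal.ofReal (√W * √Q) := by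
    have e : ∫⁻ x, R x * (∫⁻ z, k x z * w z ∂ν) ∂m = ∫⁻ z, (w * V) z ∂ν := by
      have : ∀ x, R x * (∫⁻ z, k x z * w z ∂ν) = ∫⁻ z, R x * (k x z * w z) ∂ν := fun x => by
        rw [lintegral_const_mul _ (hkw x)]
      simp_rw [this]
      rw [lintegral_lintegral_swap]
      · refine lintegral_congr fun z => ?_
        simp only [Pi.mul_apply, hV]
        rw [← lintegral_const_mul _ (hRkz z)]
        refine lintegral_congr fun x => ?_
        ring
      · exact ((hRm.comp measurable_fst).mul (hk.mul (hw.comp measurable_snd))).aemeasurable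
    rw [e]
    refine (ENNReal.lintegral_mul_le_Lp_mul_Lq ν Real.HolderConjugate.two_two
      hw.aemeasurable hVm.aemeasurable).trans ?_
    rw [ENNReal.ofReal_mul (Real.sqrt_nonneg _), Real.sqrt_eq_rpow, Real.sqrt_eq_rpow,
      ← ENNReal.ofReal_rpow_of_nonneg hW₀ (by norm_num),
      ← ENNReal.ofReal_rpow_of_nonneg hQ0 (by norm_num)]
    gcongr
    · simpa using hW
    · simpa using hV2
  have hρv : ∫ x, ρ x * v x ∂m ≤ B + √W * √Q := by
    have h1 : ENNReal.ofReal (∫ x, ρ x * v x ∂m) ≤ ENNReal.ofReal (B + √W * √Q) := by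
      calc ENNReal.ofReal (∫ x, ρ x * v x ∂m)
          ≤ ∫⁻ x, ENNReal.ofReal (ρ x * v x) ∂m := by
            rw [integral_eq_lintegral_pos_part_sub_lintegral_neg_part hρvi]
            refine (ENNReal.ofReal_le_ofReal (sub_le_self _ ENNReal.toReal_nonneg)).trans ?_
            exact ENNReal.ofReal_toReal_le
        _ ≤ ∫⁻ x, (R x * ENNReal.ofReal B + R x * ∫⁻ z, k x z * w z ∂ν) ∂m := by
            apply lintegral_mono_ae
            filter_upwards [hle] with x hx
            rw [ENNReal.ofReal_mul (hρpos x).le, ← mul_add]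
            gcongr
        _ = ENNReal.ofReal B + ∫⁻ x, R x * (∫⁻ z, k x z * w z ∂ν) ∂m := by
            rw [lintegral_add_left (hRm.mul_const _), lintegral_mul_const _ hRm, hR1, one_mul]
        _ ≤ _ := by
            rw [ENNReal.ofReal_add hB (by positivity)]
            gcongr
    exact (ENNReal.ofReal_le_ofReal_iff (by positivity)).1 h1
  have hcQ : c * Q = S + m.real univ + C₀ := by rw [hQ]; field_simp
  -- The weight in this AM–GM is chosen so that `c * Q` contains the entropy `S` with coefficient
  -- one, which cancels the `-S` in `log T`.
  have ham : √W * √Q ≤ W / (4 * c) + c * Q := by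
    have h1 : W / (4 * c) + c * Q - √W * √Q = (√W / (2 * √c) - √c * √Q) ^ 2 := by
      have hsc : √c ≠ 0 := (Real.sqrt_pos.2 hc).ne'
      have : (√W / (2 * √c) - √c * √Q) ^ 2
          = √W ^ 2 / (4 * √c ^ 2) + √c ^ 2 * √Q ^ 2 - √W * √Q := by
        field_simp
        ring
      rw [this, Real.sq_sqrt hW₀, Real.sq_sqrt hc.le, Real.sq_sqrt hQ0]
    nlinarith [sq_nonneg (√W / (2 * √c) - √c * √Q)]
  linarith

/-! ### Polar coordinates and the interaction of two kernels -/

theorem lintegral_polar (f : ℂ → ℝ≥0∞) (hf : Measurable f) (a : ℂ) :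
    ∫⁻ z, f z = ∫⁻ θ in Ioo (-Real.pi) Real.pi, ∫⁻ r in Ioi (0 : ℝ),
      ENNReal.ofReal r * f (a + circleMap 0 r θ) := by
  rw [← lintegral_add_left_eq_self f a, ← Complex.lintegral_comp_polarCoord_symm]
  have hm : Measurable fun p : ℝ × ℝ => ENNReal.ofReal p.1 * f (a + circleMap 0 p.1 p.2) := by
    refine (ENNReal.measurable_ofReal.comp measurable_fst).mul (hf.comp ?_)
    unfold circleMap
    fun_prop
  have e : ∀ p : ℝ × ℝ, ENNReal.ofReal p.1 • f (a + Complex.polarCoord.symm p)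
      = ENNReal.ofReal p.1 * f (a + circleMap 0 p.1 p.2) := fun p => by
    rw [smul_eq_mul, Complex.polarCoord_symm_apply, circleMap, Complex.exp_mul_I]
    simp
  simp_rw [e]
  rw [polarCoord_target, Measure.volume_eq_prod, ← Measure.prod_restrict,
    lintegral_prod_symm _ hm.aemeasurable]

theorem lintegral_norm_sub (f : ℝ → ℝ≥0∞) (hf : Measurable f) (a : ℂ) :
    ∫⁻ z : ℂ, f ‖z - a‖
      = ENNReal.ofReal (2 * Real.pi) * ∫⁻ r in Ioi (0 : ℝ), ENNReal.ofReal r * f r := by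
  rw [lintegral_polar (fun z => f ‖z - a‖) (by fun_prop) a]
  have : ∀ θ : ℝ, ∫⁻ r in Ioi (0 : ℝ), ENNReal.ofReal r * f ‖a + circleMap 0 r θ - a‖
      = ∫⁻ r in Ioi (0 : ℝ), ENNReal.ofReal r * f r := fun θ => by
    refine setLIntegral_congr_fun measurableSet_Ioi fun r hr => ?_
    simp [abs_of_pos (mem_Ioi.1 hr)]
  simp_rw [this]
  rw [setLIntegral_const, mul_comm, Real.volume_Ioo]
  congr 2
  ring

/-- Integral of a radial function about `a` over a set contained in `ball a R`. -/
theorem setLIntegral_norm_sub_le (f : ℝ → ℝ≥0∞) (hf : Measurable f) {a : ℂ} {R : ℝ} {s : Set ℂ}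
    (hs : s ⊆ Metric.ball a R) :
    ∫⁻ z in s, f ‖z - a‖
      ≤ ENNReal.ofReal (2 * Real.pi) * ∫⁻ r in Ioo 0 R, ENNReal.ofReal r * f r := by
  have h1 : ∫⁻ z in Metric.ball a R, f ‖z - a‖ = ∫⁻ z, (Iio R).indicator f ‖z - a‖ := by
    rw [← lintegral_indicator Metric.isOpen_ball.measurableSet]
    refine lintegral_congr fun z => ?_
    simp [indicator, dist_eq_norm]
  refine (lintegral_mono_set hs).trans ?_
  rw [h1, lintegral_norm_sub _ (hf.indicator measurableSet_Iio)]
  refine mul_le_mul' le_rfl (le_of_eq ?_)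
  have : ∀ r, ENNReal.ofReal r * (Iio R).indicator f r
      = (Iio R).indicator (fun r => ENNReal.ofReal r * f r) r := fun r => by
    simp [indicator]
  simp_rw [this]
  rw [lintegral_indicator measurableSet_Iio, Measure.restrict_restrict measurableSet_Iio]
  rw [inter_comm, Ioi_inter_Iio]

theorem lintegral_rpow_Ioo_lt_top {s : ℝ} (hs : -1 < s) (R : ℝ) :
    ∫⁻ r in Ioo 0 R, ENNReal.ofReal (r ^ s) < ⊤ := by
  have h := (intervalIntegral.intervalIntegrable_rpow' (a := 0) (b := R) hs).1
  refine lt_of_le_of_lt (lintegral_mono_set Ioo_subset_Ioc_self) ?_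
  exact h.lintegral_lt_top

theorem exists_lintegral_area_rpow_le {s : ℝ} (hs : s < 2) :
    ∃ C : ℝ, 0 ≤ C ∧ ∀ a ∈ Metric.closedBall (0 : ℂ) 1,
      ∫⁻ y, ENNReal.ofReal (‖y - a‖ ^ (-s)) ∂area ≤ ENNReal.ofReal C := by
  refine ⟨(ENNReal.ofReal (2 * Real.pi) * ∫⁻ r in Ioo (0 : ℝ) 2, ENNReal.ofReal (r ^ (1 - s))).toReal,
    ENNReal.toReal_nonneg, fun a ha => ?_⟩
  rw [ENNReal.ofReal_toReal (ENNReal.mul_ne_top ENNReal.ofReal_ne_top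
    (lintegral_rpow_Ioo_lt_top (s := 1 - s) (by linarith) 2).ne)]
  have hsub : disk ⊆ Metric.ball a 2 := fun z hz => by
    simp only [disk, Metric.mem_ball, dist_zero_right, mem_closedBall_zero_iff] at hz ha ⊢
    rw [dist_eq_norm]
    linarith [norm_sub_le z a]
  refine (setLIntegral_norm_sub_le (fun r => ENNReal.ofReal (r ^ (-s))) (by fun_prop) hsub).trans ?_
  refine mul_le_mul_right ?_ _
  refine (setLIntegral_congr_fun measurableSet_Ioo fun r hr => ?_).le
  rw [← ENNReal.ofReal_mul hr.1.le]
  congr 1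
  rw [sub_eq_add_neg, Real.rpow_add hr.1, Real.rpow_one]

/-- Near-diagonal cut-off of `1 / (2 r ^ 2)`. -/
def splitKernel (d r : ℝ) : ℝ := if r < d / 2 then 2 / d * r⁻¹ else 1 / 2 * (r⁻¹) ^ 2

theorem measurable_splitKernel (d : ℝ) : Measurable (splitKernel d) :=
  Measurable.ite measurableSet_Iio (by fun_prop) (by fun_prop)

theorem splitKernel_nonneg {d r : ℝ} (hd : 0 < d) (hr : 0 ≤ r) : 0 ≤ splitKernel d r := by
  unfold splitKernel; split_ifs <;> positivity

/-- If `r < d / 2` then `s > d / 2`, so `s⁻¹ ≤ 2 / d`; symmetrically for `s`. If neither is small,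
AM–GM applies. The factor `1 / 2` in AM–GM makes the total coefficient of the logarithm sharp. -/
theorem inv_mul_inv_le_splitKernel {d r s : ℝ} (hd : 0 < d) (hr : 0 ≤ r) (hs : 0 ≤ s)
    (h : d ≤ r + s) : r⁻¹ * s⁻¹ ≤ splitKernel d r + splitKernel d s := by
  have key : ∀ {r s : ℝ}, 0 ≤ r → d ≤ r + s → r < d / 2 → r⁻¹ * s⁻¹ ≤ splitKernel d r := by
    intro r s hr h hrd
    rw [splitKernel, if_pos hrd, mul_comm]
    gcongr
    rw [inv_le_comm₀ (by linarith) (by positivity), inv_div]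
    linarith
  rcases lt_or_ge r (d / 2) with h1 | h1
  · linarith [key hr h h1, splitKernel_nonneg hd hs]
  rcases lt_or_ge s (d / 2) with h2 | h2
  · linarith [key (s := r) hs (by linarith) h2, splitKernel_nonneg hd hr, mul_comm r⁻¹ s⁻¹]
  rw [splitKernel, splitKernel, if_neg h1.not_gt, if_neg h2.not_gt]
  nlinarith [sq_nonneg (r⁻¹ - s⁻¹)]

/-- The inner part contributes the `1`, the outer part half of `∫ dr / r` from `d / 2` to `3`, since
`ball 0 2 ⊆ ball a 3`; hence `log (6 / d)`. -/
theorem lintegral_splitKernel_le {d : ℝ} (hd : 0 < d) (hd2 : d ≤ 2) {a : ℂ} (ha : ‖a‖ ≤ 1) :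
    ∫⁻ z in Metric.ball (0 : ℂ) 2, ENNReal.ofReal (splitKernel d ‖z - a‖)
      ≤ ENNReal.ofReal (2 * Real.pi * (1 + 1 / 2 * Real.log (6 / d))) := by
  have hsub : Metric.ball (0 : ℂ) 2 ⊆ Metric.ball a 3 := fun z hz => by
    simp only [Metric.mem_ball, dist_zero_right] at hz ⊢
    rw [dist_eq_norm]
    linarith [norm_sub_le z a]
  have hlog : 0 ≤ Real.log (6 / d) := Real.log_nonneg (by rw [le_div_iff₀ hd]; linarith)
  refine (setLIntegral_norm_sub_le (fun r => ENNReal.ofReal (splitKernel d r))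
    (measurable_splitKernel d).ennreal_ofReal hsub).trans ?_
  rw [ENNReal.ofReal_mul (p := 2 * Real.pi) (by positivity)]
  refine mul_le_mul_right ?_ _
  have hun : Ioo (0 : ℝ) 3 ⊆ Ioo 0 (d / 2) ∪ Icc (d / 2) 3 := fun r hr => by
    rcases lt_or_ge r (d / 2) with h | h
    · exact Or.inl ⟨hr.1, h⟩
    · exact Or.inr ⟨h, hr.2.le⟩
  refine (lintegral_mono_set hun).trans ((lintegral_union_le _ _ _).trans ?_)
  rw [ENNReal.ofReal_add zero_le_one (by positivity)]
  gcongr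
  · calc _ = ∫⁻ r in Ioo 0 (d / 2), ENNReal.ofReal (2 / d) := by
          refine setLIntegral_congr_fun measurableSet_Ioo fun r hr => ?_
          rw [← ENNReal.ofReal_mul hr.1.le, splitKernel, if_pos hr.2]
          have := hr.1.ne'
          congr 1
          field_simp
      _ = ENNReal.ofReal 1 := by
          rw [setLIntegral_const, Real.volume_Ioo, ← ENNReal.ofReal_mul (by positivity)]
          congr 1
          field_simp
          ring
      _ ≤ _ := le_rfl
  · have hd0 : 0 < d / 2 := by positivity
    have hd3 : d / 2 ≤ 3 := by linarith
    have hint : IntegrableOn (fun r : ℝ => 1 / 2 * r⁻¹) (Icc (d / 2) 3) := by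
      apply ContinuousOn.integrableOn_Icc
      exact continuousOn_const.mul (continuousOn_inv₀.mono fun r hr => (hd0.trans_le hr.1).ne')
    calc _ = ∫⁻ r in Icc (d / 2) 3, ENNReal.ofReal (1 / 2 * r⁻¹) := by
          refine setLIntegral_congr_fun measurableSet_Icc fun r hr => ?_
          have hr0 : 0 < r := hd0.trans_le hr.1
          rw [← ENNReal.ofReal_mul hr0.le, splitKernel, if_neg hr.1.not_gt]
          congr 1
          field_simp
      _ = ENNReal.ofReal (∫ r in Icc (d / 2) 3, 1 / 2 * r⁻¹) := by
          rw [ofReal_integral_eq_lintegral_ofReal hint]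
          filter_upwards [ae_restrict_mem measurableSet_Icc] with r hr
          have hr0 : 0 < r := hd0.trans_le hr.1
          positivity
      _ ≤ _ := by
          rw [integral_Icc_eq_integral_Ioc, ← intervalIntegral.integral_of_le hd3,
            intervalIntegral.integral_const_mul, integral_inv_of_pos hd0 (by norm_num)]
          apply le_of_eq
          congr 3
          field_simp
          norm_num

theorem lintegral_inv_mul_inv_le {a b : ℂ} (ha : ‖a‖ ≤ 1) (hb : ‖b‖ ≤ 1) (hab : a ≠ b) :
    ∫⁻ z in Metric.ball (0 : ℂ) 2, ‖z - a‖ₑ⁻¹ * ‖z - b‖ₑ⁻¹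
      ≤ ENNReal.ofReal (2 * Real.pi * (2 + Real.log (6 / ‖a - b‖))) := by
  have hd : 0 < ‖a - b‖ := norm_pos_iff.2 (sub_ne_zero.2 hab)
  have hd2 : ‖a - b‖ ≤ 2 := by linarith [norm_sub_le a b]
  have hlog : 0 ≤ Real.log (6 / ‖a - b‖) := Real.log_nonneg (by rw [le_div_iff₀ hd]; linarith)
  calc ∫⁻ z in Metric.ball (0 : ℂ) 2, ‖z - a‖ₑ⁻¹ * ‖z - b‖ₑ⁻¹
      ≤ ∫⁻ z in Metric.ball (0 : ℂ) 2, (ENNReal.ofReal (splitKernel ‖a - b‖ ‖z - a‖) +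
          ENNReal.ofReal (splitKernel ‖a - b‖ ‖z - b‖)) := by
        apply lintegral_mono_ae
        filter_upwards [(Measure.ae_ne (volume.restrict _) a), (Measure.ae_ne (volume.restrict _) b)]
          with z hza hzb
        have h1 : 0 < ‖z - a‖ := norm_pos_iff.2 (sub_ne_zero.2 hza)
        have h2 : 0 < ‖z - b‖ := norm_pos_iff.2 (sub_ne_zero.2 hzb)
        rw [← ENNReal.ofReal_add (splitKernel_nonneg hd h1.le) (splitKernel_nonneg hd h2.le),
          ← ofReal_norm, ← ofReal_norm, ← ENNReal.ofReal_inv_of_pos h1,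
          ← ENNReal.ofReal_inv_of_pos h2, ← ENNReal.ofReal_mul (by positivity)]
        apply ENNReal.ofReal_le_ofReal
        apply inv_mul_inv_le_splitKernel hd h1.le h2.le
        have := norm_sub_le (z - b) (z - a)
        rw [sub_sub_sub_cancel_left] at this
        linarith
    _ ≤ _ := by
        rw [lintegral_add_left]
        · refine (add_le_add (lintegral_splitKernel_le hd hd2 ha)
            (lintegral_splitKernel_le hd hd2 hb)).trans ?_
          rw [← ENNReal.ofReal_add (by positivity) (by positivity)]
          apply ENNReal.ofReal_le_ofReal
          apply le_of_eq
          ring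
        · exact ((measurable_splitKernel _).comp (by fun_prop)).ennreal_ofReal

/-! ### Arc length: rotation invariance and singular integrals -/

theorem setLIntegral_Ioc_of_periodic {f : ℝ → ℝ≥0∞} {T : ℝ} (hT : 0 < T)
    (hf : Function.Periodic f T) (s t : ℝ) :
    ∫⁻ x in Ioc s (s + T), f x = ∫⁻ x in Ioc t (t + T), f x := by
  have : VAddInvariantMeasure (AddSubgroup.zmultiples T) ℝ volume :=
    ⟨fun c s _ => measure_preimage_add _ _ _⟩
  apply IsAddFundamentalDomain.setLIntegral_eq (G := AddSubgroup.zmultiples T)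
  exacts [isAddFundamentalDomain_Ioc hT s, isAddFundamentalDomain_Ioc hT t, hf.map_vadd_zmultiples]

theorem lintegral_arcLength {f : ℂ → ℝ≥0∞} (hf : Measurable f) :
    ∫⁻ y, f y ∂arcLength = ∫⁻ θ in Ioc (-Real.pi) Real.pi, f (circleMap 0 1 θ) := by
  rw [arcLength, lintegral_map hf (continuous_circleMap 0 1).measurable]
  have := setLIntegral_Ioc_of_periodic Real.two_pi_pos
    (f := fun θ => f (circleMap 0 1 θ)) (fun θ => by simp only [periodic_circleMap 0 1 θ]) 0 (-Real.pi)
  rw [zero_add] at this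
  rw [this]
  congr 3
  ring

theorem map_mul_arcLength {c : ℂ} (hc : ‖c‖ = 1) : arcLength.map (c * ·) = arcLength := by
  obtain ⟨α, hα⟩ := (Complex.norm_eq_one_iff c).1 hc
  refine Measure.ext_of_lintegral _ fun f hf => ?_
  rw [lintegral_map hf (by fun_prop), lintegral_arcLength hf,
    lintegral_arcLength (f := fun y => f (c * y)) (hf.comp (by fun_prop))]
  have e : ∀ θ, f (c * circleMap 0 1 θ) = f (circleMap 0 1 (α + θ)) := fun θ => by
    simp [circleMap, ← hα, ← Complex.exp_add, add_mul]
  simp_rw [e]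
  have h2 := (measurePreserving_add_left volume α).setLIntegral_comp_preimage_emb
    (measurableEmbedding_addLeft α) (fun θ => f (circleMap 0 1 θ))
    (Ioc (α + -Real.pi) (α + -Real.pi + 2 * Real.pi))
  have h3 : (fun x => α + x) ⁻¹' Ioc (α + -Real.pi) (α + -Real.pi + 2 * Real.pi)
      = Ioc (-Real.pi) Real.pi := by
    ext x
    simp only [mem_preimage, mem_Ioc]
    constructor <;> rintro ⟨h, h'⟩ <;> constructor <;> linarith
  rw [h3] at h2
  rw [h2, setLIntegral_Ioc_of_periodic Real.two_pi_pos (t := -Real.pi)]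
  · congr 3
    ring
  · intro θ
    simp only [periodic_circleMap 0 1 θ]

theorem ae_arcLength_norm : ∀ᵐ y ∂arcLength, ‖y‖ = 1 := by
  rw [arcLength, ae_map_iff (continuous_circleMap 0 1).aemeasurable
    (measurableSet_eq_fun (by fun_prop) (by fun_prop))]
  exact ae_of_all _ fun θ => by simp

instance : IsFiniteMeasure area := by
  unfold area disk
  exact ⟨by simpa using measure_ball_lt_top⟩

instance : IsFiniteMeasure arcLength := by
  unfold arcLength
  infer_instance

/-- By rotation invariance `a` may be taken to be `1`, and the chord from `1` to `e^(iθ)` has length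
at least `2|θ| / π`; what remains is a power of `|θ|` on an interval. -/
theorem exists_lintegral_arcLength_rpow_le {s : ℝ} (hs₀ : 0 ≤ s) (hs : s < 1) :
    ∃ C : ℝ, 0 ≤ C ∧ ∀ a ∈ Metric.sphere (0 : ℂ) 1,
      ∫⁻ y, ENNReal.ofReal (‖y - a‖ ^ (-s)) ∂arcLength ≤ ENNReal.ofReal C := by
  set J := ENNReal.ofReal ((2 / Real.pi) ^ (-s)) *
    (2 * ∫⁻ r in Ioo (0 : ℝ) 4, ENNReal.ofReal (r ^ (-s))) with hJ
  have hJt : J ≠ ⊤ := ENNReal.mul_ne_top ENNReal.ofReal_ne_top (ENNReal.mul_ne_top (by simp)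
    (lintegral_rpow_Ioo_lt_top (s := -s) (by linarith) 4).ne)
  refine ⟨J.toReal, ENNReal.toReal_nonneg, fun a ha => ?_⟩
  rw [ENNReal.ofReal_toReal hJt]
  have ha1 : ‖a‖ = 1 := by simpa using ha
  have hm : ∀ a : ℂ, Measurable fun y : ℂ => ENNReal.ofReal (‖y - a‖ ^ (-s)) := fun a => by fun_prop
  have h1 : ∫⁻ y, ENNReal.ofReal (‖y - a‖ ^ (-s)) ∂arcLength
      = ∫⁻ y, ENNReal.ofReal (‖y - 1‖ ^ (-s)) ∂arcLength := by
    conv_lhs => rw [← map_mul_arcLength ha1]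
    rw [lintegral_map (hm a) (by fun_prop)]
    refine lintegral_congr fun y => ?_
    have : a * y - a = a * (y - 1) := by ring
    rw [this, norm_mul, ha1, one_mul]
  rw [h1, lintegral_arcLength (hm 1)]
  have hb : ∀ θ ∈ Ioc (-Real.pi) Real.pi, θ ≠ 0 →
      ENNReal.ofReal (‖circleMap 0 1 θ - 1‖ ^ (-s))
        ≤ ENNReal.ofReal ((2 / Real.pi) ^ (-s)) * ENNReal.ofReal (|θ| ^ (-s)) := fun θ hθ h0 => by
    rw [← ENNReal.ofReal_mul (by positivity), ← Real.mul_rpow (by positivity) (abs_nonneg _)]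
    apply ENNReal.ofReal_le_ofReal
    apply Real.rpow_le_rpow_of_nonpos
    · have := abs_pos.2 h0
      positivity
    · have e : circleMap 0 1 θ = Complex.exp (Complex.I * θ) := by simp [circleMap, mul_comm]
      rw [e, Complex.norm_exp_I_mul_ofReal_sub_one, Real.norm_eq_abs, abs_mul, abs_two]
      have h2 : |θ / 2| ≤ Real.pi / 2 := by
        rw [abs_le]; constructor <;> linarith [hθ.1, hθ.2]
      have := Real.mul_abs_le_abs_sin h2
      rw [abs_div, abs_two] at this
      linarith
    · linarith
  calc _ ≤ ∫⁻ θ in Ioc (-Real.pi) Real.pi,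
        ENNReal.ofReal ((2 / Real.pi) ^ (-s)) * ENNReal.ofReal (|θ| ^ (-s)) := by
        apply lintegral_mono_ae
        filter_upwards [ae_restrict_mem measurableSet_Ioc, Measure.ae_ne _ (0 : ℝ)] with θ h1 h2
        exact hb θ h1 h2
    _ ≤ J := by
        rw [lintegral_const_mul _ (by fun_prop), hJ]
        gcongr
        have hun : Ioc (-Real.pi) Real.pi ⊆ Ioo (-4) 0 ∪ ({0} ∪ Ioo 0 4) := fun θ hθ => by
          have := Real.pi_lt_four
          rcases lt_trichotomy θ 0 with h | h | h
          · exact Or.inl ⟨by linarith [hθ.1], h⟩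
          · exact Or.inr (Or.inl h)
          · exact Or.inr (Or.inr ⟨h, by linarith [hθ.2]⟩)
        have hp : ∫⁻ θ in Ioo (0 : ℝ) 4, ENNReal.ofReal (|θ| ^ (-s))
            = ∫⁻ r in Ioo (0 : ℝ) 4, ENNReal.ofReal (r ^ (-s)) :=
          setLIntegral_congr_fun measurableSet_Ioo fun r hr => by simp only [abs_of_pos hr.1]
        have hn : ∫⁻ θ in Ioo (-4 : ℝ) 0, ENNReal.ofReal (|θ| ^ (-s))
            = ∫⁻ θ in Ioo (0 : ℝ) 4, ENNReal.ofReal (|θ| ^ (-s)) := by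
          have := (Measure.measurePreserving_neg (volume : Measure ℝ)).setLIntegral_comp_preimage_emb
            (MeasurableEquiv.neg ℝ).measurableEmbedding
            (fun θ : ℝ => ENNReal.ofReal (|θ| ^ (-s))) (Ioo 0 4)
          simpa using this
        refine (lintegral_mono_set hun).trans ((lintegral_union_le _ _ _).trans ?_)
        rw [hn, two_mul, hp]
        refine add_le_add_right ?_ _
        refine (lintegral_union_le _ _ _).trans ?_
        rw [hp]
        simp

/-! ### Logarithmic interaction energies and their exponentials -/

/-- The kernel of the logarithmic potential: modulus of the gradient of the Newtonian kernel. -/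
def newtonKernel (x z : ℂ) : ℝ≥0∞ := ENNReal.ofReal (2 * Real.pi)⁻¹ * ‖z - x‖ₑ⁻¹

/-- The average of the kernel at `x` and at the rotated point `ζ * x`. -/
def symKernel (ζ x z : ℂ) : ℝ≥0∞ :=
  ENNReal.ofReal (4 * Real.pi)⁻¹ * (‖z - x‖ₑ⁻¹ + ‖z - ζ * x‖ₑ⁻¹)

theorem measurable_newtonKernel : Measurable (Function.uncurry newtonKernel) := by
  unfold newtonKernel Function.uncurry
  fun_prop

theorem measurable_symKernel (ζ : ℂ) : Measurable (Function.uncurry (symKernel ζ)) := by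
  unfold symKernel Function.uncurry
  fun_prop

/-- The logarithm that controls the interaction of two kernels at distance `d`. -/
def logKernel (d : ℝ) : ℝ := 2 + Real.log (6 / d)

theorem logKernel_nonneg {d : ℝ} (hd : 0 < d) (hd2 : d ≤ 2) : 0 ≤ logKernel d := by
  have : 0 ≤ Real.log (6 / d) := Real.log_nonneg (by rw [le_div_iff₀ hd]; linarith)
  unfold logKernel
  linarith

theorem logKernel_anti {d e : ℝ} (hd : 0 < d) (hde : d ≤ e) : logKernel e ≤ logKernel d := by
  unfold logKernel
  have := hd.trans_le hde
  gcongr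

/-- Turns the exponential of an interaction energy into a power of the distance, whose integrability
decides which constants are admissible. -/
theorem exp_mul_logKernel {d s : ℝ} (hd : 0 < d) :
    Real.exp (s * logKernel d) = Real.exp (2 * s) * 6 ^ s * d ^ (-s) := by
  rw [logKernel, Real.log_div (by norm_num) hd.ne', Real.rpow_def_of_pos (by norm_num : (0:ℝ) < 6),
    Real.rpow_def_of_pos hd, ← Real.exp_add, ← Real.exp_add]
  congr 1
  ring

theorem lintegral_newtonKernel_mul_le {x y : ℂ} (hx : ‖x‖ ≤ 1) (hy : ‖y‖ ≤ 1) (hxy : x ≠ y) :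
    ∫⁻ z in Metric.ball (0 : ℂ) 2, newtonKernel x z * newtonKernel y z
      ≤ ENNReal.ofReal ((2 * Real.pi)⁻¹ * logKernel ‖x - y‖) := by
  have e : ∀ z, newtonKernel x z * newtonKernel y z
      = ENNReal.ofReal ((2 * Real.pi)⁻¹ * (2 * Real.pi)⁻¹) * (‖z - x‖ₑ⁻¹ * ‖z - y‖ₑ⁻¹) := fun z => by
    rw [ENNReal.ofReal_mul (by positivity), newtonKernel, newtonKernel]
    ring
  simp_rw [e]
  rw [lintegral_const_mul _ (by fun_prop)]
  refine (mul_le_mul_right (lintegral_inv_mul_inv_le hx hy hxy) _).trans (le_of_eq ?_)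
  rw [← ENNReal.ofReal_mul (by positivity), logKernel]
  congr 1
  field_simp

/-- Expanding the product gives four interactions; those of `x, y` and of `ζ x, ζ y` agree, hence
the `2`. On the diagonal the logarithm has coefficient `1 / (4π)`, half of that in
`lintegral_newtonKernel_mul_le`. -/
theorem lintegral_symKernel_mul_le {ζ x y : ℂ} (hζ : ‖ζ‖ = 1) (hx : ‖x‖ ≤ 1) (hy : ‖y‖ ≤ 1)
    (h₁ : x ≠ y) (h₂ : ζ * x ≠ y) (h₃ : x ≠ ζ * y) :
    ∫⁻ z in Metric.ball (0 : ℂ) 2, symKernel ζ x z * symKernel ζ y z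
      ≤ ENNReal.ofReal ((8 * Real.pi)⁻¹ * (2 * logKernel ‖x - y‖ + logKernel ‖ζ * x - y‖
        + logKernel ‖x - ζ * y‖)) := by
  have hζ0 : ζ ≠ 0 := norm_ne_zero_iff.1 (by rw [hζ]; exact one_ne_zero)
  have e : ∀ z, symKernel ζ x z * symKernel ζ y z
      = ENNReal.ofReal ((4 * Real.pi)⁻¹ * (4 * Real.pi)⁻¹) *
        ((‖z - x‖ₑ⁻¹ * ‖z - y‖ₑ⁻¹ + ‖z - ζ * x‖ₑ⁻¹ * ‖z - ζ * y‖ₑ⁻¹) +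
        (‖z - ζ * x‖ₑ⁻¹ * ‖z - y‖ₑ⁻¹ + ‖z - x‖ₑ⁻¹ * ‖z - ζ * y‖ₑ⁻¹)) := fun z => by
    rw [ENNReal.ofReal_mul (by positivity), symKernel, symKernel]
    ring
  have hnx : ‖ζ * x‖ ≤ 1 := by rwa [norm_mul, hζ, one_mul]
  have hny : ‖ζ * y‖ ≤ 1 := by rwa [norm_mul, hζ, one_mul]
  have h4 : ζ * x ≠ ζ * y := fun h => h₁ (mul_left_cancel₀ hζ0 h)
  have pos : ∀ {a b : ℂ}, ‖a‖ ≤ 1 → ‖b‖ ≤ 1 → a ≠ b → 0 ≤ logKernel ‖a - b‖ := fun {a b} ha hb h =>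
    logKernel_nonneg (norm_pos_iff.2 (sub_ne_zero.2 h)) (by linarith [norm_sub_le a b])
  have p1 := pos hx hy h₁
  have p2 := pos hnx hy h₂
  have p3 := pos hx hny h₃
  have p4 := pos hnx hny h4
  simp_rw [e]
  rw [lintegral_const_mul _ (by fun_prop), lintegral_add_left (by fun_prop),
    lintegral_add_left (by fun_prop), lintegral_add_left (by fun_prop)]
  have hn : ∀ {a b : ℂ}, ‖a‖ ≤ 1 → ‖b‖ ≤ 1 → a ≠ b →
      ∫⁻ z in Metric.ball (0 : ℂ) 2, ‖z - a‖ₑ⁻¹ * ‖z - b‖ₑ⁻¹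
        ≤ ENNReal.ofReal (2 * Real.pi * logKernel ‖a - b‖) := lintegral_inv_mul_inv_le
  refine (mul_le_mul_right (add_le_add (add_le_add (hn hx hy h₁) (hn hnx hny h4))
    (add_le_add (hn hnx hy h₂) (hn hx hny h₃))) _).trans (le_of_eq ?_)
  have e4 : ‖ζ * x - ζ * y‖ = ‖x - y‖ := by rw [← mul_sub, norm_mul, hζ, one_mul]
  rw [e4] at p4 ⊢
  rw [← ENNReal.ofReal_add (by positivity) (by positivity),
    ← ENNReal.ofReal_add (by positivity) (by positivity),
    ← ENNReal.ofReal_add (by positivity) (by positivity), ← ENNReal.ofReal_mul (by positivity)]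
  congr 1
  field_simp
  ring

/-- The choice `c = 2πθ` in the duality lemma cancels the factor `1 / (2π)` of the interaction, so
`e^(c N)` is a multiple of `|x - y|^(-θ)`. -/
theorem exists_lintegral_exp_le_of_newtonKernel (m : Measure ℂ) [IsFiniteMeasure m] [NullSingletonClass m]
    {θ Cp : ℝ} (hθ : 0 < θ) (hCp : 0 ≤ Cp)
    (hm : ∀ᵐ x ∂m, ‖x‖ ≤ 1 ∧ ∫⁻ y, ENNReal.ofReal (‖y - x‖ ^ (-θ)) ∂m ≤ ENNReal.ofReal Cp) :
    ∃ C₀ : ℝ, ∀ {w : ℂ → ℝ≥0∞} (_ : Measurable w) {v : ℂ → ℝ} (_ : Measurable v)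
      {M : ℝ} (_ : ∀ᵐ x ∂m, |v x| ≤ M) {W B : ℝ} (_ : 0 ≤ W) (_ : 0 ≤ B)
      (_ : ∀ᵐ x ∂m, ENNReal.ofReal (v x) ≤ ENNReal.ofReal B +
        ∫⁻ z in Metric.ball (0 : ℂ) 2, newtonKernel x z * w z)
      (_ : ∫⁻ z in Metric.ball (0 : ℂ) 2, w z ^ 2 ≤ ENNReal.ofReal W),
      ∫⁻ x, ENNReal.ofReal (Real.exp (v x)) ∂m
        ≤ ENNReal.ofReal (Real.exp (B + W / (8 * Real.pi * θ) + C₀)) := by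
  set A := Real.exp (2 * θ) * 6 ^ θ with hA
  refine ⟨m.real univ + A * Cp, fun {w} hw {v} hv {M} hM {W B} hW₀ hB hle hW => ?_⟩
  have e : 8 * Real.pi * θ = 4 * (2 * Real.pi * θ) := by ring
  rw [e]
  refine lintegral_exp_le_of_le_potential m (volume.restrict (Metric.ball (0 : ℂ) 2))
    measurable_newtonKernel hw hv hM (by positivity) hW₀ hB (by positivity) hle hW ?_
  filter_upwards [hm] with x hx
  have hy : ∀ᵐ y ∂m, ‖y‖ ≤ 1 ∧ x ≠ y := by
    filter_upwards [hm, Measure.ae_ne m x] with y h1 h2 using ⟨h1.1, h2.symm⟩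
  constructor
  · filter_upwards [hy] with y hy
    exact ((lintegral_newtonKernel_mul_le hx.1 hy.1 hy.2).trans_lt ENNReal.ofReal_lt_top).ne
  · calc _ ≤ ∫⁻ y, ENNReal.ofReal A * ENNReal.ofReal (‖y - x‖ ^ (-θ)) ∂m := by
          apply lintegral_mono_ae
          filter_upwards [hy] with y hy
          have hd : 0 < ‖x - y‖ := norm_pos_iff.2 (sub_ne_zero.2 hy.2)
          have hl := logKernel_nonneg hd (by linarith [norm_sub_le x y])
          have h := ENNReal.toReal_le_of_le_ofReal (by positivity)
            (lintegral_newtonKernel_mul_le hx.1 hy.1 hy.2)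
          rw [← ENNReal.ofReal_mul (by positivity)]
          apply ENNReal.ofReal_le_ofReal
          rw [norm_sub_rev y x, hA, ← exp_mul_logKernel hd]
          apply Real.exp_le_exp.2
          calc _ ≤ 2 * Real.pi * θ * ((2 * Real.pi)⁻¹ * logKernel ‖x - y‖) := by gcongr
            _ = _ := by field_simp
      _ ≤ _ := by
          rw [lintegral_const_mul _ (by fun_prop), ENNReal.ofReal_mul (p := A) (by positivity)]
          exact mul_le_mul_right hx.2 _

/-- Again `c = 2πθ`, but the logarithms at `y = x` and at `y = ζ x, ζ⁻¹ x` now enter with total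
weights `θ / 2` each. Since `x` and `ζ x` are `2η` apart, the first is never large together with the
others, so only integrability of the power `-θ / 2` is needed: symmetrization doubles the admissible
`θ`. -/
theorem exists_lintegral_exp_le_of_symKernel (m : Measure ℂ) [IsFiniteMeasure m] [NullSingletonClass m]
    {ζ : ℂ} (hζ : ‖ζ‖ = 1) {η θ Cp : ℝ} (hη : 0 < η) (hη2 : η ≤ 2) (hθ : 0 < θ) (hCp : 0 ≤ Cp)
    (hm : ∀ᵐ x ∂m, ‖x‖ ≤ 1 ∧ 2 * η ≤ ‖ζ * x - x‖ ∧ ∀ a : ℂ, ‖a‖ = ‖x‖ →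
      ∫⁻ y, ENNReal.ofReal (‖y - a‖ ^ (-(θ / 2))) ∂m ≤ ENNReal.ofReal Cp) :
    ∃ C₀ : ℝ, ∀ {w : ℂ → ℝ≥0∞} (_ : Measurable w) {v : ℂ → ℝ} (_ : Measurable v)
      {M : ℝ} (_ : ∀ᵐ x ∂m, |v x| ≤ M) {W B : ℝ} (_ : 0 ≤ W) (_ : 0 ≤ B)
      (_ : ∀ᵐ x ∂m, ENNReal.ofReal (v x) ≤ ENNReal.ofReal B +
        ∫⁻ z in Metric.ball (0 : ℂ) 2, symKernel ζ x z * w z)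
      (_ : ∫⁻ z in Metric.ball (0 : ℂ) 2, w z ^ 2 ≤ ENNReal.ofReal W),
      ∫⁻ x, ENNReal.ofReal (Real.exp (v x)) ∂m
        ≤ ENNReal.ofReal (Real.exp (B + W / (8 * Real.pi * θ) + C₀)) := by
  have hζ0 : ζ ≠ 0 := norm_ne_zero_iff.1 (by rw [hζ]; exact one_ne_zero)
  set A := Real.exp (2 * (θ / 2)) * 6 ^ (θ / 2) with hA
  set E := Real.exp (θ / 2 * logKernel η) with hE
  have hη0 := logKernel_nonneg hη hη2
  have hE1 : 0 < E := Real.exp_pos _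
  refine ⟨m.real univ + E * A * (Cp + Cp + Cp), fun {w} hw {v} hv {M} hM {W B} hW₀ hB hle hW => ?_⟩
  have e : 8 * Real.pi * θ = 4 * (2 * Real.pi * θ) := by ring
  rw [e]
  refine lintegral_exp_le_of_le_potential m (volume.restrict (Metric.ball (0 : ℂ) 2))
    (measurable_symKernel ζ) hw hv hM (by positivity) hW₀ hB (by positivity) hle hW ?_
  filter_upwards [hm] with x hx
  have hy : ∀ᵐ y ∂m, ‖y‖ ≤ 1 ∧ x ≠ y ∧ ζ * x ≠ y ∧ x ≠ ζ * y := by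
    filter_upwards [hm, Measure.ae_ne m x, Measure.ae_ne m (ζ * x), Measure.ae_ne m (ζ⁻¹ * x)]
      with y h1 h2 h3 h4
    refine ⟨h1.1, h2.symm, h3.symm, fun h => h4 ?_⟩
    rw [h, inv_mul_cancel_left₀ hζ0]
  constructor
  · filter_upwards [hy] with y hy
    exact ((lintegral_symKernel_mul_le hζ hx.1 hy.1 hy.2.1 hy.2.2.1 hy.2.2.2).trans_lt
      ENNReal.ofReal_lt_top).ne
  · calc _ ≤ ∫⁻ y, ENNReal.ofReal (E * A) * ((ENNReal.ofReal (‖y - x‖ ^ (-(θ / 2))) +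
          ENNReal.ofReal (‖y - ζ * x‖ ^ (-(θ / 2)))) +
          ENNReal.ofReal (‖y - ζ⁻¹ * x‖ ^ (-(θ / 2)))) ∂m := by
          apply lintegral_mono_ae
          filter_upwards [hy] with y hy
          obtain ⟨hy1, h1, h2, h3⟩ := hy
          have hnx : ‖ζ * x‖ ≤ 1 := by rw [norm_mul, hζ, one_mul]; exact hx.1
          have hny : ‖ζ * y‖ ≤ 1 := by rwa [norm_mul, hζ, one_mul]
          have d1 : 0 < ‖x - y‖ := norm_pos_iff.2 (sub_ne_zero.2 h1)
          have d2 : 0 < ‖ζ * x - y‖ := norm_pos_iff.2 (sub_ne_zero.2 h2)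
          have d3 : 0 < ‖x - ζ * y‖ := norm_pos_iff.2 (sub_ne_zero.2 h3)
          have p1 := logKernel_nonneg d1 (by linarith [norm_sub_le x y])
          have p2 := logKernel_nonneg d2 (by linarith [norm_sub_le (ζ * x) y])
          have p3 := logKernel_nonneg d3 (by linarith [norm_sub_le x (ζ * y)])
          have h := ENNReal.toReal_le_of_le_ofReal (by positivity)
            (lintegral_symKernel_mul_le hζ hx.1 hy1 h1 h2 h3)
          rw [← ENNReal.ofReal_add (by positivity) (by positivity),
            ← ENNReal.ofReal_add (by positivity) (by positivity),
            ← ENNReal.ofReal_mul (by positivity)]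
          apply ENNReal.ofReal_le_ofReal
          have e3 : ‖y - ζ⁻¹ * x‖ = ‖x - ζ * y‖ := by
            have : x - ζ * y = -(ζ * (y - ζ⁻¹ * x)) := by
              rw [mul_sub, mul_inv_cancel_left₀ hζ0]; ring
            rw [this, norm_neg, norm_mul, hζ, one_mul]
          rw [norm_sub_rev y x, norm_sub_rev y (ζ * x), e3, mul_assoc E A, mul_add A, mul_add A, hA,
            ← exp_mul_logKernel d1, ← exp_mul_logKernel d2, ← exp_mul_logKernel d3]
          set l1 := logKernel ‖x - y‖
          set l2 := logKernel ‖ζ * x - y‖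
          set l3 := logKernel ‖x - ζ * y‖
          have hexp : Real.exp (2 * Real.pi * θ * (∫⁻ z in Metric.ball (0 : ℂ) 2,
              symKernel ζ x z * symKernel ζ y z).toReal)
              ≤ Real.exp (θ / 2 * l1 + θ / 4 * (l2 + l3)) := by
            apply Real.exp_le_exp.2
            calc _ ≤ 2 * Real.pi * θ * ((8 * Real.pi)⁻¹ * (2 * l1 + l2 + l3)) := by gcongr
              _ = _ := by field_simp; ring
          refine hexp.trans ?_
          have q1 := Real.exp_pos (θ / 2 * l1)
          have q2 := Real.exp_pos (θ / 2 * l2)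
          have q3 := Real.exp_pos (θ / 2 * l3)
          -- Off the diagonal `l1` is bounded. There `l2` and `l3` may be singular at the same point
          -- (when `ζ² = 1`), so their sum is replaced by twice the larger one. Near the diagonal
          -- both are bounded by the triangle inequality.
          rcases le_or_gt η ‖x - y‖ with hη1 | hη1
          · have hl1 : l1 ≤ logKernel η := logKernel_anti hη hη1
            rcases le_total l2 l3 with h23 | h23
            · calc _ ≤ Real.exp (θ / 2 * logKernel η + θ / 2 * l3) := by
                    apply Real.exp_le_exp.2
                    nlinarith
                _ = E * Real.exp (θ / 2 * l3) := by rw [Real.exp_add]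
                _ ≤ _ := by gcongr; linarith
            · calc _ ≤ Real.exp (θ / 2 * logKernel η + θ / 2 * l2) := by
                    apply Real.exp_le_exp.2
                    nlinarith
                _ = E * Real.exp (θ / 2 * l2) := by rw [Real.exp_add]
                _ ≤ _ := by gcongr; linarith
          · have t2 : η ≤ ‖ζ * x - y‖ := by
              have := norm_add_le (ζ * x - y) (y - x)
              rw [sub_add_sub_cancel, norm_sub_rev y x] at this
              linarith [hx.2.1]
            have t3 : η ≤ ‖x - ζ * y‖ := by
              have := norm_add_le (ζ * x - ζ * y) (ζ * y - x)
              rw [sub_add_sub_cancel, norm_sub_rev (ζ * y) x, ← mul_sub, norm_mul, hζ,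
                one_mul] at this
              linarith [hx.2.1]
            have hl2 : l2 ≤ logKernel η := logKernel_anti hη t2
            have hl3 : l3 ≤ logKernel η := logKernel_anti hη t3
            calc _ ≤ Real.exp (θ / 2 * logKernel η + θ / 2 * l1) := by
                    apply Real.exp_le_exp.2
                    nlinarith
                _ = E * Real.exp (θ / 2 * l1) := by rw [Real.exp_add]
                _ ≤ _ := by gcongr; linarith
      _ ≤ _ := by
          rw [lintegral_const_mul _ (by fun_prop), ENNReal.ofReal_mul (p := E * A) (by positivity),
            lintegral_add_right _ (by fun_prop), lintegral_add_right _ (by fun_prop),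
            ENNReal.ofReal_add (by positivity) (by positivity), ENNReal.ofReal_add hCp hCp]
          have hn : ‖ζ⁻¹‖ = 1 := by rw [norm_inv, hζ, inv_one]
          gcongr
          · exact hx.2.2 x rfl
          · exact hx.2.2 _ (by rw [norm_mul, hζ, one_mul])
          · exact hx.2.2 _ (by rw [norm_mul, hn, one_mul])

/-! ### Representation by integration along rays -/

theorem circleMap_zero_eq_smul (r θ : ℝ) : circleMap 0 r θ = r • circleMap 0 1 θ := by
  simp [circleMap]

/-- The squared norm is a monic quadratic in `r`, so a line meets a circle at most twice. These are
the exceptional points for the fundamental theorem of calculus along rays. -/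
theorem countable_norm_add_circleMap_eq (x : ℂ) (θ R : ℝ) :
    {r : ℝ | ‖x + circleMap 0 r θ‖ = R}.Countable := by
  set e := circleMap 0 1 θ with he
  have he1 : ‖e‖ = 1 := by simp [he]
  have hsq : ∀ r : ℝ, ‖x + circleMap 0 r θ‖ ^ 2 = ‖x‖ ^ 2 + 2 * (r * inner ℝ x e) + r ^ 2 := fun r => by
    rw [circleMap_zero_eq_smul, norm_add_sq_real, inner_smul_right, norm_smul, ← he, he1, mul_one,
      Real.norm_eq_abs, sq_abs]
  rcases Set.eq_empty_or_nonempty {r : ℝ | ‖x + circleMap 0 r θ‖ = R} with h | ⟨s, hs⟩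
  · rw [h]; exact countable_empty
  · refine (Set.Finite.subset (Set.toFinite {s, -s - 2 * inner ℝ x e}) fun r hr => ?_).countable
    have h1 := hsq r
    have h2 := hsq s
    rw [show ‖x + circleMap 0 r θ‖ = R from hr] at h1
    rw [show ‖x + circleMap 0 s θ‖ = R from hs, h1] at h2
    have h3 : (r - s) * (r - (-s - 2 * inner ℝ x e)) = 0 := by linear_combination h2
    rcases mul_eq_zero.1 h3 with h | h
    · exact Or.inl (by linarith)
    · exact Or.inr (by simpa using (by linarith : r = -s - 2 * inner ℝ x e))

/-- Integrate the derivative along each ray from `x` out to where `F` vanishes, then average over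
directions: the polar Jacobian produces the kernel `1 / (2π|z - x|)`. Differentiability is asked
only off the unit circle, because a reflected function has a kink there. -/
theorem enorm_le_lintegral_newtonKernel {F : ℂ → ℝ} (hF : Continuous F)
    (h2 : ∀ z, 2 ≤ ‖z‖ → F z = 0) {M : ℝ}
    (hd : ∀ z, ‖z‖ ≠ 1 → DifferentiableAt ℝ F z ∧ ‖fderiv ℝ F z‖ ≤ M) {x : ℂ} (hx : ‖x‖ ≤ 1) :
    ‖F x‖ₑ ≤ ∫⁻ z in Metric.ball (0 : ℂ) 2, newtonKernel x z * ‖fderiv ℝ F z‖ₑ := by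
  set w : ℂ → ℝ≥0∞ := (Metric.ball (0 : ℂ) 2).indicator fun z => ‖fderiv ℝ F z‖ₑ with hw
  have hwm : Measurable w :=
    (measurable_fderiv ℝ F).enorm.indicator Metric.isOpen_ball.measurableSet
  have hM : 0 ≤ M := (norm_nonneg _).trans (hd 0 (by simp)).2
  have hray : ∀ θ : ℝ, ‖F x‖ₑ ≤ ∫⁻ r in Ioi (0 : ℝ), w (x + circleMap 0 r θ) := fun θ => by
    set f : ℝ → ℝ := fun r => F (x + circleMap 0 r θ) with hf
    set e := circleMap 0 1 θ with he
    have he1 : ‖e‖ = 1 := by simp [he]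
    set s := {r : ℝ | ‖x + circleMap 0 r θ‖ = 1} ∪ {r : ℝ | ‖x + circleMap 0 r θ‖ = 2} with hs
    have hsc : s.Countable := (countable_norm_add_circleMap_eq x θ 1).union
      (countable_norm_add_circleMap_eq x θ 2)
    have hline : ∀ r : ℝ, HasDerivAt (fun r : ℝ => x + circleMap 0 r θ) e r := fun r => by
      have h0 : (fun r : ℝ => x + circleMap 0 r θ) = fun r : ℝ => x + r • e := by
        funext r; rw [circleMap_zero_eq_smul]
      rw [h0]
      simpa using ((hasDerivAt_id r).smul_const e).const_add x
    have hcont : Continuous f := hF.comp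
      (continuous_iff_continuousAt.2 fun r => (hline r).continuousAt)
    have hder : ∀ r ∉ s, HasDerivAt f (deriv f r) r ∧ ‖deriv f r‖ₑ ≤ w (x + circleMap 0 r θ) ∧
        ‖deriv f r‖ ≤ M := fun r hr => by
      have hr1 : ‖x + circleMap 0 r θ‖ ≠ 1 := fun h => hr (Or.inl h)
      have hr2 : ‖x + circleMap 0 r θ‖ ≠ 2 := fun h => hr (Or.inr h)
      obtain ⟨hdz, hMz⟩ := hd _ hr1
      have hD : HasDerivAt f (fderiv ℝ F (x + circleMap 0 r θ) e) r :=
        hdz.hasFDerivAt.comp_hasDerivAt r (hline r)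
      have hn : ‖deriv f r‖ ≤ ‖fderiv ℝ F (x + circleMap 0 r θ)‖ := by
        rw [hD.deriv]
        simpa [he1] using (fderiv ℝ F (x + circleMap 0 r θ)).le_opNorm e
      refine ⟨hD.differentiableAt.hasDerivAt, ?_, hn.trans hMz⟩
      rcases lt_or_gt_of_ne hr2 with h | h
      · rw [hw, indicator_of_mem (by simpa using h)]
        exact enorm_le_iff_norm_le.2 hn
      · have h0 : F =ᶠ[𝓝 (x + circleMap 0 r θ)] fun _ => 0 := by
          filter_upwards [(isOpen_lt continuous_const continuous_norm).mem_nhds h] with z hz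
          exact h2 z (le_of_lt hz)
        rw [h0.fderiv_eq] at hn
        have : ‖deriv f r‖ = 0 := le_antisymm (by simpa using hn) (norm_nonneg _)
        rw [enorm_eq_nnnorm, nnnorm_eq_zero.2 (norm_eq_zero.1 this)]
        simp
    have hint : IntervalIntegrable (deriv f) volume 0 3 := by
      rw [intervalIntegrable_iff]
      refine Measure.integrableOn_of_bounded (M := M) (by simp) (by fun_prop) ?_
      have := ae_restrict_of_ae (s := uIoc 0 3) (μ := volume) (hsc.ae_notMem volume)
      filter_upwards [this] with r hr using (hder r hr).2.2
    have hftc := integral_eq_of_hasDerivAt_off_countable_of_le f (deriv f) (by norm_num : (0:ℝ) ≤ 3)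
      hsc hcont.continuousOn (fun r hr => (hder r hr.2).1) hint
    -- As `‖x‖ ≤ 1`, the point at parameter `3` has norm at least `2`.
    have hf3 : f 3 = 0 := h2 _ (by
      have := norm_sub_le (x + circleMap 0 3 θ) x
      rw [add_sub_cancel_left] at this
      simp at this
      linarith)
    have hf0 : f 0 = F x := by simp [hf]
    rw [hf3, hf0, zero_sub] at hftc
    rw [← enorm_neg, ← hftc, intervalIntegral.integral_of_le (by norm_num)]
    refine (enorm_integral_le_lintegral_enorm _).trans ?_
    refine le_trans ?_ (lintegral_mono_set (fun r (hr : r ∈ Ioc (0 : ℝ) 3) => hr.1))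
    apply lintegral_mono_ae
    have := ae_restrict_of_ae (s := Ioc 0 3) (μ := volume) (hsc.ae_notMem volume)
    filter_upwards [this] with r hr using (hder r hr).2.1
  have hpol := lintegral_polar (fun z => ‖z - x‖ₑ⁻¹ * w z) (by fun_prop) x
  have hin : ∀ θ : ℝ, ∫⁻ r in Ioi (0 : ℝ), ENNReal.ofReal r * (‖x + circleMap 0 r θ - x‖ₑ⁻¹ *
      w (x + circleMap 0 r θ)) = ∫⁻ r in Ioi (0 : ℝ), w (x + circleMap 0 r θ) := fun θ => by
    refine setLIntegral_congr_fun measurableSet_Ioi fun r hr => ?_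
    have hr0 : 0 < r := hr
    rw [add_sub_cancel_left, ← ofReal_norm, norm_circleMap_zero, abs_of_pos hr0,
      ← mul_assoc, ENNReal.mul_inv_cancel (by simpa using hr0) ENNReal.ofReal_ne_top, one_mul]
  simp_rw [hin] at hpol
  have hge : ENNReal.ofReal (2 * Real.pi) * ‖F x‖ₑ ≤ ∫⁻ z, ‖z - x‖ₑ⁻¹ * w z := by
    rw [hpol]
    calc _ = ∫⁻ _ in Ioo (-Real.pi) Real.pi, ‖F x‖ₑ := by
          rw [setLIntegral_const, Real.volume_Ioo, mul_comm]
          congr 2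
          ring
      _ ≤ _ := lintegral_mono fun θ => hray θ
  calc ‖F x‖ₑ = ENNReal.ofReal (2 * Real.pi)⁻¹ * (ENNReal.ofReal (2 * Real.pi) * ‖F x‖ₑ) := by
        rw [← mul_assoc, ← ENNReal.ofReal_mul (by positivity), inv_mul_cancel₀ (by positivity),
          ENNReal.ofReal_one, one_mul]
    _ ≤ ENNReal.ofReal (2 * Real.pi)⁻¹ * ∫⁻ z, ‖z - x‖ₑ⁻¹ * w z := by gcongr
    _ = ∫⁻ z in Metric.ball (0 : ℂ) 2, newtonKernel x z * ‖fderiv ℝ F z‖ₑ := by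
        rw [← lintegral_const_mul _ (by fun_prop),
          ← lintegral_indicator Metric.isOpen_ball.measurableSet]
        refine lintegral_congr fun z => ?_
        by_cases hz : z ∈ Metric.ball (0 : ℂ) 2
        · simp only [hw, indicator_of_mem hz, newtonKernel, mul_assoc]
        · simp only [hw, indicator_of_notMem hz, mul_zero]

/-! ### Inversion, reflection and potential estimates up to the boundary -/

/-- Inversion in the unit circle. -/
def circleInv (z : ℂ) : ℂ := (starRingEnd ℂ) z⁻¹

/-- The real derivative of the inversion. -/
def circleInvDeriv (z : ℂ) : ℂ →L[ℝ] ℂ :=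
  (Complex.conjCLE : ℂ →L[ℝ] ℂ) ∘L
    ((ContinuousLinearMap.toSpanSingleton ℂ (-(z ^ 2)⁻¹)).restrictScalars ℝ)

theorem hasFDerivAt_circleInv {z : ℂ} (hz : z ≠ 0) :
    HasFDerivAt circleInv (circleInvDeriv z) z := by
  have h := ((hasDerivAt_inv hz).hasFDerivAt.restrictScalars ℝ)
  exact (Complex.conjCLE : ℂ →L[ℝ] ℂ).hasFDerivAt.comp z h

theorem norm_circleInvDeriv_le (z : ℂ) : ‖circleInvDeriv z‖ ≤ (‖z‖ ^ 2)⁻¹ := by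
  refine ContinuousLinearMap.opNorm_le_bound _ (by positivity) fun h => ?_
  simp [circleInvDeriv, mul_comm]

theorem abs_det_circleInvDeriv (z : ℂ) : |(circleInvDeriv z).det| = ((‖z‖ ^ 2)⁻¹) ^ 2 := by
  have h1 : ((circleInvDeriv z : ℂ →L[ℝ] ℂ) : ℂ →ₗ[ℝ] ℂ)
      = (Complex.conjAe.toLinearMap) ∘ₗ (LinearMap.mulLeft ℝ (-(z ^ 2)⁻¹)) := by
    ext <;> simp [circleInvDeriv, mul_comm]
  have h2 : LinearMap.det (LinearMap.mulLeft ℝ (-(z ^ 2)⁻¹)) = Complex.normSq (-(z ^ 2)⁻¹) := by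
    rw [← Algebra.norm_complex_apply, Algebra.norm_apply]
    rfl
  rw [ContinuousLinearMap.det, h1, LinearMap.det_comp, h2, Complex.det_conjAe, Complex.normSq_eq_norm_sq]
  simp

/-- Change of variables under the inversion, whose Jacobian is `|z|⁻⁴`; the image of the annulus is
only part of the disk, hence an inequality. The weight is also the square of the factor `|z|⁻²` in
the reflected gradient: the conformal invariance of the Dirichlet integral. -/
theorem lintegral_comp_circleInv_le {g : ℂ → ℝ≥0∞} :
    ∫⁻ z in Metric.ball (0 : ℂ) 2 \ Metric.closedBall 0 1,
      ENNReal.ofReal (((‖z‖ ^ 2)⁻¹) ^ 2) * g (circleInv z) ≤ ∫⁻ z, g z ∂area := by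
  set s := Metric.ball (0 : ℂ) 2 \ Metric.closedBall 0 1 with hs
  have hsm : MeasurableSet s := Metric.isOpen_ball.measurableSet.diff Metric.isClosed_closedBall.measurableSet
  have h1 : ∀ z ∈ s, 1 < ‖z‖ := fun z hz => by simpa using hz.2
  have h0 : ∀ z ∈ s, z ≠ 0 := fun z hz h => by have := h1 z hz; rw [h, norm_zero] at this; linarith
  have hinj : InjOn circleInv s := fun a _ b _ hab => by
    exact inv_injective (star_injective hab)
  have h := lintegral_image_eq_lintegral_abs_det_fderiv_mul volume hsm
    (fun z hz => (hasFDerivAt_circleInv (h0 z hz)).hasFDerivWithinAt) hinj g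
  simp_rw [abs_det_circleInvDeriv] at h
  rw [← h]
  refine lintegral_mono_set ?_
  rintro _ ⟨z, hz, rfl⟩
  simp only [disk, circleInv, Metric.mem_ball, dist_zero_right, RCLike.norm_conj, norm_inv]
  exact inv_lt_one_of_one_lt₀ (h1 z hz)

theorem enorm_zero_dual : ‖(0 : ℂ →L[ℝ] ℝ)‖ₑ = 0 := by
  rw [← ofReal_norm, norm_zero, ENNReal.ofReal_zero]

theorem enorm_add_dual_le (A B : ℂ →L[ℝ] ℝ) : ‖A + B‖ₑ ≤ ‖A‖ₑ + ‖B‖ₑ := by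
  simp only [← ofReal_norm]
  rw [← ENNReal.ofReal_add (norm_nonneg _) (norm_nonneg _)]
  exact ENNReal.ofReal_le_ofReal (norm_add_le _ _)

theorem enorm_smul_dual (c : ℝ) (A : ℂ →L[ℝ] ℝ) : ‖c • A‖ₑ = ‖c‖ₑ * ‖A‖ₑ := by
  simp only [← ofReal_norm]
  rw [← ENNReal.ofReal_mul (norm_nonneg _), norm_smul]

theorem area_univ : area univ = ENNReal.ofReal Real.pi := by
  rw [area, Measure.restrict_apply_univ, disk, Complex.volume_ball, ENNReal.ofReal_one, one_pow,
    one_mul, ← NNReal.coe_real_pi, ENNReal.ofReal_coe_nnreal]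

/-- Identity on the closed unit disk, inversion in the unit circle outside. -/
def foldDisk (z : ℂ) : ℂ := ((max 1 ‖z‖ ^ 2)⁻¹ : ℝ) • z

theorem continuous_foldDisk : Continuous foldDisk := by
  unfold foldDisk
  refine Continuous.smul (Continuous.inv₀ ((continuous_const.max continuous_norm).pow 2) fun z => ?_) continuous_id
  have : (0 : ℝ) < max 1 ‖z‖ := lt_of_lt_of_le one_pos (le_max_left _ _)
  exact pow_ne_zero 2 this.ne'

theorem foldDisk_of_norm_le {z : ℂ} (hz : ‖z‖ ≤ 1) : foldDisk z = z := by
  simp [foldDisk, max_eq_left hz]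

theorem foldDisk_of_le_norm {z : ℂ} (hz : 1 ≤ ‖z‖) : foldDisk z = circleInv z := by
  rw [foldDisk, max_eq_right hz, circleInv, Complex.inv_def]
  simp [Complex.normSq_eq_norm_sq, mul_comm]

theorem norm_foldDisk_le (z : ℂ) : ‖foldDisk z‖ ≤ 1 := by
  rcases le_total ‖z‖ 1 with h | h
  · rwa [foldDisk_of_norm_le h]
  · rw [foldDisk_of_le_norm h, circleInv]
    simpa using inv_le_one_of_one_le₀ h

/-- Length of the gradient of the reflection of `φ` in the unit circle. -/
def reflectedGradient (φ : ℂ → ℝ) (z : ℂ) : ℝ≥0∞ :=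
  ENNReal.ofReal (max 1 ‖z‖ ^ 2)⁻¹ * ‖fderiv ℝ φ (foldDisk z)‖ₑ

theorem measurable_reflectedGradient (φ : ℂ → ℝ) : Measurable (reflectedGradient φ) := by
  unfold reflectedGradient
  refine Measurable.mul (ENNReal.measurable_ofReal.comp
    ((continuous_const.max continuous_norm).pow 2).measurable.inv) ?_
  exact ((measurable_fderiv ℝ φ).comp continuous_foldDisk.measurable).enorm

theorem reflectedGradient_of_norm_le (φ : ℂ → ℝ) {z : ℂ} (hz : ‖z‖ ≤ 1) :
    reflectedGradient φ z = ‖fderiv ℝ φ z‖ₑ := by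
  simp [reflectedGradient, max_eq_left hz, foldDisk_of_norm_le hz]

theorem reflectedGradient_of_le_norm (φ : ℂ → ℝ) {z : ℂ} (hz : 1 ≤ ‖z‖) :
    reflectedGradient φ z = ENNReal.ofReal (‖z‖ ^ 2)⁻¹ * ‖fderiv ℝ φ (circleInv z)‖ₑ := by
  simp only [reflectedGradient, max_eq_right hz, foldDisk_of_le_norm hz]

/-- One copy of the energy comes from the disk and at most one from the annulus by conformal
invariance. This doubling is the price of estimates up to the boundary. -/
theorem lintegral_reflectedGradient_sq_le (φ : ℂ → ℝ) :
    ∫⁻ z in Metric.ball (0 : ℂ) 2, reflectedGradient φ z ^ 2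
      ≤ 2 * ∫⁻ z, ‖fderiv ℝ φ z‖ₑ ^ 2 ∂area := by
  set s := Metric.ball (0 : ℂ) 2 \ Metric.closedBall 0 1 with hs
  have hsub : Metric.ball (0 : ℂ) 2 ⊆ disk ∪ (Metric.sphere 0 1 ∪ s) := fun z hz => by
    rcases lt_trichotomy ‖z‖ 1 with h | h | h
    · exact Or.inl (by simpa [disk] using h)
    · exact Or.inr (Or.inl (by simpa using h))
    · exact Or.inr (Or.inr ⟨hz, by simpa using h⟩)
  refine (lintegral_mono_set hsub).trans ((lintegral_union_le _ _ _).trans ?_)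
  rw [two_mul]
  refine add_le_add ?_ ((lintegral_union_le _ _ _).trans ?_)
  · refine (setLIntegral_congr_fun Metric.isOpen_ball.measurableSet fun z hz => ?_).le
    rw [reflectedGradient_of_norm_le φ (by simpa using (Metric.mem_ball.1 hz).le)]
  · rw [setLIntegral_measure_zero _ _ (Measure.addHaar_sphere _ _ _), zero_add]
    refine le_trans (le_of_eq ?_) lintegral_comp_circleInv_le
    refine setLIntegral_congr_fun (Metric.isOpen_ball.measurableSet.diff
      Metric.isClosed_closedBall.measurableSet) fun z hz => ?_
    have h1 : 1 < ‖z‖ := by simpa using hz.2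
    rw [reflectedGradient_of_le_norm φ h1.le, mul_pow, ENNReal.ofReal_pow (by positivity)]

theorem newtonKernel_le {x z : ℂ} {δ : ℝ} (hδ : 0 < δ) (h : δ ≤ ‖z - x‖) :
    newtonKernel x z ≤ ENNReal.ofReal (δ⁻¹) := by
  have hz : 0 < ‖z - x‖ := hδ.trans_le h
  rw [newtonKernel, ← ofReal_norm, ← ENNReal.ofReal_inv_of_pos hz,
    ← ENNReal.ofReal_mul (by positivity)]
  apply ENNReal.ofReal_le_ofReal
  have h1 : (2 * Real.pi)⁻¹ ≤ 1 := inv_le_one_of_one_le₀ (by linarith [Real.pi_gt_three])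
  have h2 : ‖z - x‖⁻¹ ≤ δ⁻¹ := by gcongr
  calc _ ≤ 1 * δ⁻¹ := by gcongr
    _ = _ := one_mul _

theorem lintegral_enorm_area_le (φ : ℂ → ℝ) (hφ : AEStronglyMeasurable φ area) :
    ∫⁻ z, ‖φ z‖ₑ ∂area ≤ ENNReal.ofReal Real.pi ^ (1 / 2 : ℝ) * eLpNorm φ 2 area := by
  rw [← eLpNorm_one_eq_lintegral_enorm, mul_comm]
  refine (eLpNorm_le_eLpNorm_mul_rpow_measure_univ (p := 1) (q := 2) (by norm_num) hφ).trans
    (le_of_eq ?_)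
  congr 2
  · exact area_univ
  · norm_num

theorem exists_norm_fderiv_le {χ : ℂ → ℝ} (hχ : ContDiff ℝ ∞ χ) (hc : HasCompactSupport χ) :
    ∃ C : ℝ, 0 ≤ C ∧ ∀ z, ‖fderiv ℝ χ z‖ ≤ C := by
  obtain ⟨C, hC⟩ := (hχ.continuous_fderiv (by simp)).bounded_above_of_compact_support
    (hc.fderiv (𝕜 := ℝ))
  exact ⟨C, (norm_nonneg _).trans (hC 0), hC⟩

theorem fderiv_eq_zero_of_ball {χ : ℂ → ℝ} {r c : ℝ} (h : ∀ z, ‖z‖ < r → χ z = c) {z : ℂ}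
    (hz : ‖z‖ < r) : fderiv ℝ χ z = 0 := by
  have h0 : χ =ᶠ[𝓝 z] fun _ => c := by
    filter_upwards [(isOpen_lt continuous_norm continuous_const).mem_nhds hz] with y hy
    exact h y hy
  rw [h0.fderiv_eq]
  simp

/-- The ray representation is applied to the reflected function times a cutoff. The derivative of
the cutoff lives at `‖z‖ ≥ 3 / 2`, where the kernel is bounded, so it costs only a multiple of
`‖φ‖₂`; the gradient term keeps the coefficient `1`, on which the final constants depend. -/
theorem exists_enorm_le_reflected_potential : ∃ L : ℝ, 0 ≤ L ∧ ∀ φ : ℂ → ℝ, ContDiff ℝ ∞ φ →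
    ∀ x, ‖x‖ ≤ 1 → ‖φ x‖ₑ ≤ ENNReal.ofReal L * eLpNorm φ 2 area +
      ∫⁻ z in Metric.ball (0 : ℂ) 2, newtonKernel x z * reflectedGradient φ z := by
  set χ : ContDiffBump (0 : ℂ) := ⟨3 / 2, 2, by norm_num, by norm_num⟩ with hχ
  obtain ⟨Cχ, hCχ0, hCχ⟩ := exists_norm_fderiv_le χ.contDiff χ.hasCompactSupport
  have hχ1 : ∀ z, ‖z‖ < 3 / 2 → χ z = 1 := fun z hz =>
    χ.one_of_mem_closedBall (by simpa [hχ] using hz.le)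
  have hχd : ∀ z, ‖z‖ < 3 / 2 → fderiv ℝ χ z = 0 := fun z hz => fderiv_eq_zero_of_ball hχ1 hz
  -- `2` bounds the kernel at distance at least `1 / 2`, `16` bounds `‖z‖⁴` when the Jacobian of the
  -- inversion is inserted, and `√π` comes from Cauchy–Schwarz on the disk.
  refine ⟨2 * Cχ * 16 * √Real.pi, by positivity, fun φ hφ x hx => ?_⟩
  set F : ℂ → ℝ := fun z => χ z * φ (foldDisk z) with hF
  have hφd : Differentiable ℝ φ := hφ.differentiable (by simp)
  have hin : ∀ z, ‖z‖ < 1 → HasFDerivAt F (fderiv ℝ φ z) z := fun z hz => by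
    refine (hφd z).hasFDerivAt.congr_of_eventuallyEq ?_
    filter_upwards [(isOpen_lt continuous_norm continuous_const).mem_nhds hz] with y hy
    have hy' : ‖y‖ < 1 := hy
    simp only [hF]
    rw [hχ1 y (by linarith), foldDisk_of_norm_le hy'.le, one_mul]
  have hout : ∀ z, 1 < ‖z‖ → HasFDerivAt F (χ z • (fderiv ℝ φ (circleInv z) ∘L circleInvDeriv z)
      + φ (circleInv z) • fderiv ℝ χ z) z := fun z hz => by
    have hz0 : z ≠ 0 := fun h => by rw [h, norm_zero] at hz; linarith
    have h1 := (χ.contDiff (n := 1)).differentiable (by simp) z |>.hasFDerivAt.mul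
      ((hφd (circleInv z)).hasFDerivAt.comp z (hasFDerivAt_circleInv hz0))
    refine h1.congr_of_eventuallyEq ?_
    filter_upwards [(isOpen_lt continuous_const continuous_norm).mem_nhds hz] with y hy
    have hy' : 1 < ‖y‖ := hy
    simp only [hF, foldDisk_of_le_norm hy'.le]
    rfl
  have hbd : ∀ z, ‖z‖ ≠ 1 → DifferentiableAt ℝ F z ∧ ‖fderiv ℝ F z‖ ≤
      (max 1 ‖z‖ ^ 2)⁻¹ * ‖fderiv ℝ φ (foldDisk z)‖ + ‖φ (foldDisk z)‖ * ‖fderiv ℝ χ z‖ :=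
    fun z hz => by
    rcases lt_or_gt_of_ne hz with h | h
    · refine ⟨(hin z h).differentiableAt, ?_⟩
      rw [(hin z h).fderiv, max_eq_left h.le, foldDisk_of_norm_le h.le, hχd z (by linarith)]
      simp
    · refine ⟨(hout z h).differentiableAt, ?_⟩
      rw [(hout z h).fderiv, max_eq_right h.le, foldDisk_of_le_norm h.le]
      refine (norm_add_le _ _).trans (add_le_add ?_ (norm_smul _ _).le)
      rw [norm_smul, Real.norm_eq_abs, abs_of_nonneg χ.nonneg]
      calc _ ≤ 1 * (‖fderiv ℝ φ (circleInv z)‖ * (‖z‖ ^ 2)⁻¹) := by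
            gcongr
            · exact χ.le_one
            · refine (ContinuousLinearMap.opNorm_comp_le _ _).trans ?_
              gcongr
              exact norm_circleInvDeriv_le z
        _ = _ := by ring
  obtain ⟨M₀, hM₀⟩ := (isCompact_closedBall (0 : ℂ) 1).exists_bound_of_continuousOn
    hφ.continuous.continuousOn
  obtain ⟨M₁, hM₁⟩ := (isCompact_closedBall (0 : ℂ) 1).exists_bound_of_continuousOn
    (hφ.continuous_fderiv (by simp)).continuousOn
  have hfold : ∀ z, foldDisk z ∈ Metric.closedBall (0 : ℂ) 1 := fun z => by
    simpa using norm_foldDisk_le z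
  have hM0 : 0 ≤ M₀ := (norm_nonneg _).trans (hM₀ _ (hfold 0))
  have hFx : F x = φ x := by
    simp only [hF]
    rw [hχ1 x (by linarith), foldDisk_of_norm_le hx, one_mul]
  have key := enorm_le_lintegral_newtonKernel (F := F) (M := M₁ + M₀ * Cχ)
    (χ.continuous.mul (hφ.continuous.comp continuous_foldDisk))
    (fun z hz => by
      simp only [hF]
      rw [χ.zero_of_le_dist (by simpa [hχ] using hz), zero_mul])
    (fun z hz => ⟨(hbd z hz).1, (hbd z hz).2.trans (by
      have h1 : (max 1 ‖z‖ ^ 2)⁻¹ ≤ 1 :=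
        inv_le_one_of_one_le₀ (one_le_pow₀ (le_max_left _ _))
      have h2 := hM₁ _ (hfold z)
      have h3 := hM₀ _ (hfold z)
      have h4 := hCχ z
      gcongr
      calc _ ≤ 1 * M₁ := by gcongr
        _ = M₁ := one_mul _)⟩) hx
  rw [hFx] at key
  set s := Metric.ball (0 : ℂ) 2 \ Metric.closedBall 0 1 with hs
  have hsm : MeasurableSet s :=
    Metric.isOpen_ball.measurableSet.diff Metric.isClosed_closedBall.measurableSet
  set G : ℂ → ℝ≥0∞ := s.indicator fun z =>
    ENNReal.ofReal (((‖z‖ ^ 2)⁻¹) ^ 2) * ‖φ (circleInv z)‖ₑ with hG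
  have hsplit : ∀ᵐ z ∂(volume.restrict (Metric.ball (0 : ℂ) 2)),
      newtonKernel x z * ‖fderiv ℝ F z‖ₑ ≤ newtonKernel x z * reflectedGradient φ z +
        ENNReal.ofReal (2 * Cχ * 16) * G z := by
    have hsph : ∀ᵐ z ∂(volume.restrict (Metric.ball (0 : ℂ) 2)), ‖z‖ ≠ 1 := by
      apply ae_restrict_of_ae
      rw [ae_iff]
      convert Measure.addHaar_sphere (volume : Measure ℂ) 0 1 using 2
      ext z
      simp
    filter_upwards [hsph, ae_restrict_mem Metric.isOpen_ball.measurableSet] with z hz hz2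
    have h1 : ‖fderiv ℝ F z‖ₑ ≤ reflectedGradient φ z + ‖φ (foldDisk z)‖ₑ * ‖fderiv ℝ χ z‖ₑ := by
      rw [reflectedGradient, ← ofReal_norm, ← ofReal_norm, ← ofReal_norm,
        ← ofReal_norm, ← ENNReal.ofReal_mul (by positivity),
        ← ENNReal.ofReal_mul (by positivity), ← ENNReal.ofReal_add (by positivity) (by positivity)]
      exact ENNReal.ofReal_le_ofReal (hbd z hz).2
    refine (mul_le_mul_right h1 _).trans ?_
    rw [mul_add]
    refine add_le_add_right ?_ _
    rcases lt_or_ge ‖z‖ (3 / 2) with h | h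
    · rw [hχd z h, enorm_zero_dual]
      simp
    · have hzs : z ∈ s := ⟨hz2, by simp; linarith⟩
      rw [hG, indicator_of_mem hzs, foldDisk_of_le_norm (by linarith)]
      have hz2' : ‖z‖ < 2 := by simpa using hz2
      have hk : newtonKernel x z ≤ ENNReal.ofReal 2 := by
        have := newtonKernel_le (x := x) (z := z) (δ := 1 / 2) (by norm_num)
          (by linarith [norm_sub_norm_le z x])
        simpa using this
      have h16 : 1 ≤ 16 * ((‖z‖ ^ 2)⁻¹) ^ 2 := by
        rw [inv_pow, ← pow_mul, ← div_eq_mul_inv, le_div_iff₀ (by positivity), one_mul]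
        calc ‖z‖ ^ (2 * 2) ≤ 2 ^ (2 * 2) := by gcongr
          _ = 16 := by norm_num
      calc newtonKernel x z * (‖φ (circleInv z)‖ₑ * ‖fderiv ℝ χ z‖ₑ)
          ≤ ENNReal.ofReal 2 * (‖φ (circleInv z)‖ₑ * ENNReal.ofReal Cχ) := by
            gcongr
            rw [← ofReal_norm]
            exact ENNReal.ofReal_le_ofReal (hCχ z)
        _ = ENNReal.ofReal (2 * Cχ) * (1 * ‖φ (circleInv z)‖ₑ) := by
            rw [ENNReal.ofReal_mul (by norm_num)]
            ring
        _ ≤ ENNReal.ofReal (2 * Cχ) * (ENNReal.ofReal (16 * ((‖z‖ ^ 2)⁻¹) ^ 2) *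
              ‖φ (circleInv z)‖ₑ) := by
            gcongr
            rw [← ENNReal.ofReal_one]
            exact ENNReal.ofReal_le_ofReal h16
        _ = _ := by
            rw [ENNReal.ofReal_mul (p := 2 * Cχ) (by positivity), ENNReal.ofReal_mul (p := 16) (by norm_num)]
            ring
  have hGm : Measurable (fun z => newtonKernel x z * reflectedGradient φ z) :=
    (measurable_newtonKernel.comp measurable_prodMk_left).mul (measurable_reflectedGradient φ)
  refine key.trans ((lintegral_mono_ae hsplit).trans ?_)
  rw [lintegral_add_left hGm, add_comm]
  refine add_le_add_left ?_ _
  rw [lintegral_const_mul' _ _ ENNReal.ofReal_ne_top, ENNReal.ofReal_mul (p := 2 * Cχ * 16) (by positivity),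
    mul_assoc (ENNReal.ofReal (2 * Cχ * 16))]
  refine mul_le_mul_right ?_ _
  have hGi : ∫⁻ z in Metric.ball (0 : ℂ) 2, G z ≤ ∫⁻ z, ‖φ z‖ₑ ∂area := by
    refine (setLIntegral_le_lintegral _ _).trans ?_
    rw [hG, lintegral_indicator hsm]
    exact lintegral_comp_circleInv_le
  refine hGi.trans ((lintegral_enorm_area_le φ hφ.continuous.aestronglyMeasurable).trans
    (le_of_eq ?_))
  rw [Real.sqrt_eq_rpow, ENNReal.ofReal_rpow_of_nonneg Real.pi_pos.le (by norm_num)]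

/-- Points of the disk of radius `1 / 4` are far from the boundary, so a cutoff vanishing outside
the unit disk replaces the reflection and the energy is not doubled. This makes up for the missing
separation of `x` and `ζ x` near the origin. -/
theorem exists_enorm_le_interior_potential : ∃ L : ℝ, 0 ≤ L ∧ ∀ φ : ℂ → ℝ, ContDiff ℝ ∞ φ →
    ∀ x, ‖x‖ ≤ 1 / 4 → ‖φ x‖ₑ ≤ ENNReal.ofReal L * eLpNorm φ 2 area +
      ∫⁻ z in Metric.ball (0 : ℂ) 2, newtonKernel x z * disk.indicator (fun z => ‖fderiv ℝ φ z‖ₑ) z := by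
  set χ : ContDiffBump (0 : ℂ) := ⟨1 / 2, 1, by norm_num, by norm_num⟩ with hχ
  obtain ⟨Cχ, hCχ0, hCχ⟩ := exists_norm_fderiv_le χ.contDiff χ.hasCompactSupport
  have hχ1 : ∀ z, ‖z‖ < 1 / 2 → χ z = 1 := fun z hz =>
    χ.one_of_mem_closedBall (by simpa [hχ] using hz.le)
  have hχ0 : ∀ z, 1 ≤ ‖z‖ → χ z = 0 := fun z hz => χ.zero_of_le_dist (by simpa [hχ] using hz)
  have hχd : ∀ z, ‖z‖ < 1 / 2 → fderiv ℝ χ z = 0 := fun z hz => fderiv_eq_zero_of_ball hχ1 hz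
  refine ⟨4 * Cχ * √Real.pi, by positivity, fun φ hφ x hx => ?_⟩
  set F : ℂ → ℝ := fun z => χ z * φ z with hF
  have hFs : ContDiff ℝ ∞ F := χ.contDiff.mul hφ
  obtain ⟨M, -, hM⟩ := exists_norm_fderiv_le hFs χ.hasCompactSupport.mul_right
  have hφd : Differentiable ℝ φ := hφ.differentiable (by simp)
  have hFx : F x = φ x := by
    simp only [hF]
    rw [hχ1 x (by linarith), one_mul]
  have key := enorm_le_lintegral_newtonKernel (F := F) (M := M) hFs.continuous
    (fun z hz => by simp only [hF]; rw [hχ0 z (by linarith), zero_mul])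
    (fun z _ => ⟨hFs.differentiable (by simp) z, hM z⟩) (hx.trans (by norm_num))
  rw [hFx] at key
  have hsplit : ∀ᵐ z ∂(volume.restrict (Metric.ball (0 : ℂ) 2)),
      newtonKernel x z * ‖fderiv ℝ F z‖ₑ ≤
        newtonKernel x z * disk.indicator (fun z => ‖fderiv ℝ φ z‖ₑ) z +
        ENNReal.ofReal (4 * Cχ) * disk.indicator (fun z => ‖φ z‖ₑ) z := by
    have hsph : ∀ᵐ z ∂(volume.restrict (Metric.ball (0 : ℂ) 2)), ‖z‖ ≠ 1 := by
      apply ae_restrict_of_ae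
      rw [ae_iff]
      convert Measure.addHaar_sphere (volume : Measure ℂ) 0 1 using 2
      ext z
      simp
    filter_upwards [hsph] with z hz
    rcases lt_or_gt_of_ne hz with h | h
    · have hzd : z ∈ disk := by simpa [disk] using h
      have h1 := (χ.contDiff (n := 1)).differentiable (by simp) z |>.hasFDerivAt.mul
        (hφd z).hasFDerivAt
      rw [indicator_of_mem hzd, indicator_of_mem hzd, show fderiv ℝ F z = _ from h1.fderiv]
      refine (mul_le_mul_right (enorm_add_dual_le _ _) _).trans ?_
      rw [mul_add]
      refine add_le_add (mul_le_mul_right ?_ _) ?_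
      · rw [enorm_le_iff_norm_le, norm_smul, Real.norm_eq_abs, abs_of_nonneg χ.nonneg]
        exact mul_le_of_le_one_left (norm_nonneg _) χ.le_one
      · rcases lt_or_ge ‖z‖ (1 / 2) with h' | h'
        · rw [hχd z h', smul_zero, enorm_zero_dual]
          simp
        · have hk := newtonKernel_le (x := x) (z := z) (δ := 1 / 4) (by norm_num)
            (by linarith [norm_sub_norm_le z x])
          rw [enorm_smul_dual, ENNReal.ofReal_mul (by norm_num), mul_comm ‖φ z‖ₑ, ← mul_assoc]
          gcongr
          · simpa using hk
          · rw [← ofReal_norm]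
            exact ENNReal.ofReal_le_ofReal (hCχ z)
    · have h0 : F =ᶠ[𝓝 z] fun _ => 0 := by
        filter_upwards [(isOpen_lt continuous_const continuous_norm).mem_nhds h] with y hy
        simp only [hF]
        rw [hχ0 y (le_of_lt hy), zero_mul]
      rw [h0.fderiv_eq, fderiv_fun_const, Pi.zero_apply, enorm_zero_dual, mul_zero]
      exact zero_le
  have hm : Measurable (fun z => newtonKernel x z * disk.indicator (fun z => ‖fderiv ℝ φ z‖ₑ) z) :=
    (measurable_newtonKernel.comp measurable_prodMk_left).mul
      ((measurable_fderiv ℝ φ).enorm.indicator Metric.isOpen_ball.measurableSet)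
  refine key.trans ((lintegral_mono_ae hsplit).trans ?_)
  rw [lintegral_add_left hm, add_comm]
  refine add_le_add_left ?_ _
  rw [lintegral_const_mul' _ _ ENNReal.ofReal_ne_top, ENNReal.ofReal_mul (p := 4 * Cχ) (by positivity),
    mul_assoc (ENNReal.ofReal (4 * Cχ))]
  refine mul_le_mul_right ?_ _
  refine (setLIntegral_le_lintegral _ _).trans ?_
  rw [lintegral_indicator (s := disk) Metric.isOpen_ball.measurableSet]
  refine (lintegral_enorm_area_le φ hφ.continuous.aestronglyMeasurable).trans (le_of_eq ?_)
  rw [Real.sqrt_eq_rpow, ENNReal.ofReal_rpow_of_nonneg Real.pi_pos.le (by norm_num)]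

/-! ### Moser–Trudinger inequalities for symmetrized smooth functions -/

instance : NullSingletonClass area := by
  unfold area
  infer_instance

instance : NullSingletonClass arcLength := by
  refine ⟨fun a => ?_⟩
  rw [arcLength, Measure.map_apply (continuous_circleMap 0 1).measurable (measurableSet_singleton a)]
  exact ((countable_singleton a).preimage_circleMap 0 one_ne_zero).measure_zero _

theorem measurePreserving_mul {ζ : ℂ} (hζ : ‖ζ‖ = 1) :
    MeasurePreserving (fun z : ℂ => ζ * z) volume volume := by
  let a : Circle := ⟨ζ, mem_sphere_zero_iff_norm.2 hζ⟩
  exact (rotation a).measurePreserving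

theorem measurePreserving_mul_restrict {ζ : ℂ} (hζ : ‖ζ‖ = 1) {s : Set ℂ} (hs : MeasurableSet s)
    (h : ∀ z, ζ * z ∈ s ↔ z ∈ s) :
    MeasurePreserving (fun z : ℂ => ζ * z) (volume.restrict s) (volume.restrict s) := by
  have h1 := (measurePreserving_mul hζ).restrict_preimage hs
  have h2 : (fun z : ℂ => ζ * z) ⁻¹' s = s := by
    ext z
    exact h z
  rwa [h2] at h1

theorem measurePreserving_mul_area {ζ : ℂ} (hζ : ‖ζ‖ = 1) :
    MeasurePreserving (fun z : ℂ => ζ * z) area area :=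
  measurePreserving_mul_restrict hζ Metric.isOpen_ball.measurableSet fun z => by
    simp [disk, hζ]

theorem symKernel_eq (ζ x z : ℂ) :
    symKernel ζ x z = ENNReal.ofReal (1 / 2) * (newtonKernel x z + newtonKernel (ζ * x) z) := by
  rw [symKernel, newtonKernel, newtonKernel, ← mul_add, ← mul_assoc,
    ← ENNReal.ofReal_mul (by norm_num)]
  congr 2
  field_simp
  norm_num

theorem ofReal_half_add_le (a b : ℝ) :
    ENNReal.ofReal (1 / 2 * (a + b)) ≤ ENNReal.ofReal (1 / 2) * (‖a‖ₑ + ‖b‖ₑ) := by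
  rw [← ofReal_norm, ← ofReal_norm,
    ← ENNReal.ofReal_add (norm_nonneg _) (norm_nonneg _), ← ENNReal.ofReal_mul (by norm_num)]
  apply ENNReal.ofReal_le_ofReal
  have := le_abs_self a
  have := le_abs_self b
  simp only [Real.norm_eq_abs]
  linarith

/-- Moser–Trudinger inequality for symmetrized smooth functions, with respect to a measure on the
closed disk for which the points `x` and `ζ * x` are uniformly separated. -/
theorem exists_lintegral_exp_symmetrized_le (m : Measure ℂ) [IsFiniteMeasure m]
    [NullSingletonClass m] {ζ : ℂ} (hζ : ‖ζ‖ = 1) {η θ Cp : ℝ} (hη : 0 < η) (hη2 : η ≤ 2)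
    (hθ : 0 < θ) (hCp : 0 ≤ Cp)
    (hm : ∀ᵐ x ∂m, ‖x‖ ≤ 1 ∧ 2 * η ≤ ‖ζ * x - x‖ ∧ ∀ a : ℂ, ‖a‖ = ‖x‖ →
      ∫⁻ y, ENNReal.ofReal (‖y - a‖ ^ (-(θ / 2))) ∂m ≤ ENNReal.ofReal Cp) :
    ∃ L C : ℝ, 0 ≤ L ∧ ∀ φ : ℂ → ℝ, ContDiff ℝ ∞ φ → ∀ A W : ℝ, 0 ≤ A → 0 ≤ W →
      eLpNorm φ 2 area ≤ ENNReal.ofReal A →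
      ∫⁻ z, ‖fderiv ℝ φ z‖ₑ ^ 2 ∂area ≤ ENNReal.ofReal W →
      ∫⁻ x, ENNReal.ofReal (Real.exp (1 / 2 * (φ x + φ (ζ * x)))) ∂m
        ≤ ENNReal.ofReal (Real.exp (L * A + W / (4 * Real.pi * θ) + C)) := by
  obtain ⟨C, hC⟩ := exists_lintegral_exp_le_of_symKernel m hζ hη hη2 hθ hCp hm
  obtain ⟨L, hL, hrep⟩ := exists_enorm_le_reflected_potential
  refine ⟨L, C, hL, fun φ hφ A W hA hW hφA hφW => ?_⟩
  obtain ⟨M, hM⟩ := (isCompact_closedBall (0 : ℂ) 1).exists_bound_of_continuousOn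
    hφ.continuous.continuousOn
  -- The energy enters doubled because of the reflection.
  have hW2 : W / (4 * Real.pi * θ) = (2 * W) / (8 * Real.pi * θ) := by
    field_simp
    ring
  rw [hW2]
  have hφc := hφ.continuous
  refine hC (measurable_reflectedGradient φ) (v := fun x => 1 / 2 * (φ x + φ (ζ * x)))
    (by fun_prop) (M := M) ?_ (by positivity) (by positivity) ?_ ?_
  · filter_upwards [hm] with x hx
    have h1 := hM x (by simpa using hx.1)
    have h2 := hM (ζ * x) (by simpa [hζ] using hx.1)
    rw [Real.norm_eq_abs] at h1 h2
    rw [abs_le] at *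
    constructor <;> linarith
  · filter_upwards [hm] with x hx
    have h1 := hrep φ hφ x hx.1
    have h2 := hrep φ hφ (ζ * x) (by simpa [hζ] using hx.1)
    have hk : Measurable (fun z => newtonKernel x z * reflectedGradient φ z) := by
      have := measurable_reflectedGradient φ
      unfold newtonKernel
      fun_prop
    set I₁ := ∫⁻ z in Metric.ball (0 : ℂ) 2, newtonKernel x z * reflectedGradient φ z with hI₁
    set I₂ := ∫⁻ z in Metric.ball (0 : ℂ) 2, newtonKernel (ζ * x) z * reflectedGradient φ z with hI₂
    have hI : ∫⁻ z in Metric.ball (0 : ℂ) 2, symKernel ζ x z * reflectedGradient φ z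
        = ENNReal.ofReal (1 / 2) * (I₁ + I₂) := by
      rw [hI₁, hI₂, ← lintegral_add_left hk,
        ← lintegral_const_mul' _ _ ENNReal.ofReal_ne_top]
      refine lintegral_congr fun z => ?_
      rw [symKernel_eq]
      ring
    have hLA : ENNReal.ofReal L * eLpNorm φ 2 area ≤ ENNReal.ofReal (L * A) := by
      rw [ENNReal.ofReal_mul hL]
      gcongr
    have hhalf : ENNReal.ofReal (1 / 2) + ENNReal.ofReal (1 / 2) = 1 := by
      rw [← ENNReal.ofReal_add (by norm_num) (by norm_num)]
      norm_num
    rw [hI]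
    refine (ofReal_half_add_le _ _).trans ?_
    refine (mul_le_mul_right (add_le_add (h1.trans (add_le_add_left hLA _))
      (h2.trans (add_le_add_left hLA _))) _).trans (le_of_eq ?_)
    calc ENNReal.ofReal (1 / 2) * (ENNReal.ofReal (L * A) + I₁ + (ENNReal.ofReal (L * A) + I₂))
        = (ENNReal.ofReal (1 / 2) + ENNReal.ofReal (1 / 2)) * ENNReal.ofReal (L * A)
          + ENNReal.ofReal (1 / 2) * (I₁ + I₂) := by ring
      _ = _ := by rw [hhalf, one_mul]
  · refine (lintegral_reflectedGradient_sq_le φ).trans ?_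
    rw [ENNReal.ofReal_mul (by norm_num)]
    gcongr
    simp

/-- Here `θ = 3 / 2`: the exponent `θ / 2 = 3 / 4` is integrable on a curve, whereas without
symmetrization `θ` would have to be less than `1`. -/
theorem exists_lintegral_exp_arcLength_le {ζ : ℂ} (hζ : ‖ζ‖ = 1) (hζ1 : ζ ≠ 1) :
    ∃ L C : ℝ, 0 ≤ L ∧ ∀ φ : ℂ → ℝ, ContDiff ℝ ∞ φ → ∀ A W : ℝ, 0 ≤ A → 0 ≤ W →
      eLpNorm φ 2 area ≤ ENNReal.ofReal A →
      ∫⁻ z, ‖fderiv ℝ φ z‖ₑ ^ 2 ∂area ≤ ENNReal.ofReal W →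
      ∫⁻ x, ENNReal.ofReal (Real.exp (1 / 2 * (φ x + φ (ζ * x)))) ∂arcLength
        ≤ ENNReal.ofReal (Real.exp (L * A + W / (6 * Real.pi) + C)) := by
  have hd : 0 < ‖ζ - 1‖ := norm_pos_iff.2 (sub_ne_zero.2 hζ1)
  have hd2 : ‖ζ - 1‖ ≤ 2 := by
    have := norm_sub_le ζ 1
    rw [hζ, norm_one] at this
    linarith
  obtain ⟨Cp, hCp, h⟩ := exists_lintegral_arcLength_rpow_le (s := 3 / 2 / 2)
    (by norm_num) (by norm_num)
  have e : 6 * Real.pi = 4 * Real.pi * (3 / 2) := by ring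
  rw [e]
  refine exists_lintegral_exp_symmetrized_le arcLength hζ (η := ‖ζ - 1‖ / 8) (by positivity)
    (by linarith) (by norm_num) hCp ?_
  filter_upwards [ae_arcLength_norm] with x hx
  refine ⟨hx.le, ?_, fun a ha => h a (by simpa [hx] using ha)⟩
  rw [← sub_one_mul, norm_mul, hx]
  linarith

/-- Where `‖x‖ > 1 / 4` the points `x` and `ζ x` are separated and `θ = 3` is allowed, since `θ / 2
= 3 / 2 < 2`. Where `‖x‖ ≤ 1 / 4` only the plain kernel with `θ = 3 / 2` is used, but with undoubled
energy. Both regions give `12π`. -/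
theorem exists_lintegral_exp_area_le {ζ : ℂ} (hζ : ‖ζ‖ = 1) (hζ1 : ζ ≠ 1) :
    ∃ L C : ℝ, 0 ≤ L ∧ ∀ φ : ℂ → ℝ, ContDiff ℝ ∞ φ → ∀ A W : ℝ, 0 ≤ A → 0 ≤ W →
      eLpNorm φ 2 area ≤ ENNReal.ofReal A →
      ∫⁻ z, ‖fderiv ℝ φ z‖ₑ ^ 2 ∂area ≤ ENNReal.ofReal W →
      ∫⁻ x, ENNReal.ofReal (Real.exp (1 / 2 * (φ x + φ (ζ * x)))) ∂area
        ≤ ENNReal.ofReal (Real.exp (L * A + W / (12 * Real.pi) + C)) := by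
  have hd : 0 < ‖ζ - 1‖ := norm_pos_iff.2 (sub_ne_zero.2 hζ1)
  have hd2 : ‖ζ - 1‖ ≤ 2 := by
    have := norm_sub_le ζ 1
    rw [hζ, norm_one] at this
    linarith
  obtain ⟨Cp, hCp, h⟩ := exists_lintegral_area_rpow_le (s := 3 / 2) (by norm_num)
  set b := Metric.closedBall (0 : ℂ) (1 / 4) with hb
  have hbm : MeasurableSet b := Metric.isClosed_closedBall.measurableSet
  have hdm : MeasurableSet disk := Metric.isOpen_ball.measurableSet
  have hbd : b ⊆ disk := Metric.closedBall_subset_ball (by norm_num)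
  have hfin : volume b < ⊤ := measure_closedBall_lt_top
  have : IsFiniteMeasure (volume.restrict b) := ⟨by simpa using hfin⟩
  have hmo : volume.restrict (disk \ b) ≤ area := Measure.restrict_mono_set _ sdiff_subset
  have : IsFiniteMeasure (volume.restrict (disk \ b)) := isFiniteMeasure_of_le area hmo
  -- With this `η`, `2η = ‖ζ - 1‖ / 4`, which is at most `‖ζ x - x‖` once `‖x‖ > 1 / 4`.
  obtain ⟨L₁, C₁, hL₁, h₁⟩ := exists_lintegral_exp_symmetrized_le (volume.restrict (disk \ b)) hζ
    (η := ‖ζ - 1‖ / 8) (θ := 3) (by positivity) (by linarith) (by norm_num) hCp (by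
      filter_upwards [ae_restrict_mem (hdm.diff hbm)] with x hx
      have hx1 : ‖x‖ < 1 := by simpa [disk] using hx.1
      have hx2 : 1 / 4 < ‖x‖ := by simpa [hb] using hx.2
      refine ⟨hx1.le, ?_, fun a ha => ?_⟩
      · rw [← sub_one_mul, norm_mul]
        nlinarith
      · exact (lintegral_mono' hmo le_rfl).trans (h a (by simpa [ha] using hx1.le)))
  obtain ⟨C₂, h₂⟩ := exists_lintegral_exp_le_of_newtonKernel (volume.restrict b) (θ := 3 / 2)
    (by norm_num) hCp (by
      filter_upwards [ae_restrict_mem hbm] with x hx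
      have hx1 : ‖x‖ ≤ 1 / 4 := by simpa [hb] using hx
      refine ⟨by linarith, ?_⟩
      exact (lintegral_mono' (Measure.restrict_mono_set _ hbd) le_rfl).trans
        (h x (by simp; linarith)))
  obtain ⟨L₂, hL₂, hrep⟩ := exists_enorm_le_interior_potential
  -- The `log 2` absorbs the sum over the two regions.
  refine ⟨max L₁ L₂, Real.log 2 + max C₁ C₂, hL₁.trans (le_max_left _ _), fun φ hφ A W hA hW hφA hφW => ?_⟩
  have hφc := hφ.continuous
  set T := max L₁ L₂ * A + W / (12 * Real.pi) + max C₁ C₂ with hT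
  have key₁ : ∫⁻ x in disk \ b, ENNReal.ofReal (Real.exp (1 / 2 * (φ x + φ (ζ * x))))
      ≤ ENNReal.ofReal (Real.exp T) := by
    refine (h₁ φ hφ A W hA hW hφA hφW).trans (ENNReal.ofReal_le_ofReal (Real.exp_le_exp.2 ?_))
    have e : 4 * Real.pi * 3 = 12 * Real.pi := by ring
    rw [e, hT]
    gcongr
    · exact le_max_left _ _
    · exact le_max_left _ _
  have key₀ : ∫⁻ x in b, ENNReal.ofReal (Real.exp (φ x)) ≤ ENNReal.ofReal (Real.exp T) := by
    obtain ⟨M, hM⟩ := (isCompact_closedBall (0 : ℂ) (1 / 4)).exists_bound_of_continuousOn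
      hφ.continuous.continuousOn
    refine (h₂ (w := disk.indicator fun z => ‖fderiv ℝ φ z‖ₑ)
      ((measurable_fderiv ℝ φ).enorm.indicator hdm) (v := φ) hφc.measurable (M := M) ?_ hW
      (B := L₂ * A) (by positivity) ?_ ?_).trans ?_
    · filter_upwards [ae_restrict_mem hbm] with x hx using hM x hx
    · filter_upwards [ae_restrict_mem hbm] with x hx
      have hx1 : ‖x‖ ≤ 1 / 4 := by simpa [hb] using hx
      calc _ ≤ ‖φ x‖ₑ := Real.ofReal_le_enorm _
        _ ≤ _ := hrep φ hφ x hx1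
        _ ≤ _ := by
          rw [ENNReal.ofReal_mul hL₂]
          gcongr
    · refine le_trans ?_ hφW
      refine (setLIntegral_le_lintegral _ _).trans ?_
      rw [area, ← lintegral_indicator hdm]
      refine lintegral_mono fun z => ?_
      by_cases hz : z ∈ disk <;> simp [hz]
    · apply ENNReal.ofReal_le_ofReal
      apply Real.exp_le_exp.2
      have e : 8 * Real.pi * (3 / 2) = 12 * Real.pi := by ring
      rw [e, hT]
      gcongr
      · exact le_max_right _ _
      · exact le_max_right _ _
  -- By convexity of `exp` and rotation invariance of the inner disk, the average reduces to `φ`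
  -- itself.
  have key₂ : ∫⁻ x in b, ENNReal.ofReal (Real.exp (1 / 2 * (φ x + φ (ζ * x))))
      ≤ ENNReal.ofReal (Real.exp T) := by
    have hrot : ∫⁻ x in b, ENNReal.ofReal (Real.exp (φ (ζ * x)))
        = ∫⁻ x in b, ENNReal.ofReal (Real.exp (φ x)) :=
      (measurePreserving_mul_restrict hζ hbm fun z => by simp [hb, hζ]).lintegral_comp
        (f := fun x => ENNReal.ofReal (Real.exp (φ x))) (by fun_prop)
    calc _ ≤ ∫⁻ x in b, ENNReal.ofReal (1 / 2) * (ENNReal.ofReal (Real.exp (φ x)) +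
          ENNReal.ofReal (Real.exp (φ (ζ * x)))) := by
          refine lintegral_mono fun x => ?_
          rw [← ENNReal.ofReal_add (Real.exp_pos _).le (Real.exp_pos _).le,
            ← ENNReal.ofReal_mul (by norm_num)]
          apply ENNReal.ofReal_le_ofReal
          have := convexOn_exp.2 (mem_univ (φ x)) (mem_univ (φ (ζ * x)))
            (by norm_num : (0 : ℝ) ≤ 1 / 2) (by norm_num : (0 : ℝ) ≤ 1 / 2) (by norm_num)
          simp only [smul_eq_mul] at this
          rw [mul_add, mul_add]
          exact this
      _ = ENNReal.ofReal (1 / 2) * ((∫⁻ x in b, ENNReal.ofReal (Real.exp (φ x))) +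
          ∫⁻ x in b, ENNReal.ofReal (Real.exp (φ x))) := by
          rw [lintegral_const_mul' _ _ ENNReal.ofReal_ne_top, lintegral_add_left (by fun_prop), hrot]
      _ ≤ ENNReal.ofReal (1 / 2) * (ENNReal.ofReal (Real.exp T) + ENNReal.ofReal (Real.exp T)) := by
          gcongr
      _ = _ := by
          rw [← ENNReal.ofReal_add (Real.exp_pos _).le (Real.exp_pos _).le,
            ← ENNReal.ofReal_mul (by norm_num)]
          congr 1
          ring
  have hun : disk ⊆ (disk \ b) ∪ b := by simp
  refine (lintegral_mono_set hun).trans ((lintegral_union_le _ _ _).trans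
    ((add_le_add key₁ key₂).trans ?_))
  rw [← ENNReal.ofReal_add (Real.exp_pos _).le (Real.exp_pos _).le]
  apply ENNReal.ofReal_le_ofReal
  have e : max L₁ L₂ * A + W / (12 * Real.pi) + (Real.log 2 + max C₁ C₂) = Real.log 2 + T := by
    rw [hT]; ring
  rw [e, Real.exp_add (Real.log 2), Real.exp_log (by norm_num)]
  linarith

/-! ### Cauchy–Schwarz, Poincaré and trace inequalities for smooth functions -/

theorem sq_lintegral_le {α : Type*} [MeasurableSpace α] (μ : Measure α) {f : α → ℝ≥0∞}
    (hf : AEMeasurable f μ) : (∫⁻ x, f x ∂μ) ^ 2 ≤ μ univ * ∫⁻ x, f x ^ 2 ∂μ := by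
  have h := ENNReal.lintegral_mul_le_Lp_mul_Lq μ Real.HolderConjugate.two_two
    hf (aemeasurable_const (b := (1 : ℝ≥0∞)))
  simp only [Pi.mul_apply, mul_one, ENNReal.one_rpow, lintegral_const, one_mul] at h
  calc _ ≤ ((∫⁻ x, f x ^ (2 : ℝ) ∂μ) ^ (1 / 2 : ℝ) * (μ univ) ^ (1 / 2 : ℝ)) ^ 2 := by gcongr
    _ = _ := by
      rw [mul_pow, ← ENNReal.rpow_natCast, ← ENNReal.rpow_natCast, ← ENNReal.rpow_mul,
        ← ENNReal.rpow_mul]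
      norm_num
      rw [mul_comm]

theorem lintegral_mul_sq_le {α : Type*} [MeasurableSpace α] (μ : Measure α) {f g : α → ℝ≥0∞}
    (hf : AEMeasurable f μ) (hg : AEMeasurable g μ) :
    (∫⁻ x, f x * g x ∂μ) ^ 2 ≤ (∫⁻ x, f x ^ 2 ∂μ) * ∫⁻ x, g x ^ 2 ∂μ := by
  have h := ENNReal.lintegral_mul_le_Lp_mul_Lq μ Real.HolderConjugate.two_two hf hg
  simp only [Pi.mul_apply] at h
  calc _ ≤ ((∫⁻ x, f x ^ (2 : ℝ) ∂μ) ^ (1 / 2 : ℝ) * (∫⁻ x, g x ^ (2 : ℝ) ∂μ) ^ (1 / 2 : ℝ)) ^ 2 := by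
        gcongr
    _ = _ := by
      rw [mul_pow, ← ENNReal.rpow_natCast, ← ENNReal.rpow_natCast, ← ENNReal.rpow_mul,
        ← ENNReal.rpow_mul]
      norm_num

theorem eLpNorm_two_sq {α E : Type*} [MeasurableSpace α] [NormedAddCommGroup E] (f : α → E)
    (μ : Measure α) : eLpNorm f 2 μ ^ 2 = ∫⁻ x, ‖f x‖ₑ ^ 2 ∂μ := by
  have := eLpNorm_nnreal_pow_eq_lintegral (f := f) (μ := μ) (p := 2) (by norm_num)
  simpa using this

theorem lintegral_comp_add_smul (f : ℂ → ℝ≥0∞) (hf : Measurable f) (a : ℂ) {s : ℝ} (hs : s ≠ 0) :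
    ∫⁻ y, f (a + s • y) = ENNReal.ofReal (s ^ 2)⁻¹ * ∫⁻ y, f y := by
  have h := Measure.map_addHaar_smul (volume : Measure ℂ) hs
  have hm : Measurable fun y : ℂ => s • y := measurable_const_smul s
  calc ∫⁻ y, f (a + s • y) = ∫⁻ y, f (a + y) ∂(Measure.map (fun y => s • y) volume) := by
        rw [lintegral_map (f := fun y => f (a + y)) (hf.comp (measurable_const_add a)) hm]
    _ = _ := by
        rw [show Measure.map (fun y : ℂ => s • y) volume = _ from h, lintegral_smul_measure,
          lintegral_add_left_eq_self, Complex.finrank_real_complex, smul_eq_mul, abs_of_nonneg (by positivity)]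

theorem enorm_sub_le_lintegral_fderiv {φ : ℂ → ℝ} (hφ : ContDiff ℝ ∞ φ) {x y : ℂ}
    (hx : x ∈ disk) (hy : y ∈ disk) :
    ‖φ x - φ y‖ₑ ≤ ∫⁻ s in Ioo (0 : ℝ) 1, 2 * ‖fderiv ℝ φ (x + s • (y - x))‖ₑ := by
  have hline : ∀ s : ℝ, HasDerivAt (fun s : ℝ => x + s • (y - x)) (y - x) s := fun s => by
    simpa using ((hasDerivAt_id s).smul_const (y - x)).const_add x
  have hd : ∀ s : ℝ, HasDerivAt (fun s : ℝ => φ (x + s • (y - x)))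
      (fderiv ℝ φ (x + s • (y - x)) (y - x)) s := fun s =>
    (hφ.differentiable (by simp) _).hasFDerivAt.comp_hasDerivAt s (hline s)
  have hc : Continuous fun s : ℝ => fderiv ℝ φ (x + s • (y - x)) (y - x) :=
    ((hφ.continuous_fderiv (by simp)).comp (by fun_prop)).clm_apply continuous_const
  have h := intervalIntegral.integral_eq_sub_of_hasDerivAt (fun s _ => hd s)
    (hc.intervalIntegrable 0 1)
  simp only [one_smul, zero_smul, add_zero, add_sub_cancel] at h
  rw [← enorm_neg, neg_sub, ← h, intervalIntegral.integral_of_le zero_le_one, integral_Ioc_eq_integral_Ioo]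
  refine (enorm_integral_le_lintegral_enorm _).trans (lintegral_mono fun s => ?_)
  have hxy : ‖y - x‖ ≤ 2 := by
    have h1 : ‖x‖ < 1 := by simpa [disk] using hx
    have h2 : ‖y‖ < 1 := by simpa [disk] using hy
    linarith [norm_sub_le y x]
  have h2 : (2 : ℝ≥0∞) = ENNReal.ofReal 2 := by simp
  rw [h2, ← ofReal_norm, ← ofReal_norm, ← ENNReal.ofReal_mul (by norm_num)]
  apply ENNReal.ofReal_le_ofReal
  refine ((fderiv ℝ φ (x + s • (y - x))).le_opNorm _).trans ?_
  rw [mul_comm]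
  gcongr

/-- For `s ≥ 1 / 2` substitute in `y`, with Jacobian `s⁻² ≤ 4`; for `s ≤ 1 / 2` exchange the roles
of `x` and `y`. The other variable contributes the area `π`, and convexity keeps the segment in the
disk. -/
theorem lintegral_segment_le {G : ℂ → ℝ≥0∞} (hG : Measurable G) {s : ℝ} (hs : 0 ≤ s) (hs1 : s ≤ 1) :
    ∫⁻ x, ∫⁻ y, G (x + s • (y - x)) ∂area ∂area
      ≤ ENNReal.ofReal (4 * Real.pi) * ∫⁻ z, G z ∂area := by
  set H : ℂ → ℝ≥0∞ := disk.indicator G with hH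
  have hdm : MeasurableSet disk := Metric.isOpen_ball.measurableSet
  have hHm : Measurable H := hG.indicator hdm
  have hconv : ∀ x ∈ disk, ∀ y ∈ disk, x + s • (y - x) ∈ disk := fun x hx y hy =>
    (convex_ball (0 : ℂ) 1).add_smul_sub_mem hx hy ⟨hs, hs1⟩
  have main : ∀ t : ℝ, 1 / 2 ≤ t → ∫⁻ x, ∫⁻ y, H ((1 - t) • x + t • y) ∂area ∂area
      ≤ ENNReal.ofReal (4 * Real.pi) * ∫⁻ z, G z ∂area := fun t ht => by
    have ht0 : 0 < t := by linarith
    have h1 : ∀ x, ∫⁻ y, H ((1 - t) • x + t • y) ∂area ≤ ENNReal.ofReal 4 * ∫⁻ z, G z ∂area := fun x => by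
      refine (setLIntegral_le_lintegral _ _).trans ?_
      rw [lintegral_comp_add_smul H hHm _ ht0.ne', hH, lintegral_indicator hdm]
      refine mul_le_mul_left (ENNReal.ofReal_le_ofReal ?_) _
      rw [inv_le_comm₀ (by positivity) (by norm_num)]
      nlinarith
    refine (lintegral_mono h1).trans ?_
    rw [lintegral_const, area_univ, ENNReal.ofReal_mul (by norm_num)]
    apply le_of_eq
    ring
  have e : ∫⁻ x, ∫⁻ y, G (x + s • (y - x)) ∂area ∂area
      = ∫⁻ x, ∫⁻ y, H ((1 - s) • x + s • y) ∂area ∂area := by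
    refine setLIntegral_congr_fun hdm fun x hx => ?_
    refine setLIntegral_congr_fun hdm fun y hy => ?_
    have e1 : (1 - s) • x + s • y = x + s • (y - x) := by
      rw [sub_smul, smul_sub, one_smul]; ring
    simp only [e1, hH, indicator_of_mem (hconv x hx y hy)]
  rw [e]
  rcases le_total (1 / 2) s with h | h
  · exact main s h
  · rw [lintegral_lintegral_swap (by fun_prop)]
    have := main (1 - s) (by linarith)
    simp only [sub_sub_cancel] at this
    simpa only [add_comm] using this

/-- Poincaré inequality on the disk. -/
theorem lintegral_sub_average_sq_le {φ : ℂ → ℝ} (hφ : ContDiff ℝ ∞ φ) :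
    ∫⁻ x, ‖φ x - ⨍ y, φ y ∂area‖ₑ ^ 2 ∂area ≤ 16 * ∫⁻ x, ‖fderiv ℝ φ x‖ₑ ^ 2 ∂area := by
  have hdm : MeasurableSet disk := Metric.isOpen_ball.measurableSet
  have hφc := hφ.continuous
  have hfc : Continuous (fderiv ℝ φ) := hφ.continuous_fderiv (by simp)
  set G : ℂ → ℝ≥0∞ := fun z => ‖fderiv ℝ φ z‖ₑ ^ 2 with hG
  have hGm : Measurable G := by fun_prop
  have hpi : (0 : ℝ) < Real.pi := Real.pi_pos
  have hpi0 : ENNReal.ofReal Real.pi ≠ 0 := by simpa using hpi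
  have hint : Integrable φ area := by
    obtain ⟨M, hM⟩ := (isCompact_closedBall (0 : ℂ) 1).exists_bound_of_continuousOn
      hφ.continuous.continuousOn
    refine Integrable.of_bound hφc.aestronglyMeasurable M ?_
    filter_upwards [ae_restrict_mem hdm] with x hx using hM x (Metric.ball_subset_closedBall hx)
  have hreal : area.real univ = Real.pi := by
    rw [Measure.real, area_univ, ENNReal.toReal_ofReal hpi.le]
  have h1 : ∀ x, ‖φ x - ⨍ y, φ y ∂area‖ₑ ^ 2
      ≤ ENNReal.ofReal Real.pi⁻¹ * ∫⁻ y, ‖φ x - φ y‖ₑ ^ 2 ∂area := fun x => by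
    have e : φ x - ⨍ y, φ y ∂area = Real.pi⁻¹ * ∫ y, (φ x - φ y) ∂area := by
      rw [integral_sub (integrable_const _) hint, average_eq, hreal, integral_const, hreal,
        smul_eq_mul, smul_eq_mul, mul_sub, inv_mul_cancel_left₀ hpi.ne']
    rw [e, enorm_mul, mul_pow]
    have hpe : ‖Real.pi⁻¹‖ₑ = ENNReal.ofReal Real.pi⁻¹ := Real.enorm_of_nonneg (by positivity)
    calc _ ≤ ENNReal.ofReal Real.pi⁻¹ ^ 2 * (∫⁻ y, ‖φ x - φ y‖ₑ ∂area) ^ 2 := by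
          rw [hpe]
          gcongr
          exact enorm_integral_le_lintegral_enorm _
      _ ≤ ENNReal.ofReal Real.pi⁻¹ ^ 2 * (ENNReal.ofReal Real.pi * ∫⁻ y, ‖φ x - φ y‖ₑ ^ 2 ∂area) := by
          gcongr
          rw [← area_univ]
          exact sq_lintegral_le area (by fun_prop)
      _ = _ := by
          rw [← mul_assoc, pow_two, mul_assoc (ENNReal.ofReal Real.pi⁻¹),
            ← ENNReal.ofReal_mul (by positivity), inv_mul_cancel₀ hpi.ne', ENNReal.ofReal_one, mul_one]
  -- The squared diameter gives `4`, the segment lemma `4π`; the `π` disappears with the average.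
  have h2 : ∫⁻ x, ∫⁻ y, ‖φ x - φ y‖ₑ ^ 2 ∂area ∂area
      ≤ ENNReal.ofReal (16 * Real.pi) * ∫⁻ z, G z ∂area := by
    calc _ ≤ ∫⁻ x, ∫⁻ y, (∫⁻ s in Ioo (0 : ℝ) 1, 4 * G (x + s • (y - x))) ∂area ∂area := by
          refine setLIntegral_mono_ae' hdm (ae_of_all _ fun x hx => ?_)
          refine setLIntegral_mono_ae' hdm (ae_of_all _ fun y hy => ?_)
          calc _ ≤ (∫⁻ s in Ioo (0 : ℝ) 1, 2 * ‖fderiv ℝ φ (x + s • (y - x))‖ₑ) ^ 2 := by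
                gcongr
                exact enorm_sub_le_lintegral_fderiv hφ hx hy
            _ ≤ _ := by
                refine (sq_lintegral_le _ (by fun_prop)).trans ?_
                rw [Measure.restrict_apply_univ, Real.volume_Ioo, sub_zero, ENNReal.ofReal_one, one_mul]
                refine lintegral_mono fun s => ?_
                rw [mul_pow, hG]
                norm_num
      _ = ∫⁻ s in Ioo (0 : ℝ) 1, ∫⁻ x, ∫⁻ y, 4 * G (x + s • (y - x)) ∂area ∂area := by
          have : ∀ x, ∫⁻ y, (∫⁻ s in Ioo (0 : ℝ) 1, 4 * G (x + s • (y - x))) ∂area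
              = ∫⁻ s in Ioo (0 : ℝ) 1, ∫⁻ y, 4 * G (x + s • (y - x)) ∂area := fun x => by
            rw [lintegral_lintegral_swap]
            apply Measurable.aemeasurable
            unfold Function.uncurry
            fun_prop
          simp_rw [this]
          rw [lintegral_lintegral_swap]
          apply Measurable.aemeasurable
          unfold Function.uncurry
          exact Measurable.lintegral_prod_right'
            (f := fun q : (ℂ × ℝ) × ℂ => 4 * G (q.1.1 + q.1.2 • (q.2 - q.1.1))) (by fun_prop)
      _ ≤ ∫⁻ s in Ioo (0 : ℝ) 1, ENNReal.ofReal (16 * Real.pi) * ∫⁻ z, G z ∂area := by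
          refine setLIntegral_mono_ae' measurableSet_Ioo (ae_of_all _ fun s hs => ?_)
          simp_rw [lintegral_const_mul' (4 : ℝ≥0∞) _ (by simp)]
          refine (mul_le_mul_right (lintegral_segment_le hGm hs.1.le hs.2.le) _).trans (le_of_eq ?_)
          rw [← mul_assoc]
          congr 1
          have h4 : (4 : ℝ≥0∞) = ENNReal.ofReal 4 := by simp
          rw [h4, ← ENNReal.ofReal_mul (by norm_num)]
          congr 1
          ring
      _ = _ := by
          rw [setLIntegral_const, Real.volume_Ioo, sub_zero, ENNReal.ofReal_one, mul_one]
  refine (lintegral_mono h1).trans ?_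
  rw [lintegral_const_mul' _ _ ENNReal.ofReal_ne_top]
  refine (mul_le_mul_right h2 _).trans (le_of_eq ?_)
  rw [← mul_assoc, ← ENNReal.ofReal_mul (by positivity)]
  congr 1
  have h16 : (16 : ℝ≥0∞) = ENNReal.ofReal 16 := by simp
  rw [h16]
  congr 1
  field_simp

/-- Multiplicative trace inequality. -/
theorem lintegral_arcLength_sq_le {φ : ℂ → ℝ} (hφ : ContDiff ℝ ∞ φ) :
    ∫⁻ y, ‖φ y‖ₑ ^ 2 ∂arcLength
      ≤ 2 * (∫⁻ x, ‖φ x‖ₑ ^ 2 ∂area + ∫⁻ x, ‖φ x‖ₑ * ‖fderiv ℝ φ x‖ₑ ∂area) := by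
  have hφc := hφ.continuous
  have hfc : Continuous (fderiv ℝ φ) := hφ.continuous_fderiv (by simp)
  set H : ℂ → ℝ≥0∞ := fun z => 2 * (‖φ z‖ₑ ^ 2 + ‖φ z‖ₑ * ‖fderiv ℝ φ z‖ₑ) with hH
  have hHm : Measurable H := by fun_prop
  have hdm : MeasurableSet disk := Metric.isOpen_ball.measurableSet
  have hray : ∀ θ : ℝ, ‖φ (circleMap 0 1 θ)‖ₑ ^ 2
      ≤ ∫⁻ r in Ioi (0 : ℝ), ENNReal.ofReal r * disk.indicator H (0 + circleMap 0 r θ) := fun θ => by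
    set e := circleMap 0 1 θ with he
    have he1 : ‖e‖ = 1 := by simp [he]
    -- The weight `r ^ 2` removes the value at the centre, and its derivative still carries the
    -- factor `r` of the area element.
    have hd : ∀ r : ℝ, HasDerivAt (fun r : ℝ => r ^ 2 * φ (r • e) ^ 2)
        (2 * r * φ (r • e) ^ 2 + r ^ 2 * (2 * φ (r • e) * fderiv ℝ φ (r • e) e)) r := fun r => by
      have h1 : HasDerivAt (fun r : ℝ => r • e) e r := by
        simpa using (hasDerivAt_id r).smul_const e
      have h2 := (hφ.differentiable (by simp) (r • e)).hasFDerivAt.comp_hasDerivAt r h1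
      have h3 := (hasDerivAt_pow 2 r).mul (h2.pow 2)
      refine h3.congr_deriv ?_
      simp
    have hc : Continuous fun r : ℝ =>
        2 * r * φ (r • e) ^ 2 + r ^ 2 * (2 * φ (r • e) * fderiv ℝ φ (r • e) e) := by
      have h1 : Continuous fun r : ℝ => r • e := by fun_prop
      have h2 : Continuous fun r : ℝ => fderiv ℝ φ (r • e) e := (hfc.comp h1).clm_apply continuous_const
      fun_prop
    have h := intervalIntegral.integral_eq_sub_of_hasDerivAt (fun s _ => hd s)
      (hc.intervalIntegrable 0 1)
    simp only [one_smul, one_pow, one_mul, ne_eq, OfNat.ofNat_ne_zero, not_false_eq_true, zero_pow,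
      zero_mul, sub_zero] at h
    have e0 : ‖φ e‖ₑ ^ 2 = ‖φ e ^ 2‖ₑ := by rw [pow_two, pow_two, enorm_mul]
    rw [e0, ← h, intervalIntegral.integral_of_le zero_le_one, integral_Ioc_eq_integral_Ioo]
    refine (enorm_integral_le_lintegral_enorm _).trans ?_
    refine le_trans ?_ (lintegral_mono_set (fun r (hr : r ∈ Ioo (0 : ℝ) 1) => hr.1))
    refine setLIntegral_mono_ae' measurableSet_Ioo (ae_of_all _ fun r hr => ?_)
    have hz : circleMap 0 r θ ∈ disk := by simpa [disk, abs_of_pos hr.1] using hr.2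
    rw [zero_add, indicator_of_mem hz, circleMap_zero_eq_smul, ← he, hH]
    have h2 : (2 : ℝ≥0∞) = ENNReal.ofReal 2 := by simp
    simp only [← ofReal_norm]
    rw [h2, ← ENNReal.ofReal_pow (norm_nonneg _), ← ENNReal.ofReal_mul (norm_nonneg _),
      ← ENNReal.ofReal_add (by positivity) (by positivity), ← ENNReal.ofReal_mul (by norm_num),
      ← ENNReal.ofReal_mul hr.1.le]
    apply ENNReal.ofReal_le_ofReal
    have h4 : ‖fderiv ℝ φ (r • e) e‖ ≤ ‖fderiv ℝ φ (r • e)‖ := by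
      simpa [he1] using (fderiv ℝ φ (r • e)).le_opNorm e
    have hr0 := hr.1
    have hr1 := hr.2
    calc _ ≤ ‖2 * r * φ (r • e) ^ 2‖ + ‖r ^ 2 * (2 * φ (r • e) * fderiv ℝ φ (r • e) e)‖ := norm_add_le _ _
      _ = 2 * r * ‖φ (r • e)‖ ^ 2 + r * (r * (2 * (‖φ (r • e)‖ * ‖fderiv ℝ φ (r • e) e‖))) := by
          simp only [norm_mul, norm_pow, Real.norm_eq_abs, abs_of_pos hr0, abs_two]
          ring
      _ ≤ 2 * r * ‖φ (r • e)‖ ^ 2 + r * (1 * (2 * (‖φ (r • e)‖ * ‖fderiv ℝ φ (r • e)‖))) := by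
          gcongr
      _ = _ := by ring
  rw [lintegral_arcLength (by fun_prop), ← setLIntegral_congr Ioo_ae_eq_Ioc]
  refine (lintegral_mono hray).trans ?_
  rw [← lintegral_polar _ (hHm.indicator hdm) 0, lintegral_indicator hdm, hH]
  refine le_of_eq ?_
  rw [lintegral_const_mul' _ _ (by simp), lintegral_add_left (by fun_prop)]
  rfl

/-! ### Density in `H¹` of functions smooth up to the boundary -/

theorem eLpNorm_two_le_of_sq_le {α E : Type*} [MeasurableSpace α] [NormedAddCommGroup E]
    {f : α → E} {μ : Measure α} {c : ℝ≥0∞} (h : ∫⁻ x, ‖f x‖ₑ ^ 2 ∂μ ≤ c ^ 2) :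
    eLpNorm f 2 μ ≤ c := by
  rw [← eLpNorm_two_sq] at h
  exact (ENNReal.pow_right_strictMono two_ne_zero).le_iff_le.1 h

/-- By density it suffices to treat a continuous compactly supported `g`, which is uniformly
continuous. For `r ≥ 1 / 2` the affine change of variables at most doubles the `L²` norm, so the
error budget is `δ/2 + δ/4 + δ/4`. -/
theorem exists_eLpNorm_comp_affine_sub_le {E : Type*} [NormedAddCommGroup E] [NormedSpace ℝ E]
    {f : ℂ → E} (hf : StronglyMeasurable f) (hf2 : MemLp f 2 volume) {δ : ℝ} (hδ : 0 < δ) :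
    ∃ ρ > 0, ∀ (r : ℝ) (y : ℂ), |r - 1| ≤ ρ → ‖y‖ ≤ ρ →
      eLpNorm (fun x => f (r • x - y) - f x) 2 volume ≤ ENNReal.ofReal δ := by
  obtain ⟨g, hgc, hfg, hg, hg2⟩ := hf2.exists_hasCompactSupport_eLpNorm_sub_le (by norm_num)
    (ε := ENNReal.ofReal (δ / 4)) (by simpa using hδ)
  obtain ⟨R, hR1, hR⟩ : ∃ R, 1 ≤ R ∧ ∀ x, R < ‖x‖ → g x = 0 := by
    obtain ⟨R, hR⟩ := hgc.isCompact.isBounded.subset_closedBall 0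
    refine ⟨max R 1, le_max_right _ _, fun x hx => image_eq_zero_of_notMem_tsupport fun h => ?_⟩
    have := hR h
    rw [mem_closedBall_zero_iff] at this
    exact (this.trans (le_max_left _ _)).not_gt hx
  set B : Set ℂ := Metric.closedBall 0 (4 * R + 4) with hB
  have hBf : volume B < ⊤ := measure_closedBall_lt_top
  set V := (volume B).toReal with hV
  have hV0 : 0 ≤ V := ENNReal.toReal_nonneg
  set κ : ℝ := δ / (4 * (V + 1)) with hκ
  have hκ0 : 0 < κ := by positivity
  obtain ⟨τ, hτ0, hτ⟩ := Metric.uniformContinuous_iff.1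
    (hgc.uniformContinuous_of_continuous hg) κ hκ0
  refine ⟨min (1 / 2) (τ / (2 * (4 * R + 5))), by positivity, fun r y hr hy => ?_⟩
  have hr1 := hr.trans (min_le_left _ _)
  have hr2 := hr.trans (min_le_right _ _)
  have hy1 := hy.trans (min_le_left _ _)
  have hy2 := hy.trans (min_le_right _ _)
  have hr0 : 1 / 2 ≤ r := by linarith [(abs_le.1 hr1).1]
  have hTm : Measurable fun x : ℂ => r • x - y := by fun_prop
  have hfgm : StronglyMeasurable (f - g) := hf.sub hg.stronglyMeasurable
  have h1 : eLpNorm (fun x => (f - g) (r • x - y)) 2 volume ≤ ENNReal.ofReal (δ / 2) := by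
    apply eLpNorm_two_le_of_sq_le
    have := lintegral_comp_add_smul (fun z => ‖(f - g) z‖ₑ ^ 2) (hfgm.enorm.pow_const 2) (-y)
      (s := r) (by linarith)
    have e : ∀ x, -y + r • x = r • x - y := fun x => by ring
    simp only [e] at this
    rw [this, ← eLpNorm_two_sq]
    calc _ ≤ ENNReal.ofReal (2 ^ 2) * ENNReal.ofReal (δ / 4) ^ 2 := by
          refine mul_le_mul' (ENNReal.ofReal_le_ofReal ?_) (by gcongr)
          rw [inv_le_comm₀ (by positivity) (by norm_num)]
          nlinarith
      _ = _ := by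
          rw [← ENNReal.ofReal_pow (by positivity), ← ENNReal.ofReal_mul (by positivity),
            ← ENNReal.ofReal_pow (by positivity)]
          congr 1
          ring
  have h2 : eLpNorm (fun x => g (r • x - y) - g x) 2 volume ≤ ENNReal.ofReal (δ / 4) := by
    apply eLpNorm_two_le_of_sq_le
    have hp : ∀ x, ‖g (r • x - y) - g x‖ₑ ^ 2 ≤ B.indicator (fun _ => ENNReal.ofReal κ ^ 2) x := by
      intro x
      by_cases hx : x ∈ B
      · rw [indicator_of_mem hx]
        gcongr
        rw [← ofReal_norm, ← dist_eq_norm]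
        refine ENNReal.ofReal_le_ofReal (hτ ?_).le
        rw [hB, mem_closedBall_zero_iff] at hx
        rw [dist_eq_norm, show r • x - y - x = (r - 1) • x - y by rw [sub_smul, one_smul]; ring]
        calc _ ≤ |r - 1| * ‖x‖ + ‖y‖ := by
              refine (norm_sub_le _ _).trans ?_
              rw [norm_smul, Real.norm_eq_abs]
          _ ≤ τ / (2 * (4 * R + 5)) * (4 * R + 4) + τ / (2 * (4 * R + 5)) := by gcongr
          _ = τ / 2 := by field_simp; ring
          _ < τ := by linarith
      · rw [indicator_of_notMem hx]
        rw [hB, mem_closedBall_zero_iff, not_le] at hx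
        have : ‖r • x‖ ≤ ‖r • x - y‖ + ‖y‖ := by
          simpa using norm_add_le (r • x - y) y
        rw [norm_smul, Real.norm_eq_abs, abs_of_pos (by linarith)] at this
        rw [hR x (by linarith), hR (r • x - y) (by nlinarith)]
        simp
    refine (lintegral_mono hp).trans ?_
    rw [lintegral_indicator Metric.isClosed_closedBall.measurableSet, lintegral_const,
      Measure.restrict_apply_univ, ← ENNReal.ofReal_toReal hBf.ne, ← hV,
      ← ENNReal.ofReal_pow hκ0.le, ← ENNReal.ofReal_mul (by positivity),
      ← ENNReal.ofReal_pow (by positivity)]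
    refine ENNReal.ofReal_le_ofReal ?_
    have : δ / 4 = κ * (V + 1) := by rw [hκ]; field_simp
    rw [this, mul_pow]
    gcongr
    nlinarith
  have e : (fun x => f (r • x - y) - f x)
      = ((fun x => (f - g) (r • x - y)) + fun x => g (r • x - y) - g x) - (f - g) := by
    funext x
    simp
  have hTc : Continuous fun x : ℂ => r • x - y := by fun_prop
  have m1 : AEStronglyMeasurable (fun x => (f - g) (r • x - y)) volume :=
    (hfgm.comp_measurable hTm).aestronglyMeasurable
  have m2 : AEStronglyMeasurable (fun x => g (r • x - y) - g x) volume :=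
    ((hg.comp hTc).sub hg).aestronglyMeasurable
  rw [e]
  calc _ ≤ ENNReal.ofReal (δ / 2) + ENNReal.ofReal (δ / 4) + ENNReal.ofReal (δ / 4) := by
        refine (eLpNorm_sub_le (m1.add m2) hfgm.aestronglyMeasurable (by norm_num)).trans ?_
        refine add_le_add ((eLpNorm_add_le m1 m2 (by norm_num)).trans (add_le_add h1 h2)) hfg
    _ = _ := by
        rw [← ENNReal.ofReal_add (by positivity) (by positivity),
          ← ENNReal.ofReal_add (by positivity) (by positivity)]
        congr 1
        ring

/-- Dilation by `r` followed by averaging against a bump function. -/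
def mollify {E : Type*} [NormedAddCommGroup E] [NormedSpace ℝ E]
    (η : ContDiffBump (0 : ℂ)) (r : ℝ) (f : ℂ → E) (x : ℂ) : E :=
  ∫ y, η.normed volume y • f (r • x - y)

/-- The normalized bump is a probability density, so the mollified function is an average of the
maps `x ↦ f (r • x - y)`, and Cauchy–Schwarz against that probability bounds its distance to `f`. -/
theorem eLpNorm_mollify_sub_le {E : Type*} [NormedAddCommGroup E] [NormedSpace ℝ E]
    [CompleteSpace E] {f : ℂ → E} (hf : StronglyMeasurable f) (hfi : Integrable f volume)
    (η : ContDiffBump (0 : ℂ)) (r : ℝ) {c : ℝ≥0∞}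
    (h : ∀ y, ‖y‖ ≤ η.rOut → eLpNorm (fun x => f (r • x - y) - f x) 2 volume ≤ c) :
    eLpNorm (fun x => mollify η r f x - f x) 2 volume ≤ c := by
  apply eLpNorm_two_le_of_sq_le
  set w : ℂ → ℝ≥0∞ := fun y => ENNReal.ofReal (η.normed volume y) with hw
  have hwm : Measurable w := η.continuous_normed.measurable.ennreal_ofReal
  set ν := (volume : Measure ℂ).withDensity w with hν
  have hint : Integrable (η.normed volume) volume :=
    η.continuous_normed.integrable_of_hasCompactSupport η.hasCompactSupport_normed
  have hν1 : ν univ = 1 := by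
    rw [hν, withDensity_apply _ MeasurableSet.univ, Measure.restrict_univ,
      ← ofReal_integral_eq_lintegral_ofReal hint (Eventually.of_forall η.nonneg_normed),
      η.integral_normed, ENNReal.ofReal_one]
  have : IsProbabilityMeasure ν := ⟨hν1⟩
  have hcomp : StronglyMeasurable fun p : ℂ × ℂ => f (r • p.1 - p.2) :=
    hf.comp_measurable (by fun_prop)
  have hH : Measurable fun p : ℂ × ℂ => ‖f (r • p.1 - p.2) - f p.1‖ₑ ^ 2 :=
    (hcomp.sub (hf.comp_measurable measurable_fst)).enorm.pow_const 2
  have hH' : ∀ x, Measurable fun y => ‖f (r • x - y) - f x‖ₑ := fun x =>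
    ((hcomp.comp_measurable (measurable_const.prodMk measurable_id)).sub
      stronglyMeasurable_const).enorm
  obtain ⟨M, hM⟩ : ∃ M, ∀ y, ‖η.normed volume y‖ ≤ M :=
    η.hasCompactSupport_normed.exists_bound_of_continuous η.continuous_normed
  have hp : ∀ x, ‖mollify η r f x - f x‖ₑ ^ 2 ≤ ∫⁻ y, ‖f (r • x - y) - f x‖ₑ ^ 2 ∂ν := by
    intro x
    have hi1 : Integrable (fun y => η.normed volume y • f (r • x - y)) volume :=
      (hfi.comp_sub_left (r • x)).bdd_smul _ η.continuous_normed.aestronglyMeasurable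
        (Eventually.of_forall hM)
    have hi2 : Integrable (fun y => η.normed volume y • f x) volume := hint.smul_const _
    have e : mollify η r f x - f x = ∫ y, η.normed volume y • (f (r • x - y) - f x) := by
      simp only [smul_sub]
      rw [integral_sub hi1 hi2, η.integral_normed_smul, mollify]
    have e2 : ‖mollify η r f x - f x‖ₑ ≤ ∫⁻ y, ‖f (r • x - y) - f x‖ₑ ∂ν := by
      rw [e, hν, lintegral_withDensity_eq_lintegral_mul _ hwm (hH' x)]
      refine (enorm_integral_le_lintegral_enorm _).trans (le_of_eq (lintegral_congr fun y => ?_))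
      rw [enorm_smul, Pi.mul_apply, hw, Real.enorm_of_nonneg (η.nonneg_normed y)]
    calc _ ≤ (∫⁻ y, ‖f (r • x - y) - f x‖ₑ ∂ν) ^ 2 := by gcongr
      _ ≤ _ := by
        have := sq_lintegral_le ν (hH' x).aemeasurable
        rwa [hν1, one_mul] at this
  calc _ ≤ ∫⁻ x, (∫⁻ y, ‖f (r • x - y) - f x‖ₑ ^ 2 ∂ν) := lintegral_mono hp
    _ = ∫⁻ y, (∫⁻ x, ‖f (r • x - y) - f x‖ₑ ^ 2) ∂ν := lintegral_lintegral_swap hH.aemeasurable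
    _ ≤ ∫⁻ y, c ^ 2 ∂ν := by
        refine lintegral_mono_ae ?_
        rw [hν, ae_withDensity_iff hwm]
        refine Eventually.of_forall fun y hy => ?_
        rw [← eLpNorm_two_sq]
        refine pow_le_pow_left' (h y ?_) 2
        have : y ∈ Function.support (η.normed volume) := fun h0 => hy (by simp [hw, h0])
        rw [η.support_normed_eq, mem_ball_zero_iff] at this
        exact this.le
    _ = c ^ 2 := by rw [lintegral_const, hν1, mul_one]

theorem inner_gradient (φ : ℂ → ℝ) (x v : ℂ) : inner ℝ (gradient φ x) v = fderiv ℝ φ x v := by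
  rw [gradient, InnerProductSpace.toDual_symm_apply]

theorem norm_gradient (φ : ℂ → ℝ) (x : ℂ) : ‖gradient φ x‖ = ‖fderiv ℝ φ x‖ := by
  rw [gradient, LinearIsometryEquiv.norm_map]

theorem continuous_gradient {φ : ℂ → ℝ} (hφ : ContDiff ℝ ∞ φ) : Continuous (gradient φ) :=
  (InnerProductSpace.toDual ℝ ℂ).symm.continuous.comp (hφ.continuous_fderiv (by simp))

theorem mollify_eq_convolution (f : ℂ → ℝ) (η : ContDiffBump (0 : ℂ)) (r : ℝ) :
    mollify η r f = fun x =>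
      (convolution f (η.normed volume) (ContinuousLinearMap.lsmul ℝ ℝ) volume) (r • x) := by
  funext x
  rw [mollify, convolution_def, ← integral_sub_left_eq_self _ volume (r • x)]
  simp [mul_comm]

theorem contDiff_mollify {f : ℂ → ℝ} (hf : Integrable f volume) (η : ContDiffBump (0 : ℂ))
    (r : ℝ) : ContDiff ℝ ∞ (mollify η r f) := by
  rw [mollify_eq_convolution]
  have hs : HasCompactSupport (η.normed (volume : Measure ℂ)) := η.hasCompactSupport_normed
  have hc : ContDiff ℝ ∞ (η.normed (volume : Measure ℂ)) := η.contDiff_normed (n := ⊤)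
  have := hs.contDiff_convolution_right (μ := volume)
    (ContinuousLinearMap.lsmul ℝ ℝ) hf.locallyIntegrable hc
  exact this.comp (contDiff_const_smul r)

/-- When the ball about `r x` lies in the disk, the bump reflected and centred at `r x` is an
admissible test function, and the weak gradient identity moves the derivative onto `g`; the factor
`r` is the chain rule. -/
theorem gradient_mollify {u : ℂ → ℝ} {g : ℂ → ℂ} (hu : Integrable u area)
    (hg : IsWeakGradient u g) {f : ℂ → ℝ} {F : ℂ → ℂ}
    (hf : f =ᵐ[volume] disk.indicator u) (hF : F =ᵐ[volume] disk.indicator g)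
    (hfi : Integrable f volume) (η : ContDiffBump (0 : ℂ)) (r : ℝ) (x : ℂ)
    (hp : Metric.closedBall (r • x) η.rOut ⊆ disk) :
    gradient (mollify η r f) x = r • mollify η r F x := by
  have hdm : MeasurableSet disk := Metric.isOpen_ball.measurableSet
  set p : ℂ := r • x with hpdef
  set e := η.normed volume with he
  have hec : ContDiff ℝ ∞ e := η.contDiff_normed (n := ⊤)
  have hes : HasCompactSupport e := η.hasCompactSupport_normed
  set ψ : ℂ → ℝ := fun z => e (p - z) with hψ
  have hψc : ContDiff ℝ ∞ ψ := hec.comp (contDiff_const.sub contDiff_id)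
  have hts : tsupport ψ ⊆ Metric.closedBall p η.rOut := by
    refine closure_minimal (fun z hz => ?_) Metric.isClosed_closedBall
    have : p - z ∈ Function.support (η.normed volume) := hz
    rw [η.support_normed_eq, mem_ball_zero_iff, ← dist_eq_norm, dist_comm] at this
    exact this.le
  have hψs : HasCompactSupport ψ :=
    (isCompact_closedBall p η.rOut).of_isClosed_subset (isClosed_tsupport _) hts
  have hweak := hg.2 ψ hψc hψs (hts.trans hp)
  have hfd : ∀ z v, fderiv ℝ ψ z v = - fderiv ℝ e (p - z) v := by
    intro z v
    have h1 : HasFDerivAt e (fderiv ℝ e (p - z)) (p - z) :=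
      (hec.differentiable (by simp) _).hasFDerivAt
    have h2 : HasFDerivAt (fun z : ℂ => p - z) (-ContinuousLinearMap.id ℝ ℂ) z :=
      (hasFDerivAt_id z).const_sub p
    have h3 : HasFDerivAt ψ _ z := h1.comp z h2
    rw [h3.fderiv]
    simp
  have hψi : Integrable (fun z => u z • gradient ψ z) area := by
    obtain ⟨M, hM⟩ : ∃ M, ∀ y, ‖gradient ψ y‖ ≤ M := by
      obtain ⟨M, hM⟩ := (hψs.fderiv ℝ).exists_bound_of_continuous
        (hψc.continuous_fderiv (by simp))
      exact ⟨M, fun y => (norm_gradient ψ y).trans_le (hM y)⟩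
    exact hu.smul_bdd M (continuous_gradient hψc).aestronglyMeasurable (Eventually.of_forall hM)
  refine ext_inner_right ℝ fun v => ?_
  rw [inner_gradient, mollify_eq_convolution]
  have hconv := hes.hasFDerivAt_convolution_right (μ := volume)
    (ContinuousLinearMap.lsmul ℝ ℝ) hfi.locallyIntegrable (hec.of_le (by simp)) p
  have hcomp := HasFDerivAt.comp (f := fun x : ℂ => r • x) x hconv
    ((hasFDerivAt_id (𝕜 := ℝ) x).const_smul r)
  have hR : ∀ (G : ℂ → ℂ), ∫ y, e y • G (p - y) = ∫ z, ψ z • G z := fun G => by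
    rw [← integral_sub_left_eq_self _ volume p]
    simp [hψ]
  have h3 : mollify η r F x = - ∫ z, u z • gradient ψ z ∂area := by
    rw [hweak, neg_neg, mollify, ← he, ← hpdef, hR, area, ← integral_indicator hdm]
    refine integral_congr_ae (hF.mono fun z hz => ?_)
    simp only [hz, indicator]
    split_ifs <;> simp
  have h4 : (convolution f (fderiv ℝ e)
      ((ContinuousLinearMap.lsmul ℝ ℝ).precompR ℂ) volume) p v
      = - ∫ z, inner ℝ (u z • gradient ψ z) v ∂area := by
    rw [convolution_precompR_apply _ hfi.locallyIntegrable (hes.fderiv ℝ)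
      (hec.continuous_fderiv (by simp)), convolution_def, area, ← integral_indicator hdm,
      ← integral_neg]
    refine integral_congr_ae (hf.mono fun z hz => ?_)
    simp only [hz, indicator]
    split_ifs
    · rw [inner_smul_left, inner_gradient, hfd]
      simp
    · simp
  have h5 : ∫ z, inner ℝ (u z • gradient ψ z) v ∂area
      = inner ℝ (∫ z, u z • gradient ψ z ∂area) v := by
    rw [real_inner_comm, ← integral_inner hψi]
    exact integral_congr_ae (Eventually.of_forall fun z => real_inner_comm _ _)
  rw [show (fun x : ℂ => (convolution f e (ContinuousLinearMap.lsmul ℝ ℝ) volume) (r • x))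
    = (convolution f e (ContinuousLinearMap.lsmul ℝ ℝ) volume) ∘ fun x : ℂ => r • x from rfl,
    hcomp.fderiv, h3, inner_smul_left, inner_neg_left, ← h5, ← h4]
  simp

/-- Shrinking the argument before mollifying keeps every bump inside the disk, so extension of `u`
by zero is harmless and the approximations are smooth on the whole plane. -/
theorem exists_contDiff_approx {u : ℂ → ℝ} {g : ℂ → ℂ} (hu : MemLp u 2 area)
    (hg : IsWeakGradient u g) {δ : ℝ} (hδ : 0 < δ) :
    ∃ φ : ℂ → ℝ, ContDiff ℝ ∞ φ ∧
      eLpNorm (fun x => φ x - u x) 2 area ≤ ENNReal.ofReal δ ∧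
      eLpNorm (fun x => gradient φ x - g x) 2 area ≤ ENNReal.ofReal δ := by
  have hdm : MeasurableSet disk := Metric.isOpen_ball.measurableSet
  have hg2 := hg.1
  set f : ℂ → ℝ := disk.indicator (hu.1.mk u) with hf
  set F : ℂ → ℂ := disk.indicator (hg2.1.mk g) with hF
  have hfs : StronglyMeasurable f := hu.1.stronglyMeasurable_mk.indicator hdm
  have hFs : StronglyMeasurable F := hg2.1.stronglyMeasurable_mk.indicator hdm
  have hf2 : MemLp f 2 volume :=
    (memLp_indicator_iff_restrict hdm).2 (hu.ae_eq hu.1.ae_eq_mk)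
  have hF2 : MemLp F 2 volume :=
    (memLp_indicator_iff_restrict hdm).2 (hg2.ae_eq hg2.1.ae_eq_mk)
  have hfi : Integrable f volume := by
    rw [hf, integrable_indicator_iff hdm]
    exact (hu.ae_eq hu.1.ae_eq_mk).integrable (μ := area) (by norm_num)
  have hFi : Integrable F volume := by
    rw [hF, integrable_indicator_iff hdm]
    exact (hg2.ae_eq hg2.1.ae_eq_mk).integrable (μ := area) (by norm_num)
  have hfu : f =ᵐ[volume] disk.indicator u := by
    filter_upwards [(ae_restrict_iff' hdm).1 hu.1.ae_eq_mk] with x hx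
    simp only [hf, indicator]
    split_ifs with h
    · exact (hx h).symm
    · rfl
  have hFg : F =ᵐ[volume] disk.indicator g := by
    filter_upwards [(ae_restrict_iff' hdm).1 hg2.1.ae_eq_mk] with x hx
    simp only [hF, indicator]
    split_ifs with h
    · exact (hx h).symm
    · rfl
  set N := (eLpNorm F 2 volume).toReal with hN
  have hN0 : 0 ≤ N := ENNReal.toReal_nonneg
  obtain ⟨ρ₁, hρ₁, h1⟩ := exists_eLpNorm_comp_affine_sub_le hfs hf2 hδ
  obtain ⟨ρ₂, hρ₂, h2⟩ := exists_eLpNorm_comp_affine_sub_le hFs hF2 (half_pos hδ)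
  obtain ⟨ε, hε0, hε1, hε2, hε3, hε4⟩ : ∃ ε : ℝ, 0 < ε ∧ ε ≤ 1 / 4 ∧ 2 * ε ≤ ρ₁ ∧ 2 * ε ≤ ρ₂ ∧
      2 * ε * N ≤ δ / 2 := by
    refine ⟨min (min (1 / 4) (δ / (4 * (N + 1)))) (min (ρ₁ / 2) (ρ₂ / 2)), by positivity,
      (min_le_left _ _).trans (min_le_left _ _), ?_, ?_, ?_⟩
    · have := (min_le_right (min (1 / 4) (δ / (4 * (N + 1)))) _).trans
        (min_le_left (ρ₁ / 2) (ρ₂ / 2))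
      linarith
    · have := (min_le_right (min (1 / 4) (δ / (4 * (N + 1)))) _).trans
        (min_le_right (ρ₁ / 2) (ρ₂ / 2))
      linarith
    · have := (min_le_left _ (min (ρ₁ / 2) (ρ₂ / 2))).trans
        (min_le_right (1 / 4) (δ / (4 * (N + 1))))
      rw [le_div_iff₀ (by positivity)] at this
      have h0 : 0 ≤ min (min (1 / 4) (δ / (4 * (N + 1)))) (min (ρ₁ / 2) (ρ₂ / 2)) := by positivity
      nlinarith
  set η : ContDiffBump (0 : ℂ) := ⟨ε / 2, ε, by positivity, by linarith⟩ with hη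
  -- The gap `2ε` exceeds the bump radius `ε`, so the closed ball of radius `ε` about `r x` stays in
  -- the disk.
  set r : ℝ := 1 - 2 * ε with hr
  have hr1 : |r - 1| = 2 * ε := by
    rw [hr, show 1 - 2 * ε - 1 = -(2 * ε) by ring, abs_neg, abs_of_pos (by positivity)]
  refine ⟨mollify η r f, contDiff_mollify hfi η r, ?_, ?_⟩
  · calc eLpNorm (fun x => mollify η r f x - u x) 2 area
        = eLpNorm (fun x => mollify η r f x - f x) 2 area := by
          refine eLpNorm_congr_ae ?_
          filter_upwards [ae_restrict_of_ae hfu, ae_restrict_mem hdm] with x hx hxd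
          rw [hx, indicator_of_mem hxd]
      _ ≤ eLpNorm (fun x => mollify η r f x - f x) 2 volume :=
          eLpNorm_mono_measure _ Measure.restrict_le_self
      _ ≤ _ := eLpNorm_mollify_sub_le hfs hfi η r fun y hy =>
          h1 r y (hr1.le.trans hε2) (hy.trans (by simp only [hη]; linarith))
  · have hSF : eLpNorm (fun x => mollify η r F x - F x) 2 volume ≤ ENNReal.ofReal (δ / 2) :=
      eLpNorm_mollify_sub_le hFs hFi η r fun y hy =>
          h2 r y (hr1.le.trans hε3) (hy.trans (by simp only [hη]; linarith))
    have hSFm : AEStronglyMeasurable (fun x => mollify η r F x - F x) volume := by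
      refine AEStronglyMeasurable.sub ?_ hFs.aestronglyMeasurable
      have : StronglyMeasurable fun p : ℂ × ℂ => η.normed volume p.2 • F (r • p.1 - p.2) :=
        (η.continuous_normed.stronglyMeasurable.comp_measurable measurable_snd).smul
          (hFs.comp_measurable (by fun_prop))
      exact this.integral_prod_right.aestronglyMeasurable
    -- On the disk, with `S` the smoothing, the gradient error is `r S F - F = r (S F - F) - 2ε F`,
    -- because `r = 1 - 2ε`.
    calc eLpNorm (fun x => gradient (mollify η r f) x - g x) 2 area
        = eLpNorm ((r • fun x => mollify η r F x - F x) - (2 * ε) • F) 2 area := by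
          refine eLpNorm_congr_ae ?_
          filter_upwards [ae_restrict_of_ae hFg, ae_restrict_mem hdm] with x hx hxd
          rw [gradient_mollify (hu.integrable (by norm_num)) hg hfu hFg hfi η r x ?_,
            ← indicator_of_mem (f := g) hxd, ← hx]
          · simp only [Pi.sub_apply, Pi.smul_apply, smul_sub, hr, sub_smul, one_smul]
            abel
          · intro z hz
            rw [Metric.mem_closedBall, dist_eq_norm] at hz
            rw [disk, mem_ball_zero_iff] at hxd ⊢
            have hr0 : 0 < r := by linarith
            have : ‖z‖ ≤ ‖z - r • x‖ + ‖r • x‖ := by simpa using norm_add_le (z - r • x) (r • x)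
            rw [norm_smul, Real.norm_eq_abs, abs_of_pos hr0] at this
            have hz' : ‖z - r • x‖ ≤ ε := hz
            nlinarith
      _ ≤ eLpNorm ((r • fun x => mollify η r F x - F x) - (2 * ε) • F) 2 volume :=
          eLpNorm_mono_measure _ Measure.restrict_le_self
      _ ≤ eLpNorm (r • fun x => mollify η r F x - F x) 2 volume + eLpNorm ((2 * ε) • F) 2 volume :=
          eLpNorm_sub_le (hSFm.const_smul r) (hFs.aestronglyMeasurable.const_smul _) (by norm_num)
      _ ≤ ENNReal.ofReal (δ / 2) + ENNReal.ofReal (δ / 2) := by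
          rw [eLpNorm_const_smul, eLpNorm_const_smul]
          refine add_le_add ?_ ?_
          · refine (mul_le_of_le_one_left' ?_).trans hSF
            rw [Real.enorm_of_nonneg (by linarith)]
            exact ENNReal.ofReal_le_one.2 (by linarith)
          · rw [Real.enorm_of_nonneg (by linarith), ← ENNReal.ofReal_toReal hF2.2.ne, ← hN,
              ← ENNReal.ofReal_mul (by linarith)]
            exact ENNReal.ofReal_le_ofReal hε4
      _ = _ := by
          rw [← ENNReal.ofReal_add (by positivity) (by positivity), add_halves]

theorem exists_contDiff_tendsto {u : ℂ → ℝ} {g : ℂ → ℂ} (hu : MemLp u 2 area)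
    (hg : IsWeakGradient u g) :
    ∃ φ : ℕ → ℂ → ℝ, (∀ n, ContDiff ℝ ∞ (φ n)) ∧
      Tendsto (fun n => eLpNorm (fun x => φ n x - u x) 2 area) atTop (𝓝 0) ∧
      Tendsto (fun n => eLpNorm (fun x => gradient (φ n) x - g x) 2 area) atTop (𝓝 0) := by
  choose φ h1 h2 h3 using fun n : ℕ =>
    exists_contDiff_approx hu hg (δ := 1 / ((n : ℝ) + 1)) (by positivity)
  have h0 : Tendsto (fun n : ℕ => ENNReal.ofReal (1 / ((n : ℝ) + 1))) atTop (𝓝 0) := by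
    simpa using ENNReal.tendsto_ofReal tendsto_one_div_add_atTop_nhds_zero_nat
  exact ⟨φ, h1, tendsto_of_tendsto_of_tendsto_of_le_of_le tendsto_const_nhds h0
    (fun _ => zero_le) h2, tendsto_of_tendsto_of_tendsto_of_le_of_le tendsto_const_nhds h0
    (fun _ => zero_le) h3⟩

/-! ### Weak gradients and traces: existence, uniqueness, constants -/

theorem isWeakGradient_weakGradient {u : ℂ → ℝ} (hu : MemH1 u) :
    IsWeakGradient u (weakGradient u) :=
  Classical.epsilon_spec hu.2

/-- `weakGradient` is picked by choice, so its behaviour under adding constants rests on this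
uniqueness. The difference of two weak gradients is orthogonal to all test functions. -/
theorem IsWeakGradient.ae_eq {u : ℂ → ℝ} {g₁ g₂ : ℂ → ℂ} (h₁ : IsWeakGradient u g₁)
    (h₂ : IsWeakGradient u g₂) : g₁ =ᵐ[area] g₂ := by
  have hdm : MeasurableSet disk := Metric.isOpen_ball.measurableSet
  have i₁ : Integrable g₁ area := h₁.1.integrable (by norm_num)
  have i₂ : Integrable g₂ area := h₂.1.integrable (by norm_num)
  have key := IsOpen.ae_eq_zero_of_integral_contDiff_smul_eq_zero (μ := (volume : Measure ℂ))
    (U := disk) (f := fun x => g₁ x - g₂ x) Metric.isOpen_ball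
    (IntegrableOn.locallyIntegrableOn (i₁.sub i₂)) ?_
  · filter_upwards [(ae_restrict_iff' hdm).2 key] with x hx
    exact sub_eq_zero.1 hx
  · intro ψ hψ hψs hψt
    obtain ⟨M, hM⟩ := hψs.exists_bound_of_continuous hψ.continuous
    have j : ∀ g : ℂ → ℂ, Integrable g area → Integrable (fun x => ψ x • g x) area := fun g hg =>
      hg.bdd_smul M hψ.continuous.aestronglyMeasurable (Eventually.of_forall hM)
    have e := (h₁.2 ψ hψ hψs hψt).symm.trans (h₂.2 ψ hψ hψs hψt)
    calc ∫ x, ψ x • (g₁ x - g₂ x) = ∫ x, ψ x • (g₁ x - g₂ x) ∂area := by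
          refine (setIntegral_eq_integral_of_forall_compl_eq_zero fun x hx => ?_).symm
          rw [image_eq_zero_of_notMem_tsupport fun h => hx (hψt h), zero_smul]
      _ = ∫ x, ψ x • g₁ x ∂area - ∫ x, ψ x • g₂ x ∂area := by
          simp only [smul_sub]
          exact integral_sub (j _ i₁) (j _ i₂)
      _ = 0 := by rw [neg_inj.1 e, sub_self]

theorem integral_gradient_eq_zero {ψ : ℂ → ℝ} (hψ : ContDiff ℝ ∞ ψ) (hψs : HasCompactSupport ψ)
    (hψt : tsupport ψ ⊆ disk) : ∫ x, gradient ψ x ∂area = 0 := by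
  have hc := continuous_gradient hψ
  have hs : HasCompactSupport (gradient ψ) :=
    (hψs.fderiv ℝ).comp_left (g := (InnerProductSpace.toDual ℝ ℂ).symm) (map_zero _)
  have hi : Integrable (gradient ψ) volume := hc.integrable_of_hasCompactSupport hs
  have h1 : ∫ x, gradient ψ x ∂area = ∫ x, gradient ψ x := by
    refine setIntegral_eq_integral_of_forall_compl_eq_zero fun x hx => ?_
    have : x ∉ tsupport (fderiv ℝ ψ) := fun h => hx (hψt (tsupport_fderiv_subset ℝ h))
    rw [gradient, image_eq_zero_of_notMem_tsupport this, map_zero]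
  rw [h1]
  refine ext_inner_right ℝ fun v => ?_
  rw [real_inner_comm, ← integral_inner hi, inner_zero_left]
  have e : ∀ x, inner ℝ v (gradient ψ x) = 1 * fderiv ℝ ψ x v := fun x => by
    rw [real_inner_comm, inner_gradient, one_mul]
  have hj : Integrable (fun x => fderiv ℝ ψ x v) volume := by
    simpa only [e, one_mul] using hi.const_inner (𝕜 := ℝ) v
  simp only [e]
  rw [integral_mul_fderiv_eq_neg_fderiv_mul_of_integrable (f := fun _ => (1 : ℝ))]
  · simp
  · simp
  · simpa using hj
  · simpa using hψ.continuous.integrable_of_hasCompactSupport hψs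
  · fun_prop
  · exact fun x _ => hψ.differentiable (by simp) x

theorem IsWeakGradient.add_const {u : ℂ → ℝ} {g : ℂ → ℂ} (hu : MemLp u 2 area)
    (h : IsWeakGradient u g) (c : ℝ) : IsWeakGradient (fun x => u x + c) g := by
  refine ⟨h.1, fun ψ hψ hψs hψt => ?_⟩
  rw [← h.2 ψ hψ hψs hψt]
  have hs : HasCompactSupport (gradient ψ) :=
    (hψs.fderiv ℝ).comp_left (g := (InnerProductSpace.toDual ℝ ℂ).symm) (map_zero _)
  obtain ⟨M, hM⟩ := hs.exists_bound_of_continuous (continuous_gradient hψ)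
  have i1 : Integrable (fun x => u x • gradient ψ x) area :=
    (hu.integrable (by norm_num)).smul_bdd M (continuous_gradient hψ).aestronglyMeasurable
      (Eventually.of_forall hM)
  have i2 : Integrable (fun x => c • gradient ψ x) area :=
    (((continuous_gradient hψ).integrable_of_hasCompactSupport hs).smul c).mono_measure
      Measure.restrict_le_self
  simp only [add_smul]
  rw [integral_add i1 i2, integral_smul, integral_gradient_eq_zero hψ hψs hψt, smul_zero, add_zero]

theorem MemH1.add_const {u : ℂ → ℝ} (hu : MemH1 u) (c : ℝ) : MemH1 fun x => u x + c :=
  ⟨hu.1.add (memLp_const c), _, (isWeakGradient_weakGradient hu).add_const hu.1 c⟩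

theorem weakGradient_add_const {u : ℂ → ℝ} (hu : MemH1 u) (c : ℝ) :
    weakGradient (fun x => u x + c) =ᵐ[area] weakGradient u :=
  (isWeakGradient_weakGradient (hu.add_const c)).ae_eq
    ((isWeakGradient_weakGradient hu).add_const hu.1 c)

theorem eLpNorm_gradient (φ : ℂ → ℝ) :
    eLpNorm (gradient φ) 2 area ^ 2 = ∫⁻ x, ‖fderiv ℝ φ x‖ₑ ^ 2 ∂area := by
  rw [eLpNorm_two_sq]
  refine lintegral_congr fun x => ?_
  rw [← ofReal_norm (gradient φ x), norm_gradient, ofReal_norm]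

/-- The product form matters: a function small in `L²` whose gradient is merely bounded has a small
trace. -/
theorem eLpNorm_arcLength_sq_le {φ : ℂ → ℝ} (hφ : ContDiff ℝ ∞ φ) :
    eLpNorm φ 2 arcLength ^ 2
      ≤ 2 * (eLpNorm φ 2 area ^ 2 + eLpNorm φ 2 area * eLpNorm (gradient φ) 2 area) := by
  have h := lintegral_arcLength_sq_le hφ
  rw [← eLpNorm_two_sq, ← eLpNorm_two_sq] at h
  refine h.trans ?_
  gcongr
  rw [← ENNReal.pow_le_pow_left_iff two_ne_zero, mul_pow, eLpNorm_two_sq, eLpNorm_gradient]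
  have m1 : Measurable fun x => ‖φ x‖ₑ := hφ.continuous.measurable.enorm
  have m2 : Measurable fun x => ‖fderiv ℝ φ x‖ₑ :=
    (hφ.continuous_fderiv (by simp)).measurable.enorm
  exact lintegral_mul_sq_le area m1.aemeasurable m2.aemeasurable

theorem eLpNorm_arcLength_le {φ : ℂ → ℝ} (hφ : ContDiff ℝ ∞ φ) :
    eLpNorm φ 2 arcLength ≤ 2 * (eLpNorm φ 2 area + eLpNorm (gradient φ) 2 area) := by
  rw [← ENNReal.pow_le_pow_left_iff two_ne_zero]
  refine (eLpNorm_arcLength_sq_le hφ).trans ?_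
  generalize eLpNorm φ 2 area = a
  generalize eLpNorm (gradient φ) 2 area = b
  calc 2 * (a ^ 2 + a * b) ≤ 2 * (a ^ 2 + a * b) + (2 * a ^ 2 + 6 * (a * b) + 4 * b ^ 2) :=
        le_self_add
    _ = _ := by ring

theorem gradient_sub {φ ψ : ℂ → ℝ} (hφ : ContDiff ℝ ∞ φ) (hψ : ContDiff ℝ ∞ ψ) (x : ℂ) :
    gradient (fun x => φ x - ψ x) x = gradient φ x - gradient ψ x := by
  rw [gradient, gradient, gradient, ← map_sub,
    ← fderiv_fun_sub (hφ.differentiable (by simp) x) (hψ.differentiable (by simp) x)]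

theorem eLpNorm_sub_le_add {E : Type*} [NormedAddCommGroup E] {μ : Measure ℂ} {f g h : ℂ → E}
    (hf : AEStronglyMeasurable f μ) (hg : AEStronglyMeasurable g μ)
    (hh : AEStronglyMeasurable h μ) :
    eLpNorm (fun x => f x - g x) 2 μ
      ≤ eLpNorm (fun x => f x - h x) 2 μ + eLpNorm (fun x => g x - h x) 2 μ := by
  have e : (fun x => f x - g x) = (fun x => f x - h x) - fun x => g x - h x := by
    funext x
    simp
  rw [e]
  exact eLpNorm_sub_le (hf.sub hh) (hg.sub hh) (by norm_num)

/-- Two smooth functions close to the same `H¹` function are close on the circle. -/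
theorem eLpNorm_arcLength_sub_le {u : ℂ → ℝ} {g : ℂ → ℂ} (hu : AEStronglyMeasurable u area)
    (hg : AEStronglyMeasurable g area) {φ ψ : ℂ → ℝ} (hφ : ContDiff ℝ ∞ φ)
    (hψ : ContDiff ℝ ∞ ψ) :
    eLpNorm (fun x => φ x - ψ x) 2 arcLength
      ≤ 2 * (eLpNorm (fun x => φ x - u x) 2 area + eLpNorm (fun x => gradient φ x - g x) 2 area)
        + 2 * (eLpNorm (fun x => ψ x - u x) 2 area
          + eLpNorm (fun x => gradient ψ x - g x) 2 area) := by
  refine (eLpNorm_arcLength_le (hφ.sub hψ)).trans ?_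
  rw [show gradient (fun x => φ x - ψ x) = fun x => gradient φ x - gradient ψ x from
    funext (gradient_sub hφ hψ)]
  have h1 := eLpNorm_sub_le_add (μ := area) hφ.continuous.aestronglyMeasurable
    hψ.continuous.aestronglyMeasurable hu
  have h2 := eLpNorm_sub_le_add (μ := area) (continuous_gradient hφ).aestronglyMeasurable
    (continuous_gradient hψ).aestronglyMeasurable hg
  refine (mul_le_mul_right (add_le_add h1 h2) 2).trans (le_of_eq ?_)
  ring

theorem memLp_arcLength {φ : ℂ → ℝ} (hφ : Continuous φ) : MemLp φ 2 arcLength := by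
  obtain ⟨M, hM⟩ := (isCompact_sphere (0 : ℂ) 1).exists_bound_of_continuousOn hφ.continuousOn
  refine MemLp.of_bound hφ.aestronglyMeasurable M ?_
  filter_upwards [ae_arcLength_norm] with x hx
  exact hM x (by simpa using hx)

theorem exists_tendsto_eLpNorm_sub {μ : Measure ℂ} {f : ℕ → ℂ → ℝ} (hf : ∀ n, MemLp (f n) 2 μ)
    {c : ℕ → ℝ≥0∞} (hc : Tendsto c atTop (𝓝 0))
    (h : ∀ m n, eLpNorm (fun x => f m x - f n x) 2 μ ≤ c m + c n) :
    ∃ t, MemLp t 2 μ ∧ Tendsto (fun n => eLpNorm (fun x => f n x - t x) 2 μ) atTop (𝓝 0) := by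
  have : Fact ((1 : ℝ≥0∞) ≤ 2) := ⟨by norm_num⟩
  have hcau : CauchySeq fun n => (hf n).toLp (f n) := by
    refine EMetric.cauchySeq_iff.2 fun ε hε => ?_
    obtain ⟨N, hN⟩ := eventually_atTop.1 (hc.eventually_lt_const (ENNReal.half_pos hε.ne'))
    refine ⟨N, fun m hm n hn => ?_⟩
    rw [Lp.edist_toLp_toLp]
    refine (h m n).trans_lt ?_
    exact (ENNReal.add_lt_add (hN m hm) (hN n hn)).trans_eq (ENNReal.add_halves ε)
  obtain ⟨T, hT⟩ := cauchySeq_tendsto_of_complete hcau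
  refine ⟨T, Lp.memLp T, (tendsto_iff_edist_tendsto_0.1 hT).congr fun n => ?_⟩
  rw [Lp.edist_def]
  refine eLpNorm_congr_ae ?_
  filter_upwards [(hf n).coeFn_toLp] with x hx
  rw [Pi.sub_apply, hx]

/-- By the trace inequality smooth approximations of `u` are Cauchy in `L²` of the circle, which is
complete. -/
theorem exists_isTrace {u : ℂ → ℝ} (hu : MemH1 u) : ∃ t, IsTrace u t := by
  have hw := isWeakGradient_weakGradient hu
  obtain ⟨φ, hφ, h1, h2⟩ := exists_contDiff_tendsto hu.1 hw
  have hc := ENNReal.Tendsto.const_mul (a := 2) (h1.add h2) (Or.inr (by norm_num))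
  rw [add_zero, mul_zero] at hc
  obtain ⟨t, ht, h3⟩ := exists_tendsto_eLpNorm_sub
    (fun n => memLp_arcLength (hφ n).continuous) hc
    fun m n => eLpNorm_arcLength_sub_le hu.1.1 hw.1.1 (hφ m) (hφ n)
  exact ⟨t, ht, φ, hφ, h1, h2, h3⟩

theorem isTrace_boundaryTrace {u : ℂ → ℝ} (hu : MemH1 u) : IsTrace u (boundaryTrace u) :=
  Classical.epsilon_spec (exists_isTrace hu)

theorem IsTrace.ae_eq {u t₁ t₂ : ℂ → ℝ} (hu : MemH1 u) (h₁ : IsTrace u t₁) (h₂ : IsTrace u t₂) :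
    t₁ =ᵐ[arcLength] t₂ := by
  have hw := isWeakGradient_weakGradient hu
  obtain ⟨m₁, φ, hφ, a₁, b₁, c₁⟩ := h₁
  obtain ⟨m₂, ψ, hψ, a₂, b₂, c₂⟩ := h₂
  have hle : ∀ n, eLpNorm (fun x => t₁ x - t₂ x) 2 arcLength
      ≤ eLpNorm (fun x => φ n x - t₁ x) 2 arcLength + eLpNorm (fun x => ψ n x - t₂ x) 2 arcLength
        + (2 * (eLpNorm (fun x => φ n x - u x) 2 area
            + eLpNorm (fun x => gradient (φ n) x - weakGradient u x) 2 area)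
        + 2 * (eLpNorm (fun x => ψ n x - u x) 2 area
          + eLpNorm (fun x => gradient (ψ n) x - weakGradient u x) 2 area)) := by
    intro n
    have e : (fun x => t₁ x - t₂ x)
        = ((fun x => φ n x - ψ n x) - fun x => φ n x - t₁ x) + fun x => ψ n x - t₂ x := by
      funext x
      simp only [Pi.add_apply, Pi.sub_apply]
      ring
    have s₁ := (hφ n).continuous.aestronglyMeasurable (μ := arcLength)
    have s₂ := (hψ n).continuous.aestronglyMeasurable (μ := arcLength)
    rw [e]
    calc _ ≤ (eLpNorm (fun x => φ n x - ψ n x) 2 arcLength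
            + eLpNorm (fun x => φ n x - t₁ x) 2 arcLength)
            + eLpNorm (fun x => ψ n x - t₂ x) 2 arcLength := by
          refine (eLpNorm_add_le ((s₁.sub s₂).sub (s₁.sub m₁.1)) (s₂.sub m₂.1)
            (by norm_num)).trans ?_
          exact add_le_add_left (eLpNorm_sub_le (s₁.sub s₂) (s₁.sub m₁.1) (by norm_num)) _
      _ = eLpNorm (fun x => φ n x - t₁ x) 2 arcLength
            + eLpNorm (fun x => ψ n x - t₂ x) 2 arcLength
            + eLpNorm (fun x => φ n x - ψ n x) 2 arcLength := by ring
      _ ≤ _ := by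
          gcongr
          exact eLpNorm_arcLength_sub_le hu.1.1 hw.1.1 (hφ n) (hψ n)
  have h2 : ∀ {f : ℕ → ℝ≥0∞}, Tendsto f atTop (𝓝 0) → Tendsto (fun n => 2 * f n) atTop (𝓝 0) :=
    fun hf => by simpa using ENNReal.Tendsto.const_mul (a := 2) hf (Or.inr (by norm_num))
  have hadd : ∀ {f g : ℕ → ℝ≥0∞}, Tendsto f atTop (𝓝 0) → Tendsto g atTop (𝓝 0) →
      Tendsto (fun n => f n + g n) atTop (𝓝 0) := fun hf hg => by simpa using hf.add hg
  have h0 : eLpNorm (fun x => t₁ x - t₂ x) 2 arcLength = 0 := le_antisymm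
    (ge_of_tendsto' (hadd (hadd c₁ c₂) (hadd (h2 (hadd a₁ b₁)) (h2 (hadd a₂ b₂)))) hle) zero_le
  filter_upwards [(eLpNorm_eq_zero_iff (m₁.1.sub m₂.1) (by norm_num)).1 h0] with x hx
  exact sub_eq_zero.1 hx

theorem boundaryTrace_add_const {u : ℂ → ℝ} (hu : MemH1 u) (c : ℝ) :
    boundaryTrace (fun x => u x + c) =ᵐ[arcLength] fun x => boundaryTrace u x + c := by
  obtain ⟨m, φ, hφ, h1, h2, h3⟩ := isTrace_boundaryTrace hu
  refine (isTrace_boundaryTrace (hu.add_const c)).ae_eq (hu.add_const c)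
    ⟨m.add (memLp_const c), fun n x => φ n x + c, fun n => (hφ n).add contDiff_const, ?_, ?_, ?_⟩
  · simpa only [add_sub_add_right_eq_sub] using h1
  · refine h2.congr fun n => eLpNorm_congr_ae ?_
    filter_upwards [weakGradient_add_const hu c] with x hx
    rw [hx, gradient, gradient, fderiv_add_const]
  · simpa only [add_sub_add_right_eq_sub] using h3

theorem tendsto_eLpNorm_of_sub {E : Type*} [NormedAddCommGroup E] {μ : Measure ℂ}
    {f : ℕ → ℂ → E} {g : ℂ → E} (hf : ∀ n, AEStronglyMeasurable (f n) μ) (hg : MemLp g 2 μ)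
    (h : Tendsto (fun n => eLpNorm (fun x => f n x - g x) 2 μ) atTop (𝓝 0)) :
    Tendsto (fun n => eLpNorm (f n) 2 μ) atTop (𝓝 (eLpNorm g 2 μ)) := by
  have l1 := ENNReal.Tendsto.sub (tendsto_const_nhds (x := eLpNorm g 2 μ)) h (Or.inl hg.2.ne)
  have l2 := (tendsto_const_nhds (x := eLpNorm g 2 μ)).add h
  rw [tsub_zero] at l1
  rw [add_zero] at l2
  refine tendsto_of_tendsto_of_tendsto_of_le_of_le l1 l2 (fun n => ?_) fun n => ?_
  · refine tsub_le_iff_right.2 ?_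
    have e : g = f n - fun x => f n x - g x := by
      funext x
      simp
    conv_lhs => rw [e]
    exact eLpNorm_sub_le (hf n) ((hf n).sub hg.1) (by norm_num)
  · have e : f n = g + fun x => f n x - g x := by
      funext x
      simp
    conv_lhs => rw [e]
    exact eLpNorm_add_le hg.1 ((hf n).sub hg.1) (by norm_num)

theorem eLpNorm_boundaryTrace_le {u : ℂ → ℝ} (hu : MemH1 u) :
    eLpNorm (boundaryTrace u) 2 arcLength
      ≤ 2 * (eLpNorm u 2 area + eLpNorm (weakGradient u) 2 area) := by
  have hw := isWeakGradient_weakGradient hu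
  obtain ⟨m, φ, hφ, h1, h2, h3⟩ := isTrace_boundaryTrace hu
  have l1 := tendsto_eLpNorm_of_sub (fun n => (hφ n).continuous.aestronglyMeasurable) hu.1 h1
  have l2 := tendsto_eLpNorm_of_sub
    (fun n => (continuous_gradient (hφ n)).aestronglyMeasurable) hw.1 h2
  have l3 := tendsto_eLpNorm_of_sub (fun n => (hφ n).continuous.aestronglyMeasurable) m h3
  exact le_of_tendsto_of_tendsto' l3
    (ENNReal.Tendsto.const_mul (l1.add l2) (Or.inr (by norm_num)))
    fun n => eLpNorm_arcLength_le (hφ n)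

/-! ### Moser–Trudinger inequalities for symmetric `H¹` functions -/

/-- Fatou's lemma along an almost everywhere convergent subsequence; an upper bound for the limit
needs no uniform integrability. -/
theorem lintegral_exp_le_of_tendsto {μ : Measure ℂ} {v : ℂ → ℝ} {f : ℕ → ℂ → ℝ}
    (hf : ∀ n, Continuous (f n)) (hv : AEStronglyMeasurable v μ)
    (h : Tendsto (fun n => eLpNorm (fun x => f n x - v x) 2 μ) atTop (𝓝 0))
    {c : ℕ → ℝ} {c' : ℝ} (hc : Tendsto c atTop (𝓝 c'))
    (hle : ∀ n, ∫⁻ x, ENNReal.ofReal (Real.exp (f n x)) ∂μ ≤ ENNReal.ofReal (Real.exp (c n))) :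
    ∫⁻ x, ENNReal.ofReal (Real.exp (v x)) ∂μ ≤ ENNReal.ofReal (Real.exp c') := by
  obtain ⟨ns, hns, hae⟩ := (tendstoInMeasure_of_tendsto_eLpNorm (p := 2) (by norm_num)
    (fun n => (hf n).aestronglyMeasurable) hv h).exists_seq_tendsto_ae
  have h1 : Tendsto (fun n => ENNReal.ofReal (Real.exp (c (ns n)))) atTop
      (𝓝 (ENNReal.ofReal (Real.exp c'))) :=
    ENNReal.tendsto_ofReal ((Real.continuous_exp.tendsto _).comp (hc.comp hns.tendsto_atTop))
  calc ∫⁻ x, ENNReal.ofReal (Real.exp (v x)) ∂μ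
      = ∫⁻ x, liminf (fun n => ENNReal.ofReal (Real.exp (f (ns n) x))) atTop ∂μ := by
        refine lintegral_congr_ae (hae.mono fun x hx => ?_)
        exact (ENNReal.tendsto_ofReal ((Real.continuous_exp.tendsto _).comp hx)).liminf_eq.symm
    _ ≤ liminf (fun n => ∫⁻ x, ENNReal.ofReal (Real.exp (f (ns n) x)) ∂μ) atTop :=
        lintegral_liminf_le fun n =>
          (Real.continuous_exp.comp (hf (ns n))).measurable.ennreal_ofReal
    _ ≤ liminf (fun n => ENNReal.ofReal (Real.exp (c (ns n)))) atTop :=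
        liminf_le_liminf (Eventually.of_forall fun n => hle (ns n))
    _ = _ := h1.liminf_eq

theorem eLpNorm_half_add_sub_le {μ : Measure ℂ} {f g u : ℂ → ℝ} (hf : AEStronglyMeasurable f μ)
    (hg : AEStronglyMeasurable g μ) (hu : AEStronglyMeasurable u μ) :
    eLpNorm (fun x => 1 / 2 * (f x + g x) - u x) 2 μ
      ≤ eLpNorm (fun x => f x - u x) 2 μ + eLpNorm (fun x => g x - u x) 2 μ := by
  have e : (fun x => 1 / 2 * (f x + g x) - u x)
      = (1 / 2 : ℝ) • ((fun x => f x - u x) + fun x => g x - u x) := by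
    funext x
    simp only [Pi.smul_apply, Pi.add_apply, smul_eq_mul]
    ring
  rw [e, eLpNorm_const_smul]
  refine (mul_le_of_le_one_left' ?_).trans (eLpNorm_add_le (hf.sub hu) (hg.sub hu) (by norm_num))
  rw [Real.enorm_of_nonneg (by norm_num)]
  exact ENNReal.ofReal_le_one.2 (by norm_num)

theorem eLpNorm_const_mul_sub (μ : Measure ℂ) (c : ℝ) (f g : ℂ → ℝ) :
    eLpNorm (fun x => c * f x - c * g x) 2 μ = ‖c‖ₑ * eLpNorm (fun x => f x - g x) 2 μ := by
  rw [← eLpNorm_const_smul]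
  congr 1
  funext x
  simp [mul_sub]

section Rotation

variable {ζ : ℂ}

theorem contDiff_comp_mul {φ : ℂ → ℝ} (hφ : ContDiff ℝ ∞ φ) (ζ : ℂ) :
    ContDiff ℝ ∞ fun x => φ (ζ * x) :=
  hφ.comp (contDiff_const.mul contDiff_id)

theorem eLpNorm_comp_mul_sub (hζ : ‖ζ‖ = 1) {u : ℂ → ℝ} (hu : AEStronglyMeasurable u area)
    (hinv : (fun x => u (ζ * x)) =ᵐ[area] u) {φ : ℂ → ℝ} (hφ : Continuous φ) :
    eLpNorm (fun x => φ (ζ * x) - u x) 2 area = eLpNorm (fun x => φ x - u x) 2 area := by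
  have h := eLpNorm_comp_measurePreserving (f := fun x => ζ * x) (p := 2)
    (hφ.aestronglyMeasurable.sub hu) (measurePreserving_mul_area hζ)
  refine Eq.trans (eLpNorm_congr_ae ?_) h
  filter_upwards [hinv] with x hx
  simp [hx]

theorem eLpNorm_gradient_comp_mul_le (hζ : ‖ζ‖ = 1) {φ : ℂ → ℝ} (hφ : ContDiff ℝ ∞ φ) :
    eLpNorm (gradient fun x => φ (ζ * x)) 2 area ≤ eLpNorm (gradient φ) 2 area := by
  rw [← eLpNorm_comp_measurePreserving (f := fun x => ζ * x)
    (continuous_gradient hφ).aestronglyMeasurable (measurePreserving_mul_area hζ)]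
  refine eLpNorm_mono fun x => ?_
  rw [Function.comp_apply, norm_gradient, norm_gradient]
  have h1 : HasFDerivAt (fun x : ℂ => ζ * x) (ContinuousLinearMap.mul ℝ ℂ ζ) x :=
    (ContinuousLinearMap.mul ℝ ℂ ζ).hasFDerivAt
  have h2 : HasFDerivAt (fun x => φ (ζ * x)) _ x :=
    (hφ.differentiable (by simp) (ζ * x)).hasFDerivAt.comp x h1
  rw [h2.fderiv]
  refine (ContinuousLinearMap.opNorm_comp_le _ _).trans
    (mul_le_of_le_one_right (norm_nonneg _) ?_)
  exact ((ContinuousLinearMap.opNorm_mul_apply_le ℝ ℂ ζ)).trans hζ.le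

/-- In the disk `φ n ∘ ζ - φ n` tends to zero in `L²` because `u` is invariant, while its gradients
stay bounded; the multiplicative trace inequality then makes it vanish on the circle. No rotation
formula for the weak gradient or for the trace is needed. -/
theorem tendsto_eLpNorm_comp_mul_arcLength (hζ : ‖ζ‖ = 1) {u : ℂ → ℝ} {g : ℂ → ℂ} {t : ℂ → ℝ}
    (hu : MemLp u 2 area) (hg : MemLp g 2 area) (ht : MemLp t 2 arcLength)
    (hinv : (fun x => u (ζ * x)) =ᵐ[area] u) {φ : ℕ → ℂ → ℝ} (hφ : ∀ n, ContDiff ℝ ∞ (φ n))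
    (h1 : Tendsto (fun n => eLpNorm (fun x => φ n x - u x) 2 area) atTop (𝓝 0))
    (h2 : Tendsto (fun n => eLpNorm (fun x => gradient (φ n) x - g x) 2 area) atTop (𝓝 0))
    (h3 : Tendsto (fun n => eLpNorm (fun x => φ n x - t x) 2 arcLength) atTop (𝓝 0)) :
    Tendsto (fun n => eLpNorm (fun x => φ n (ζ * x) - t x) 2 arcLength) atTop (𝓝 0) := by
  have hφ' := fun n => contDiff_comp_mul (hφ n) ζ
  set a := fun n => eLpNorm (fun x => φ n x - u x) 2 area with ha
  set b := fun n => eLpNorm (gradient (φ n)) 2 area with hb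
  have hbl : Tendsto b atTop (𝓝 (eLpNorm g 2 area)) := tendsto_eLpNorm_of_sub
    (fun n => (continuous_gradient (hφ n)).aestronglyMeasurable) hg h2
  set d := fun n => eLpNorm (fun x => φ n (ζ * x) - φ n x) 2 arcLength with hd
  have hd2 : ∀ n, d n ^ 2 ≤ 2 * ((2 * a n) ^ 2 + 2 * a n * (2 * b n)) := by
    intro n
    refine (eLpNorm_arcLength_sq_le ((hφ' n).sub (hφ n))).trans ?_
    have e1 : eLpNorm (fun x => φ n (ζ * x) - φ n x) 2 area ≤ 2 * a n := by
      refine (eLpNorm_sub_le_add (hφ' n).continuous.aestronglyMeasurable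
        (hφ n).continuous.aestronglyMeasurable hu.1).trans ?_
      rw [eLpNorm_comp_mul_sub hζ hu.1 hinv (hφ n).continuous, two_mul]
    have e2 : eLpNorm (gradient fun x => φ n (ζ * x) - φ n x) 2 area ≤ 2 * b n := by
      rw [show (gradient fun x => φ n (ζ * x) - φ n x)
        = (gradient fun x => φ n (ζ * x)) - gradient (φ n) from
          funext (gradient_sub (hφ' n) (hφ n))]
      refine (eLpNorm_sub_le (continuous_gradient (hφ' n)).aestronglyMeasurable
        (continuous_gradient (hφ n)).aestronglyMeasurable (by norm_num)).trans ?_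
      rw [two_mul]
      exact add_le_add_left (eLpNorm_gradient_comp_mul_le hζ (hφ n)) _
    gcongr
  have ha2 : Tendsto (fun n => 2 * a n) atTop (𝓝 0) := by
    simpa using ENNReal.Tendsto.const_mul (a := 2) h1 (Or.inr (by norm_num))
  have hb2 : Tendsto (fun n => 2 * b n) atTop (𝓝 (2 * eLpNorm g 2 area)) :=
    ENNReal.Tendsto.const_mul hbl (Or.inr (by norm_num))
  have hbt : 2 * eLpNorm g 2 area ≠ ⊤ := ENNReal.mul_ne_top (by norm_num) hg.2.ne
  have hR : Tendsto (fun n => 2 * ((2 * a n) ^ 2 + 2 * a n * (2 * b n))) atTop (𝓝 0) := by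
    have l1 := ENNReal.Tendsto.pow (n := 2) ha2
    have l2 := ENNReal.Tendsto.mul ha2 (Or.inr hbt) hb2 (Or.inr (by norm_num))
    have l3 := ENNReal.Tendsto.const_mul (a := 2) (l1.add l2) (Or.inr (by norm_num))
    simpa using l3
  have hd0 : Tendsto d atTop (𝓝 0) := by
    have l1 : Tendsto (fun n => d n ^ 2) atTop (𝓝 0) :=
      tendsto_of_tendsto_of_tendsto_of_le_of_le tendsto_const_nhds hR (fun _ => zero_le) hd2
    have l2 := l1.ennrpow_const (1 / 2)
    rw [ENNReal.zero_rpow_of_pos (by norm_num)] at l2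
    refine l2.congr fun n => ?_
    rw [← ENNReal.rpow_natCast, ← ENNReal.rpow_mul]
    norm_num
  have hsum : Tendsto (fun n => d n + eLpNorm (fun x => φ n x - t x) 2 arcLength) atTop (𝓝 0) := by
    simpa using hd0.add h3
  refine tendsto_of_tendsto_of_tendsto_of_le_of_le tendsto_const_nhds hsum
    (fun _ => zero_le) fun n => ?_
  have e : (fun x => φ n (ζ * x) - t x)
      = (fun x => φ n (ζ * x) - φ n x) + fun x => φ n x - t x := by
    funext x
    simp
  simp only [hd]
  rw [e]
  exact eLpNorm_add_le ((hφ' n).sub (hφ n)).continuous.aestronglyMeasurable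
    ((hφ n).continuous.aestronglyMeasurable.sub ht.1) (by norm_num)

theorem memLp_area {E : Type*} [NormedAddCommGroup E] [SecondCountableTopology E] {f : ℂ → E}
    (hf : Continuous f) : MemLp f 2 area := by
  obtain ⟨M, hM⟩ := (isCompact_closedBall (0 : ℂ) 1).exists_bound_of_continuousOn hf.continuousOn
  refine MemLp.of_bound hf.aestronglyMeasurable M ?_
  filter_upwards [ae_restrict_mem Metric.isOpen_ball.measurableSet] with x hx
  exact hM x (Metric.ball_subset_closedBall hx)

/-- The `L²(𝔻)` norm, as a real number. -/
def l2Norm {E : Type*} [NormedAddCommGroup E] (f : ℂ → E) : ℝ := (eLpNorm f 2 area).toReal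

theorem l2Norm_nonneg {E : Type*} [NormedAddCommGroup E] (f : ℂ → E) : 0 ≤ l2Norm f :=
  ENNReal.toReal_nonneg

theorem ofReal_l2Norm {E : Type*} [NormedAddCommGroup E] {f : ℂ → E} (hf : MemLp f 2 area) :
    ENNReal.ofReal (l2Norm f) = eLpNorm f 2 area :=
  ENNReal.ofReal_toReal hf.2.ne

theorem tendsto_l2Norm {E : Type*} [NormedAddCommGroup E] {f : ℕ → ℂ → E} {g : ℂ → E}
    (hf : ∀ n, AEStronglyMeasurable (f n) area) (hg : MemLp g 2 area)
    (h : Tendsto (fun n => eLpNorm (fun x => f n x - g x) 2 area) atTop (𝓝 0)) :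
    Tendsto (fun n => l2Norm (f n)) atTop (𝓝 (l2Norm g)) :=
  (ENNReal.tendsto_toReal hg.2.ne).comp (tendsto_eLpNorm_of_sub hf hg h)

theorem lintegral_fderiv_sq {φ : ℂ → ℝ} (hφ : ContDiff ℝ ∞ φ) :
    ∫⁻ z, ‖fderiv ℝ φ z‖ₑ ^ 2 ∂area = ENNReal.ofReal (l2Norm (gradient φ) ^ 2) := by
  rw [← eLpNorm_gradient, ENNReal.ofReal_pow (l2Norm_nonneg _),
    ofReal_l2Norm (memLp_area (continuous_gradient hφ))]

/-- The approximations need not be symmetric, but their averages with their rotations still converge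
to `u`, and the smooth estimate involves only the norms of `φ n` themselves. -/
theorem exists_lintegral_exp_area_le_of_memH1 (hζ : ‖ζ‖ = 1) (hζ1 : ζ ≠ 1) :
    ∃ L C : ℝ, 0 ≤ L ∧ ∀ u : ℂ → ℝ, MemH1 u → (fun x => u (ζ * x)) =ᵐ[area] u →
      ∫⁻ x, ENNReal.ofReal (Real.exp (u x)) ∂area ≤ ENNReal.ofReal (Real.exp
        (L * l2Norm u + l2Norm (weakGradient u) ^ 2 / (12 * Real.pi) + C)) := by
  obtain ⟨L, C, hL, h⟩ := exists_lintegral_exp_area_le hζ hζ1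
  refine ⟨L, C, hL, fun u hu hinv => ?_⟩
  have hw := isWeakGradient_weakGradient hu
  obtain ⟨-, φ, hφ, h1, h2, -⟩ := isTrace_boundaryTrace hu
  have hφ' := fun n => contDiff_comp_mul (hφ n) ζ
  have l1 := tendsto_l2Norm (fun n => (hφ n).continuous.aestronglyMeasurable) hu.1 h1
  have l2 := tendsto_l2Norm
    (fun n => (continuous_gradient (hφ n)).aestronglyMeasurable) hw.1 h2
  refine lintegral_exp_le_of_tendsto (f := fun n x => 1 / 2 * (φ n x + φ n (ζ * x)))
    (fun n => continuous_const.mul ((hφ n).continuous.add (hφ' n).continuous)) hu.1.1 ?_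
    (((l1.const_mul L).add ((l2.pow 2).div_const _)).add_const C) fun n => ?_
  · have h0 : Tendsto (fun n => eLpNorm (fun x => φ n x - u x) 2 area
        + eLpNorm (fun x => φ n x - u x) 2 area) atTop (𝓝 0) := by simpa using h1.add h1
    refine tendsto_of_tendsto_of_tendsto_of_le_of_le tendsto_const_nhds h0
      (fun _ => zero_le) fun n => ?_
    refine (eLpNorm_half_add_sub_le (hφ n).continuous.aestronglyMeasurable
      (hφ' n).continuous.aestronglyMeasurable hu.1.1).trans ?_
    rw [eLpNorm_comp_mul_sub hζ hu.1.1 hinv (hφ n).continuous]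
  · exact h (φ n) (hφ n) _ _ (l2Norm_nonneg _) (sq_nonneg _)
      (ofReal_l2Norm (memLp_area (hφ n).continuous)).ge (lintegral_fderiv_sq (hφ n)).le

/-- The circle estimate is applied to `φ n / 2`, which divides the energy by `4` and turns `6π` into
`24π`. -/
theorem exists_lintegral_exp_boundaryTrace_le (hζ : ‖ζ‖ = 1) (hζ1 : ζ ≠ 1) :
    ∃ L C : ℝ, 0 ≤ L ∧ ∀ u : ℂ → ℝ, MemH1 u → (fun x => u (ζ * x)) =ᵐ[area] u →
      ∫⁻ x, ENNReal.ofReal (Real.exp (boundaryTrace u x / 2)) ∂arcLength ≤ ENNReal.ofReal (Real.exp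
        (L * l2Norm u + l2Norm (weakGradient u) ^ 2 / (24 * Real.pi) + C)) := by
  obtain ⟨L, C, hL, h⟩ := exists_lintegral_exp_arcLength_le hζ hζ1
  refine ⟨L, C, hL, fun u hu hinv => ?_⟩
  have hw := isWeakGradient_weakGradient hu
  obtain ⟨ht, φ, hφ, h1, h2, h3⟩ := isTrace_boundaryTrace hu
  set t := boundaryTrace u with htdef
  have hφ' := fun n => contDiff_comp_mul (hφ n) ζ
  have l1 := tendsto_l2Norm (fun n => (hφ n).continuous.aestronglyMeasurable) hu.1 h1
  have l2 := tendsto_l2Norm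
    (fun n => (continuous_gradient (hφ n)).aestronglyMeasurable) hw.1 h2
  have h4 := tendsto_eLpNorm_comp_mul_arcLength hζ hu.1 hw.1 ht hinv hφ h1 h2 h3
  have e : ∀ x, t x / 2 = 1 / 2 * t x := fun x => by ring
  simp only [e]
  have hc : ∀ n, ContDiff ℝ ∞ fun x => 1 / 2 * φ n x := fun n => contDiff_const.mul (hφ n)
  have hc' : ∀ n, ContDiff ℝ ∞ fun x => 1 / 2 * φ n (ζ * x) := fun n => contDiff_const.mul (hφ' n)
  refine lintegral_exp_le_of_tendsto
    (f := fun n x => 1 / 2 * (1 / 2 * φ n x + 1 / 2 * φ n (ζ * x)))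
    (fun n => continuous_const.mul ((hc n).continuous.add (hc' n).continuous))
    (ht.1.const_mul _) ?_
    (((l1.const_mul L).add ((l2.pow 2).div_const _)).add_const C) fun n => ?_
  · have h0 : Tendsto (fun n => ‖(1 / 2 : ℝ)‖ₑ * eLpNorm (fun x => φ n x - t x) 2 arcLength
        + ‖(1 / 2 : ℝ)‖ₑ * eLpNorm (fun x => φ n (ζ * x) - t x) 2 arcLength) atTop (𝓝 0) := by
      have := (ENNReal.Tendsto.const_mul (a := ‖(1 / 2 : ℝ)‖ₑ) h3 (Or.inr enorm_ne_top)).add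
        (ENNReal.Tendsto.const_mul (a := ‖(1 / 2 : ℝ)‖ₑ) h4 (Or.inr enorm_ne_top))
      simpa only [mul_zero, add_zero] using this
    refine tendsto_of_tendsto_of_tendsto_of_le_of_le tendsto_const_nhds h0
      (fun _ => zero_le) fun n => ?_
    refine (eLpNorm_half_add_sub_le (hc n).continuous.aestronglyMeasurable
      (hc' n).continuous.aestronglyMeasurable (ht.1.const_mul _)).trans ?_
    rw [eLpNorm_const_mul_sub, eLpNorm_const_mul_sub _ _ (fun x => φ n (ζ * x))]
  · refine (h (fun x => 1 / 2 * φ n x) (hc n) (l2Norm (φ n)) (l2Norm (gradient (φ n)) ^ 2 / 4)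
      (l2Norm_nonneg _) (by positivity) ?_ ?_).trans (le_of_eq ?_)
    · rw [ofReal_l2Norm (memLp_area (hφ n).continuous)]
      refine eLpNorm_mono fun x => ?_
      rw [norm_mul]
      refine mul_le_of_le_one_left (norm_nonneg _) ?_
      norm_num
    · have hfd : ∀ z, ‖fderiv ℝ (fun x => 1 / 2 * φ n x) z‖ₑ ^ 2
          = ENNReal.ofReal (1 / 4) * ‖fderiv ℝ (φ n) z‖ₑ ^ 2 := by
        intro z
        rw [fderiv_const_mul ((hφ n).differentiable (by simp) z), enorm_smul_dual, mul_pow,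
          Real.enorm_of_nonneg (by norm_num), ← ENNReal.ofReal_pow (by norm_num)]
        norm_num
      simp only [hfd]
      rw [lintegral_const_mul' _ _ ENNReal.ofReal_ne_top, lintegral_fderiv_sq (hφ n),
        ← ENNReal.ofReal_mul (by norm_num)]
      refine ENNReal.ofReal_le_ofReal (le_of_eq ?_)
      ring
    · congr 3
      field_simp
      ring

end Rotation

/-! ### A nontrivial rotation in the group -/

/-- Otherwise every nontrivial element is a reflection `x ↦ a * conj x`. Such a map fixes a square
root `b` of `a`, so some other element moves `b`; it is a different reflection, and the product of
the two is a nontrivial rotation. -/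
theorem exists_mul_mem {G : Subgroup (ℂ ≃ₗᵢ[ℝ] ℂ)}
    (hG : ∀ x ∈ Metric.sphere (0 : ℂ) 1, ∃ g ∈ G, g x ≠ x) :
    ∃ ζ : ℂ, ‖ζ‖ = 1 ∧ ζ ≠ 1 ∧ ∃ g ∈ G, ∀ x, g x = ζ * x := by
  by_contra! hno
  have refl : ∀ g ∈ G, (∃ y, g y ≠ y) → ∃ a : Circle, ∀ x, g x = a * (starRingEnd ℂ) x := by
    intro g hg ⟨y, hy⟩
    obtain ⟨a, ha | ha⟩ := linear_isometry_complex g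
    · exfalso
      have hga : ∀ x, g x = a * x := fun x => by rw [ha, rotation_apply]
      obtain ⟨x, hx⟩ := hno a (Circle.norm_coe a) (fun h1 => hy (by rw [hga, h1, one_mul])) g hg
      exact hx (hga x)
    · exact ⟨a, fun x => by rw [ha]; simp⟩
  obtain ⟨g, hg, hg1⟩ := hG 1 (by simp)
  obtain ⟨a, ha⟩ := refl g hg ⟨1, hg1⟩
  obtain ⟨b, hb, hba⟩ : ∃ b : ℂ, ‖b‖ = 1 ∧ b * b = a := by
    refine ⟨Complex.exp ((Complex.arg a / 2 : ℝ) * Complex.I), Complex.norm_exp_ofReal_mul_I _, ?_⟩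
    rw [← Complex.exp_add]
    have := Complex.norm_mul_exp_arg_mul_I (a : ℂ)
    rw [Circle.norm_coe, Complex.ofReal_one, one_mul] at this
    refine Eq.trans ?_ this
    congr 1
    push_cast
    ring
  have hbb : b * (starRingEnd ℂ) b = 1 := by
    rw [Complex.mul_conj, Complex.normSq_eq_norm_sq, hb]
    norm_num
  obtain ⟨g', hg', hgb⟩ := hG b (by simpa using hb)
  obtain ⟨a', ha'⟩ := refl g' hg' ⟨b, hgb⟩
  have haa : (a : ℂ) * (starRingEnd ℂ) (a : ℂ) = 1 := by
    rw [Complex.mul_conj, Complex.normSq_eq_norm_sq, Circle.norm_coe]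
    norm_num
  have hne : (a' : ℂ) * (starRingEnd ℂ) (a : ℂ) ≠ 1 := fun h1 => hgb <| by
    have : (a' : ℂ) = a := by
      calc (a' : ℂ) = a' * ((a : ℂ) * (starRingEnd ℂ) (a : ℂ)) := by rw [haa, mul_one]
        _ = (a' * (starRingEnd ℂ) (a : ℂ)) * a := by ring
        _ = a := by rw [h1, one_mul]
    rw [ha', this, ← hba, mul_assoc, hbb, mul_one]
  obtain ⟨x, hx⟩ := hno (a' * (starRingEnd ℂ) (a : ℂ))
    (by rw [norm_mul, RCLike.norm_conj, Circle.norm_coe, Circle.norm_coe, mul_one]) hne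
    (g' * g) (G.mul_mem hg' hg)
  refine hx ?_
  rw [LinearIsometryEquiv.coe_mul, Function.comp_apply, ha', ha, map_mul, Complex.conj_conj,
    mul_assoc]

/-! ### Norms, logarithmic bounds and the lower bound for the functional -/

theorem ofReal_integral_norm_sq {E : Type*} [NormedAddCommGroup E] {μ : Measure ℂ} {f : ℂ → E}
    (hf : MemLp f 2 μ) : ENNReal.ofReal (∫ x, ‖f x‖ ^ 2 ∂μ) = eLpNorm f 2 μ ^ 2 := by
  rw [eLpNorm_two_sq, ofReal_integral_eq_lintegral_ofReal (hf.integrable_norm_pow (by norm_num))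
    (Eventually.of_forall fun x => sq_nonneg _)]
  refine lintegral_congr fun x => ?_
  rw [ENNReal.ofReal_pow (norm_nonneg _), ofReal_norm]

theorem integral_norm_sq_area {E : Type*} [NormedAddCommGroup E] {f : ℂ → E}
    (hf : MemLp f 2 area) : ∫ x, ‖f x‖ ^ 2 ∂area = l2Norm f ^ 2 := by
  rw [l2Norm, ← ENNReal.toReal_pow, ← ofReal_integral_norm_sq hf,
    ENNReal.toReal_ofReal (integral_nonneg fun x => sq_nonneg _)]

theorem h1Norm_sq {u : ℂ → ℝ} (hu : MemH1 u) :
    h1Norm u ^ 2 = l2Norm u ^ 2 + l2Norm (weakGradient u) ^ 2 := by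
  have h1 : ∫ x, u x ^ 2 ∂area = l2Norm u ^ 2 := by
    rw [← integral_norm_sq_area hu.1]
    simp
  rw [h1Norm, h1, integral_norm_sq_area (isWeakGradient_weakGradient hu).1,
    Real.sq_sqrt (by positivity)]

theorem h1Norm_nonneg (u : ℂ → ℝ) : 0 ≤ h1Norm u := Real.sqrt_nonneg _

theorem l2Norm_le_h1Norm {u : ℂ → ℝ} (hu : MemH1 u) : l2Norm u ≤ h1Norm u :=
  (sq_le_sq₀ (l2Norm_nonneg _) (h1Norm_nonneg u)).1
    (by rw [h1Norm_sq hu]; exact le_add_of_nonneg_right (sq_nonneg _))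

theorem l2Norm_weakGradient_le_h1Norm {u : ℂ → ℝ} (hu : MemH1 u) :
    l2Norm (weakGradient u) ≤ h1Norm u :=
  (sq_le_sq₀ (l2Norm_nonneg _) (h1Norm_nonneg u)).1
    (by rw [h1Norm_sq hu]; exact le_add_of_nonneg_left (sq_nonneg _))

/-- Among the translates of `u` by constants, the one of mean zero has the least `L²` norm. -/
theorem eLpNorm_le_eLpNorm_sub_const {u : ℂ → ℝ} (hu : MemLp u 2 area)
    (h0 : ∫ x, u x ∂area = 0) (c : ℝ) :
    eLpNorm u 2 area ≤ eLpNorm (fun x => u x - c) 2 area := by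
  have hc : MemLp (fun x => u x - c) 2 area := hu.sub (memLp_const c)
  rw [← ENNReal.pow_le_pow_left_iff two_ne_zero, ← ofReal_integral_norm_sq hu,
    ← ofReal_integral_norm_sq hc]
  refine ENNReal.ofReal_le_ofReal ?_
  have hui : Integrable u area := hu.integrable (by norm_num)
  have hus : Integrable (fun x => ‖u x‖ ^ 2) area := hu.integrable_norm_pow (by norm_num)
  have e : ∀ x, ‖u x - c‖ ^ 2 = ‖u x‖ ^ 2 - 2 * c * u x + c ^ 2 := fun x => by
    simp only [Real.norm_eq_abs, sq_abs]
    ring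
  have e' : ∫ x, (‖u x‖ ^ 2 - 2 * c * u x + c ^ 2) ∂area
      = ∫ x, (‖u x‖ ^ 2 - 2 * c * u x) ∂area + ∫ _, c ^ 2 ∂area :=
    integral_add (hus.sub (hui.const_mul _)) (integrable_const _)
  simp only [e]
  rw [e', integral_sub hus (hui.const_mul _), integral_const_mul, h0, integral_const, smul_eq_mul]
  have : 0 ≤ area.real univ * c ^ 2 := by positivity
  linarith

/-- The Poincaré inequality on the disk. -/
theorem l2Norm_le_of_integral_eq_zero {u : ℂ → ℝ} (hu : MemH1 u) (h0 : ∫ x, u x ∂area = 0) :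
    l2Norm u ≤ 4 * l2Norm (weakGradient u) := by
  have hw := isWeakGradient_weakGradient hu
  obtain ⟨-, φ, hφ, h1, h2, -⟩ := isTrace_boundaryTrace hu
  have l2 := tendsto_eLpNorm_of_sub
    (fun n => (continuous_gradient (hφ n)).aestronglyMeasurable) hw.1 h2
  have hle : ∀ n, eLpNorm u 2 area
      ≤ eLpNorm (fun x => φ n x - u x) 2 area + 4 * eLpNorm (gradient (φ n)) 2 area := by
    intro n
    -- This is the mean of `φ n`; as `u` has mean zero, subtracting it from `u` can only increase
    -- the norm.
    set c := ⨍ y, φ n y ∂area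
    have hp : eLpNorm (fun x => φ n x - c) 2 area ≤ 4 * eLpNorm (gradient (φ n)) 2 area := by
      refine eLpNorm_two_le_of_sq_le ((lintegral_sub_average_sq_le (hφ n)).trans (le_of_eq ?_))
      rw [mul_pow, eLpNorm_gradient]
      norm_num
    have e : (fun x => u x - c) = (fun x => φ n x - c) - fun x => φ n x - u x := by
      funext x
      simp
    have hφm := (hφ n).continuous.aestronglyMeasurable (μ := area)
    calc eLpNorm u 2 area ≤ eLpNorm (fun x => u x - c) 2 area :=
          eLpNorm_le_eLpNorm_sub_const hu.1 h0 c
      _ ≤ eLpNorm (fun x => φ n x - c) 2 area + eLpNorm (fun x => φ n x - u x) 2 area := by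
          rw [e]
          exact eLpNorm_sub_le (hφm.sub aestronglyMeasurable_const) (hφm.sub hu.1.1) (by norm_num)
      _ ≤ _ := by
          rw [add_comm]
          exact add_le_add_right hp _
  have hlim := h1.add (ENNReal.Tendsto.const_mul (a := 4) l2 (Or.inr (by norm_num)))
  rw [zero_add] at hlim
  have := ge_of_tendsto' hlim hle
  rw [← ofReal_l2Norm hu.1, ← ofReal_l2Norm hw.1, show (4 : ℝ≥0∞) = ENNReal.ofReal 4 by simp,
    ← ENNReal.ofReal_mul (by norm_num)] at this
  exact (ENNReal.ofReal_le_ofReal_iff (mul_nonneg (by norm_num) (l2Norm_nonneg _))).1 this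

theorem log_integral_mul_exp_le {μ : Measure ℂ} {k v : ℂ → ℝ} {M E : ℝ} (hM : 0 < M)
    (hk : ∀ᵐ x ∂μ, ‖k x‖ ≤ M)
    (h : ∫⁻ x, ENNReal.ofReal (Real.exp (v x)) ∂μ ≤ ENNReal.ofReal (Real.exp E))
    (hpos : 0 < ∫ x, k x * Real.exp (v x) ∂μ) :
    Real.log (∫ x, k x * Real.exp (v x) ∂μ) ≤ Real.log M + E := by
  rw [← Real.log_exp E, ← Real.log_mul hM.ne' (Real.exp_pos E).ne']
  refine Real.log_le_log hpos ?_
  have h1 : ENNReal.ofReal (∫ x, k x * Real.exp (v x) ∂μ) ≤ ENNReal.ofReal (M * Real.exp E) := by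
    calc ENNReal.ofReal (∫ x, k x * Real.exp (v x) ∂μ)
        = ‖∫ x, k x * Real.exp (v x) ∂μ‖ₑ := (Real.enorm_of_nonneg hpos.le).symm
      _ ≤ ∫⁻ x, ‖k x * Real.exp (v x)‖ₑ ∂μ := enorm_integral_le_lintegral_enorm _
      _ ≤ ∫⁻ x, ENNReal.ofReal M * ENNReal.ofReal (Real.exp (v x)) ∂μ := by
          refine lintegral_mono_ae (hk.mono fun x hx => ?_)
          rw [enorm_mul, Real.enorm_of_nonneg (Real.exp_pos _).le, ← ofReal_norm]
          gcongr
      _ = ENNReal.ofReal M * ∫⁻ x, ENNReal.ofReal (Real.exp (v x)) ∂μ :=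
          lintegral_const_mul' _ _ ENNReal.ofReal_ne_top
      _ ≤ _ := by
          rw [ENNReal.ofReal_mul hM.le]
          gcongr
  exact (ENNReal.ofReal_le_ofReal_iff (by positivity)).1 h1

theorem exists_abs_integral_boundaryTrace_le :
    ∃ T : ℝ, 0 ≤ T ∧ ∀ u : ℂ → ℝ, MemH1 u →
      |∫ x, boundaryTrace u x ∂arcLength| ≤ T * h1Norm u := by
  set T := Real.sqrt (arcLength univ).toReal with hT
  refine ⟨T * 4, by positivity, fun u hu => ?_⟩
  have hw := isWeakGradient_weakGradient hu
  have ht := (isTrace_boundaryTrace hu).1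
  have hn := l2Norm_nonneg u
  have hn' := l2Norm_nonneg (weakGradient u)
  have h1 : ‖∫ x, boundaryTrace u x ∂arcLength‖ₑ ^ 2
      ≤ ENNReal.ofReal ((T * (2 * (l2Norm u + l2Norm (weakGradient u)))) ^ 2) := by
    calc _ ≤ (∫⁻ x, ‖boundaryTrace u x‖ₑ ∂arcLength) ^ 2 := by
          gcongr
          exact enorm_integral_le_lintegral_enorm _
      _ ≤ arcLength univ * ∫⁻ x, ‖boundaryTrace u x‖ₑ ^ 2 ∂arcLength :=
          sq_lintegral_le _ ht.1.enorm
      _ ≤ ENNReal.ofReal (T ^ 2) * (2 * (eLpNorm u 2 area + eLpNorm (weakGradient u) 2 area)) ^ 2 := by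
          rw [← eLpNorm_two_sq, hT, Real.sq_sqrt ENNReal.toReal_nonneg,
            ENNReal.ofReal_toReal (measure_ne_top _ _)]
          gcongr
          exact eLpNorm_boundaryTrace_le hu
      _ = _ := by
          rw [← ofReal_l2Norm hu.1, ← ofReal_l2Norm hw.1, ← ENNReal.ofReal_add hn hn',
            show (2 : ℝ≥0∞) = ENNReal.ofReal 2 by simp, ← ENNReal.ofReal_mul (by norm_num),
            ← ENNReal.ofReal_pow (by positivity), ← ENNReal.ofReal_mul (by positivity), ← mul_pow]
  rw [← ofReal_norm, ← ENNReal.ofReal_pow (norm_nonneg _),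
    ENNReal.ofReal_le_ofReal_iff (sq_nonneg _)] at h1
  have h2 := (sq_le_sq₀ (norm_nonneg _) (by positivity)).1 h1
  rw [Real.norm_eq_abs] at h2
  refine h2.trans ?_
  rw [mul_assoc]
  refine mul_le_mul_of_nonneg_left ?_ (Real.sqrt_nonneg _)
  linarith [l2Norm_le_h1Norm hu, l2Norm_weakGradient_le_h1Norm hu]

theorem exists_norm_le_of_continuousOn {k : ℂ → ℝ} {s : Set ℂ} (hs : IsCompact s)
    (hk : ContinuousOn k s) : ∃ M, 1 ≤ M ∧ ∀ x ∈ s, ‖k x‖ ≤ M := by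
  obtain ⟨M, hM⟩ := hs.exists_bound_of_continuousOn hk
  exact ⟨max M 1, le_max_right _ _, fun x hx => (hM x hx).trans (le_max_left _ _)⟩

theorem neg_one_le_mul_log {x : ℝ} (hx : 0 ≤ x) : -1 ≤ x * Real.log x := by
  rcases hx.eq_or_lt with rfl | hx
  · simp
  · have := mul_le_mul_of_nonneg_left (Real.one_sub_inv_le_log_of_pos hx) hx.le
    rw [mul_sub, mul_one, mul_inv_cancel₀ hx.ne'] at this
    linarith

/-- The two logarithms cost `ρ B² / (6π)` and `(2π - ρ) B² / (6π)`, with `B` the `L²` norm of the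
gradient; the sum `B² / 3` does not depend on `ρ` and leaves `B² / 6`. All other terms are linear in
the norm or bounded, uniformly in `ρ`. -/
theorem exists_le_I {G : Subgroup (ℂ ≃ₗᵢ[ℝ] ℂ)}
    (hG : ∀ x ∈ Metric.sphere (0 : ℂ) 1, ∃ g ∈ G, g x ≠ x) {K h : ℂ → ℝ}
    (hK : ContinuousOn K (Metric.closedBall (0 : ℂ) 1))
    (hh : ContinuousOn h (Metric.sphere (0 : ℂ) 1)) :
    ∃ C₁ : ℝ, 0 < C₁ ∧ ∃ C₂ : ℝ, 0 < C₂ ∧ ∃ C : ℝ,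
      ∀ ρ ∈ Set.Icc (0 : ℝ) (2 * Real.pi), ∀ u ∈ XG G K h,
        ∫ x, u x ∂area = 0 → C₁ * h1Norm u ^ 2 - C₂ * h1Norm u + C ≤ I K h ρ u := by
  obtain ⟨ζ, hζ, hζ1, g, hg, hgζ⟩ := exists_mul_mem hG
  obtain ⟨L₁, c₁, hL₁, H₁⟩ := exists_lintegral_exp_area_le_of_memH1 hζ hζ1
  obtain ⟨L₂, c₂, hL₂, H₂⟩ := exists_lintegral_exp_boundaryTrace_le hζ hζ1
  obtain ⟨T, hT, H₃⟩ := exists_abs_integral_boundaryTrace_le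
  obtain ⟨M₁, hM₁, hKM⟩ := exists_norm_le_of_continuousOn (isCompact_closedBall 0 1) hK
  obtain ⟨M₂, hM₂, hhM⟩ := exists_norm_le_of_continuousOn (isCompact_sphere 0 1) hh
  have hpi := Real.pi_pos
  set d₁ := Real.log M₁ + |c₁| with hd₁
  set d₂ := Real.log M₂ + |c₂| with hd₂
  have hd₁0 : 0 ≤ d₁ := add_nonneg (Real.log_nonneg hM₁) (abs_nonneg _)
  have hd₂0 : 0 ≤ d₂ := add_nonneg (Real.log_nonneg hM₂) (abs_nonneg _)
  -- `102 = 6 * 17`: the remaining `1 / 6` of the energy, and `17` from the Poincaré inequality. The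
  -- `+ 1` makes `C₂` positive, and `6 = 4 + 2` comes from `x log x ≥ -1`.
  refine ⟨1 / 102, by norm_num, 4 * Real.pi * L₁ + 8 * Real.pi * L₂ + 2 * T + 1, by positivity,
    -(4 * Real.pi * d₁ + 8 * Real.pi * d₂ + 6), fun ρ hρ u hu hu0 => ?_⟩
  obtain ⟨⟨hu1, hm₁, hm₂⟩, hinv⟩ := hu
  have hinv' : (fun x => u (ζ * x)) =ᵐ[area] u := by simpa only [hgζ] using hinv g hg
  have hN0 := h1Norm_nonneg u
  have hA := l2Norm_le_h1Norm hu1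
  have hsq := h1Norm_sq hu1
  have hP := l2Norm_le_of_integral_eq_zero hu1 hu0
  have hA0 := l2Norm_nonneg u
  have hw := isWeakGradient_weakGradient hu1
  have hlog₁ := log_integral_mul_exp_le (μ := area) (k := K) (M := M₁) (by linarith) (by
    filter_upwards [ae_restrict_mem Metric.isOpen_ball.measurableSet] with x hx
    exact hKM x (Metric.ball_subset_closedBall hx)) (H₁ u hu1 hinv') hm₁
  have hlog₂ := log_integral_mul_exp_le (μ := arcLength) (k := h) (M := M₂) (by linarith) (by
    filter_upwards [ae_arcLength_norm] with x hx
    exact hhM x (by simpa using hx)) (H₂ u hu1 hinv') hm₂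
  have ht := (abs_le.1 (H₃ u hu1)).1
  have hx₁ := neg_one_le_mul_log hρ.1
  have hx₂ := neg_one_le_mul_log (sub_nonneg.2 hρ.2)
  rw [I, integral_norm_sq_area hw.1, bulkMass, boundaryMass]
  set B := l2Norm (weakGradient u) with hB
  set A := l2Norm u with hAdef
  set N := h1Norm u with hN
  set b₁ := Real.log (∫ x, K x * Real.exp (u x) ∂area)
  set b₂ := Real.log (∫ x, h x * Real.exp (boundaryTrace u x / 2) ∂arcLength)
  have hb₁ : b₁ ≤ L₁ * N + B ^ 2 / (12 * Real.pi) + d₁ := by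
    have := mul_le_mul_of_nonneg_left hA hL₁
    linarith [le_abs_self c₁]
  have hb₂ : b₂ ≤ L₂ * N + B ^ 2 / (24 * Real.pi) + d₂ := by
    have := mul_le_mul_of_nonneg_left hA hL₂
    linarith [le_abs_self c₂]
  obtain ⟨hρ0, hρ1⟩ := hρ
  have k₁ : 2 * ρ * b₁ ≤ 4 * Real.pi * (L₁ * N + d₁) + ρ * (B ^ 2 / (6 * Real.pi)) := by
    calc 2 * ρ * b₁ ≤ 2 * ρ * (L₁ * N + B ^ 2 / (12 * Real.pi) + d₁) := by gcongr
      _ = 2 * ρ * (L₁ * N + d₁) + ρ * (B ^ 2 / (6 * Real.pi)) := by field_simp; ring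
      _ ≤ _ := by
        have : 2 * ρ * (L₁ * N + d₁) ≤ 4 * Real.pi * (L₁ * N + d₁) :=
          mul_le_mul_of_nonneg_right (by linarith) (by positivity)
        linarith
  have k₂ : 4 * (2 * Real.pi - ρ) * b₂
      ≤ 8 * Real.pi * (L₂ * N + d₂) + (2 * Real.pi - ρ) * (B ^ 2 / (6 * Real.pi)) := by
    have hr : 0 ≤ 2 * Real.pi - ρ := by linarith
    calc 4 * (2 * Real.pi - ρ) * b₂
        ≤ 4 * (2 * Real.pi - ρ) * (L₂ * N + B ^ 2 / (24 * Real.pi) + d₂) := by gcongr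
      _ = 4 * (2 * Real.pi - ρ) * (L₂ * N + d₂) + (2 * Real.pi - ρ) * (B ^ 2 / (6 * Real.pi)) := by
        field_simp
        ring
      _ ≤ _ := by
        have : 4 * (2 * Real.pi - ρ) * (L₂ * N + d₂) ≤ 8 * Real.pi * (L₂ * N + d₂) :=
          mul_le_mul_of_nonneg_right (by linarith) (by positivity)
        linarith
  have k₃ : ρ * (B ^ 2 / (6 * Real.pi)) + (2 * Real.pi - ρ) * (B ^ 2 / (6 * Real.pi))
      = B ^ 2 / 3 := by
    field_simp
    ring
  -- `N² = A² + B²` and `A ≤ 4 B` by Poincaré.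
  have k₄ : N ^ 2 ≤ 17 * B ^ 2 := by nlinarith
  nlinarith

/-- The changes `-2ρ c`, `+4π c` and `-4(2π - ρ) c / 2` add up to zero. -/
theorem XG_add_const {G : Subgroup (ℂ ≃ₗᵢ[ℝ] ℂ)} {K h u : ℂ → ℝ} (hu : u ∈ XG G K h) (c ρ : ℝ) :
    (fun x => u x + c) ∈ XG G K h ∧ I K h ρ (fun x => u x + c) = I K h ρ u := by
  obtain ⟨⟨hu1, hm₁, hm₂⟩, hinv⟩ := hu
  have e₁ : bulkMass K (fun x => u x + c) = Real.exp c * bulkMass K u := by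
    rw [bulkMass, bulkMass, ← integral_const_mul]
    refine integral_congr_ae (Eventually.of_forall fun x => ?_)
    simp only [Real.exp_add]
    ring
  have htr := boundaryTrace_add_const hu1 c
  have e₂ : boundaryMass h (fun x => u x + c) = Real.exp (c / 2) * boundaryMass h u := by
    rw [boundaryMass, boundaryMass, ← integral_const_mul]
    refine integral_congr_ae (htr.mono fun x hx => ?_)
    simp only [hx, add_div, Real.exp_add]
    ring
  refine ⟨⟨⟨hu1.add_const c, ?_, ?_⟩, fun g hg => ?_⟩, ?_⟩
  · rw [e₁]
    exact mul_pos (Real.exp_pos _) hm₁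
  · rw [e₂]
    exact mul_pos (Real.exp_pos _) hm₂
  · filter_upwards [hinv g hg] with x hx
    rw [hx]
  · have e₃ : ∫ x, ‖weakGradient (fun x => u x + c) x‖ ^ 2 ∂area
        = ∫ x, ‖weakGradient u x‖ ^ 2 ∂area :=
      integral_congr_ae ((weakGradient_add_const hu1 c).mono fun x hx => by simp only [hx])
    have hti : Integrable (boundaryTrace u) arcLength :=
      (isTrace_boundaryTrace hu1).1.integrable (by norm_num)
    have harc : arcLength.real univ = 2 * Real.pi := by
      rw [measureReal_def, arcLength, Measure.map_apply (by fun_prop) MeasurableSet.univ]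
      simp [Real.pi_pos.le]
    have e₄ : ∫ x, boundaryTrace (fun x => u x + c) x ∂arcLength
        = (∫ x, boundaryTrace u x ∂arcLength) + 2 * Real.pi * c := by
      rw [integral_congr_ae htr, integral_add hti (integrable_const _), integral_const, harc,
        smul_eq_mul]
    rw [I, I, e₁, e₂, e₃, e₄, Real.log_mul (Real.exp_pos _).ne' hm₁.ne',
      Real.log_mul (Real.exp_pos _).ne' hm₂.ne', Real.log_exp, Real.log_exp]
    ring

end

end DiskCurvature

/-! ### The theorem -/

theorem mainTheorem4
    (G : Subgroup (ℂ ≃ₗᵢ[ℝ] ℂ))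
    (hG : ∀ x ∈ Metric.sphere (0 : ℂ) 1, ∃ g ∈ G, g x ≠ x)
    (K h : ℂ → ℝ)
    (hK : ContinuousOn K (Metric.closedBall (0 : ℂ) 1))
    (hh : ContinuousOn h (Metric.sphere (0 : ℂ) 1))
    (hKG : ∀ g ∈ G, ∀ x ∈ Metric.closedBall (0 : ℂ) 1, K (g x) = K x)
    (hhG : ∀ g ∈ G, ∀ x ∈ Metric.sphere (0 : ℂ) 1, h (g x) = h x) :
    -- invariance of the space and of the functional under the addition of constants
    (∀ ρ ∈ Set.Icc (0 : ℝ) (2 * Real.pi), ∀ u ∈ DiskCurvature.XG G K h, ∀ c : ℝ,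
      (fun x => u x + c) ∈ DiskCurvature.XG G K h ∧
      DiskCurvature.I K h ρ (fun x => u x + c) = DiskCurvature.I K h ρ u) ∧
    -- coercivity modulo constants
    (∀ ρ ∈ Set.Icc (0 : ℝ) (2 * Real.pi), ∀ M : ℝ, ∃ R : ℝ, ∀ u ∈ DiskCurvature.XG G K h,
      R ≤ DiskCurvature.h1Norm (fun x => u x - ⨍ y, u y ∂DiskCurvature.area) →
      M ≤ DiskCurvature.I K h ρ u) ∧
    -- the quantitative estimate for normalized functions, uniform in the parameter
    (∃ C₁ : ℝ, 0 < C₁ ∧ ∃ C₂ : ℝ, 0 < C₂ ∧ ∃ C : ℝ,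
      ∀ ρ ∈ Set.Icc (0 : ℝ) (2 * Real.pi), ∀ u ∈ DiskCurvature.XG G K h,
        ∫ x, u x ∂DiskCurvature.area = 0 →
        C₁ * DiskCurvature.h1Norm u ^ 2 - C₂ * DiskCurvature.h1Norm u + C
          ≤ DiskCurvature.I K h ρ u) := by
  obtain ⟨C₁, hC₁, C₂, hC₂, C, hC⟩ := DiskCurvature.exists_le_I hG hK hh
  refine ⟨fun ρ _ u hu c => DiskCurvature.XG_add_const hu c ρ, fun ρ hρ M => ?_,
    C₁, hC₁, C₂, hC₂, C, hC⟩
  -- This `R` forces `C₁ N - C₂ ≥ |M - C|`, and the `+ 1` forces `N ≥ 1`, so that `N (C₁ N - C₂) ≥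
  -- |M - C|`.
  refine ⟨(C₂ + |M - C|) / C₁ + 1, fun u hu hR => ?_⟩
  -- Subtracting the mean changes neither membership nor the value of the functional, and reduces to
  -- the normalized estimate.
  obtain ⟨hv, hI⟩ := DiskCurvature.XG_add_const hu (-⨍ y, u y ∂DiskCurvature.area) ρ
  simp only [← sub_eq_add_neg] at hv hI
  have h0 : ∫ x, (u x - ⨍ y, u y ∂DiskCurvature.area) ∂DiskCurvature.area = 0 :=
    MeasureTheory.integral_sub_average _ _
  have key := hC ρ hρ _ hv h0
  rw [hI] at key
  refine le_trans ?_ key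
  generalize DiskCurvature.h1Norm (fun x => u x - ⨍ y, u y ∂DiskCurvature.area) = N at hR
  have h1 : 0 ≤ (C₂ + |M - C|) / C₁ := by positivity
  have h2 : C₂ + |M - C| ≤ C₁ * N := by
    rw [← div_le_iff₀' hC₁]
    linarith
  have h3 : |M - C| ≤ N * (C₁ * N - C₂) := by
    nlinarith [abs_nonneg (M - C)]
  nlinarith [le_abs_self (M - C)]
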